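/- Let $M$ be a compact smooth Riemannian manifold without boundary, with Riemannian norm $\|\cdot\|$ and Riemannian distance $\mathrm{d}$, and let $f\colon M\to M$ be a $C^1$ diffeomorphism. Fix a dense sequence $(\varphi_m)_{m\ge 0}$ in $C(M,\mathbb{R})$ and, for Borel probability measures $\mu,\nu$ on $M$, put $$\mathrm{d}(\mu,\nu)=\sum_{m\ge 0}\frac{|\int\varphi_m\,d\mu-\int\varphi_m\,d\nu|}{2^{m+1}\|\varphi_m\|_\infty}$$ (terms with $\varphi_m=0$ are read as $0$). Let $\Lambda\subset M$ be compact with $f(\Lambda)=\Lambda$, and let $T_\Lambda M=E\oplus F$ be a dominated splitting: $E,F$ are continuous $Df$-invariant subbundles of constant rank and, for some continuous Riemannian metric $\|\cdot\|'$ on $M$, $\|Df|_{E(x)}\|'\cdot\|Df^{-1}|_{F(f(x))}\|'<\frac12$ for all $x\in\Lambda$. For $\lambda\in(0,1)$ let $$\Lambda_\lambda=\Big\{x\in\Lambda:\ \prod_{i=0}^{n-1}\|Df|_{E(f^i(x))}\|\le\lambda^n,\ \ \prod_{i=0}^{n-1}\|Df^{-1}|_{F(f^{-i}(x))}\|\le\lambda^n\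 \text{ for all } n\in\mathbb{N}\Big\}.$$ Then for every $\varepsilon>0$ there is $\eta_0>0$ such that the following holds for all integers $n\ge1$, $k\ge1$, all $\eta\in(0,\eta_0)$ and all pairwise distinct points $p_1,\dots,p_k\in\Lambda_\lambda$ with $f^n(p_i)=p_i$. Suppose that $\mathrm{d}(p_i,p_j)<\eta$ for $1\le i<j\le k$ and that $\{p_1,\dots,p_k\}$ is $(n,16\eta)$-separated, i.e. for $i\neq j$ there is $l\in\{0,\dots,n\}$ with $\mathrm{d}(f^l(p_i),f^l(p_j))\ge16\eta$. Then there is a hyperbolic set $K$ of $f$ of index $\dim E$, that is, a compact set with $f(K)=K$ and a $Df$-invariant splitting $T_KM=E^s\oplus E^u$ with $E^s$ uniformly contracted, $E^u$ uniformly expanded and $\dim E^s=\dim E$, such that - $h_{top}(f|_K)\ge\frac{\log k}{n}$; - every $f$-invariant Borel probability measure $\nu$ with $\nu(K)=1$ satisfies $\mathrm{d}(\nu,\mu)<\varepsilon$ for some $\mu=\sum_{i=1}^k\alpha_i\delta_{\mathcal{O}_{p_i}}$ with $\alpha_i\ge0$ and $\sum_i\alpha_i=1$, where $\delta_{\mathcal{O}_{p_i}}$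 is the uniform probability measure on the orbit of $p_i$. -/

import Mathlib

open Bundle
open scoped Manifold ContDiff Bundle NNReal ENNReal

noncomputable section

namespace DominatedHorseshoe

section Smooth

variable {d : ℕ} {M : Type*} [TopologicalSpace M] [ChartedSpace (EuclideanSpace ℝ (Fin d)) M]

/-- `‖Df|_{E(x)}‖`: the operator norm of the restriction of the derivative of `f` at `x` to the
subspace `E x` of the tangent space, for the given Riemannian metric. -/
def derivNormOn [RiemannianBundle (fun x : M => TangentSpace (𝓡 d) x)]
    (f : M → M) (E : (x : M) → Submodule ℝ (TangentSpace (𝓡 d) x)) (x : M) : ℝ :=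
  ‖(mfderiv (𝓡 d) (𝓡 d) f x).comp (E x).subtypeL‖

/-- `T_K M = E ⊕ F` is a splitting over `K` into `Df`-invariant subbundles, with `E` of
rank `s`. Only the values of `E` and `F` at the points of `K` matter. -/
structure IsInvariantSplitting (f : M → M) (K : Set M)
    (E F : (x : M) → Submodule ℝ (TangentSpace (𝓡 d) x)) (s : ℕ) : Prop where
  isCompl : ∀ x ∈ K, IsCompl (E x) (F x)
  finrank_eq : ∀ x ∈ K, Module.finrank ℝ (E x) = s
  map_left : ∀ x ∈ K,
    (E x).map (mfderiv (𝓡 d) (𝓡 d) f x : TangentSpace (𝓡 d) x →ₗ[ℝ] TangentSpace (𝓡 d) (f x))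
      = E (f x)
  map_right : ∀ x ∈ K,
    (F x).map (mfderiv (𝓡 d) (𝓡 d) f x : TangentSpace (𝓡 d) x →ₗ[ℝ] TangentSpace (𝓡 d) (f x))
      = F (f x)

/-- The pair `E`, `F` is continuous over `K`: the projection onto `E x` along `F x`, as a section
of the bundle of endomorphisms of the tangent spaces, depends continuously on `x ∈ K`. -/
def IsContinuousPair [IsManifold (𝓡 d) ∞ M] (K : Set M)
    (E F : (x : M) → Submodule ℝ (TangentSpace (𝓡 d) x)) : Prop :=
  ∃ P : (x : M) → TangentSpace (𝓡 d) x →L[ℝ] TangentSpace (𝓡 d) x,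
    (∀ x ∈ K, (∀ v ∈ E x, P x v = v) ∧ ∀ v ∈ F x, P x v = 0) ∧
    ContinuousOn (fun x : M => Bundle.TotalSpace.mk'
      (EuclideanSpace ℝ (Fin d) →L[ℝ] EuclideanSpace ℝ (Fin d))
      (E := fun x : M => TangentSpace (𝓡 d) x →L[ℝ] TangentSpace (𝓡 d) x) x (P x)) K

/-- `T_K M = E ⊕ F` is a dominated splitting of the diffeomorphism `f` over `K`, with `E` of
rank `s`: it is continuous, invariant, and for some continuous Riemannian metric on `M` (not
necessarily the given one)
`‖Df|_{E(x)}‖ * ‖Df⁻¹|_{F(f x)}‖ < 1/2` for all `x ∈ K`. -/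
structure IsDominatedSplitting [IsManifold (𝓡 d) ∞ M] (f : M ≃ₘ^1⟮𝓡 d, 𝓡 d⟯ M) (K : Set M)
    (E F : (x : M) → Submodule ℝ (TangentSpace (𝓡 d) x)) (s : ℕ) : Prop where
  invariant : IsInvariantSplitting f K E F s
  continuous : IsContinuousPair K E F
  dominated : ∃ g : Bundle.ContinuousRiemannianMetric (EuclideanSpace ℝ (Fin d))
      (fun x : M => TangentSpace (𝓡 d) x),
    letI : RiemannianBundle (fun x : M => TangentSpace (𝓡 d) x) := ⟨g.toRiemannianMetric⟩
    ∀ x ∈ K, derivNormOn f E x * derivNormOn f.symm F (f x) < 1 / 2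

/-- The Pesin block of the points of `Λ` along whose forward orbit `E` is contracted, and along
whose backward orbit `F` is contracted by `f⁻¹`, at the uniform rate `lam` from time `0` on. -/
def pesinBlock [RiemannianBundle (fun x : M => TangentSpace (𝓡 d) x)]
    (f : M ≃ₘ^1⟮𝓡 d, 𝓡 d⟯ M) (Λ : Set M)
    (E F : (x : M) → Submodule ℝ (TangentSpace (𝓡 d) x)) (lam : ℝ) : Set M :=
  {x | x ∈ Λ ∧ ∀ n : ℕ,
    ∏ i ∈ Finset.range n, derivNormOn f E (f^[i] x) ≤ lam ^ n ∧
    ∏ i ∈ Finset.range n, derivNormOn f.symm F (f.symm^[i] x) ≤ lam ^ n}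

/-- `K` is a hyperbolic set of `f` of index `s`: it is compact and invariant, and
`T_K M = Es ⊕ Eu` with `Es` of rank `s`, uniformly contracted by `f`, and `Eu` uniformly
expanded by `f`. -/
def IsHyperbolicSet [RiemannianBundle (fun x : M => TangentSpace (𝓡 d) x)]
    (f : M ≃ₘ^1⟮𝓡 d, 𝓡 d⟯ M) (K : Set M) (s : ℕ) : Prop :=
  IsCompact K ∧ f '' K = K ∧
  ∃ Es Eu : (x : M) → Submodule ℝ (TangentSpace (𝓡 d) x),
    IsInvariantSplitting f K Es Eu s ∧
    ∃ C : ℝ, 0 < C ∧ ∃ κ : ℝ, 0 < κ ∧ κ < 1 ∧ ∀ x ∈ K, ∀ n : ℕ,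
      (∀ v ∈ Es x, ‖mfderiv (𝓡 d) (𝓡 d) (f^[n]) x v‖ ≤ C * κ ^ n * ‖v‖) ∧
      (∀ v ∈ Eu x, ‖v‖ ≤ C * κ ^ n * ‖mfderiv (𝓡 d) (𝓡 d) (f^[n]) x v‖)

end Smooth

/-- `S` is `(n, r)`-separated: any two different points of `S` are at distance at least `r` from
each other at some time `j ∈ {0, …, n}`. -/
def IsSeparatedSet {M : Type*} [EMetricSpace M] (f : M → M) (n : ℕ) (r : ℝ) (S : Set M) : Prop :=
  ∀ x ∈ S, ∀ y ∈ S, x ≠ y → ∃ j ≤ n, ENNReal.ofReal r ≤ edist (f^[j] x) (f^[j] y)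

section Measures

variable {M : Type*} [MeasurableSpace M]

open MeasureTheory

/-- The periodic measure of a periodic point `p`: the uniform probability measure on its orbit. -/
def periodicMeasure (f : M → M) (p : M) : Measure M :=
  (Function.minimalPeriod f p : ℝ≥0∞)⁻¹ •
    ∑ j ∈ Finset.range (Function.minimalPeriod f p), Measure.dirac (f^[j] p)

/-- `Cov(p_1, …, p_k)`: the convex combinations of the periodic measures of the `p i`. -/
def periodicHull (f : M → M) {k : ℕ} (p : Fin k → M) : Set (Measure M) :=
  {μ | ∃ α : Fin k → ℝ≥0, ∑ i, α i = 1 ∧ μ = ∑ i, α i • periodicMeasure f (p i)}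

/-- The distance `∑ₙ |∫ φₙ dμ - ∫ φₙ dν| / (2ⁿ⁺¹ ‖φₙ‖)` on probability measures (a term with
`φₙ = 0` is `0`). For a dense sequence `φ` it induces the weak-* topology. -/
def weakDist [TopologicalSpace M] [CompactSpace M] (φ : ℕ → C(M, ℝ)) (μ ν : Measure M) : ℝ :=
  ∑' n : ℕ, |(∫ x, φ n x ∂μ) - ∫ x, φ n x ∂ν| / (2 ^ (n + 1) * ‖φ n‖)

/-- The `f`-invariant probability measures supported on `K`. -/
def invariantMeasuresOn (f : M → M) (K : Set M) : Set (Measure M) :=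
  {ν | IsProbabilityMeasure ν ∧ MeasurePreserving f ν ν ∧ ν K = 1}

end Measures

end DominatedHorseshoe

end

/-! Every concatenation of the orbit segments of the `p i` should be shadowed by an orbit, and the
shadowing orbits should be hyperbolic. The difficulty is that the Pesin conditions control `E` and
`F` only from time `0`: in the middle of a segment neither contraction of `E` nor expansion of `F`
is guaranteed, and `f` is only `C¹`.

Fix `N` so large that an iterate of length at least `N` beats the constants lost in changing charts,
and cut each segment into blocks of length between `N` and `2 * N`. By periodicity both Pesin
conditions apply to the same segment: `E` is contracted from its start on, and `F` is contracted by
the inverse from its end backwards. Let `p` be the normalised product of the `E`-norms of the blocks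
already crossed, `b` that of the inverse `F`-norms of the blocks still to come, and `g = max p b`
(`exists_weights`). Domination, which makes the product of the two norms of a block small, implies
that every block is hyperbolic at a fixed rate for the norms divided by `g`. Moreover `g` is `1` at
both ends, so jumps between different segments cost nothing; `g ≤ 1`, so rescaled balls stay inside
chart balls of uniform size; and `g` has a bounded ratio across each block, so the error of the
linear approximation, at most `ζ * ‖v‖`, is absorbed with one uniform `ζ`. This homogeneity is what
makes `C¹` regularity sufficient.

The result is a finite network of hyperbolic maps (`IsNetwork`, built in
`IsDominatedData.exists_network`) in which the end of each segment leads to the start of all the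
others. All its dynamics follows from the relation `HypPair` between a vector and its image. A
contraction argument shadows every periodic word within `δ` (`IsNetwork.exists_isShadowed`), and
expansivity shows that two of the periodic points whose orbits stay within `3 * δ` are equal
(`IsNetwork.eq_of_edist_le`). The set `K` is the hull `shadowHull` of all points that `δ`-shadow
some word, which is compact and invariant.

On `K` the stable and unstable spaces consist of the tangent vectors with bounded future or past.
Cones provide subspaces of the right dimensions, and no nonzero vector is bounded in both directions
(`IsNetwork.isHyperbolicSet`). The `k ^ L` periodic words of period `L` give points separated within
time `n * L`, hence the entropy bound (`log_div_le_coverEntropy`). An invariant measure on `K` is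
split according to the segment being followed, and replacing each orbit piece by the segment it
shadows gives a convex combination of the periodic measures (`exists_convex_combination`).

If `n < N`, the period `n * N` is used instead. Closeness at time `0` then persists for a whole
period, so expansivity forces `k = 1` and the entropy bound is trivial. -/

open Bundle Set Filter Topology
open scoped Manifold ContDiff Bundle NNReal ENNReal

noncomputable section

namespace DominatedHorseshoe

/-! ### Hyperbolic pairs of vectors and invariant cones -/

section SplitNorm

variable {V : Type*} [NormedAddCommGroup V] [NormedSpace ℝ V]

/-- The maximum of the norms of the two components of `v` in the splitting given by `P`. -/
def splitNorm (P : V →L[ℝ] V) (v : V) : ℝ := max ‖P v‖ ‖v - P v‖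

theorem splitNorm_nonneg (P : V →L[ℝ] V) (v : V) : 0 ≤ splitNorm P v :=
  le_max_of_le_left (norm_nonneg _)

theorem norm_apply_le_splitNorm (P : V →L[ℝ] V) (v : V) : ‖P v‖ ≤ splitNorm P v := le_max_left _ _

theorem norm_sub_apply_le_splitNorm (P : V →L[ℝ] V) (v : V) : ‖v - P v‖ ≤ splitNorm P v :=
  le_max_right _ _

theorem norm_le_two_mul_splitNorm (P : V →L[ℝ] V) (v : V) : ‖v‖ ≤ 2 * splitNorm P v := by
  have h : ‖v‖ ≤ ‖P v‖ + ‖v - P v‖ := by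
    simpa using norm_add_le (P v) (v - P v)
  linarith [norm_apply_le_splitNorm P v, norm_sub_apply_le_splitNorm P v]

theorem splitNorm_le {P : V →L[ℝ] V} {C : ℝ} (hP : ∀ v, ‖P v‖ ≤ C * ‖v‖) (v : V) :
    splitNorm P v ≤ (C + 1) * ‖v‖ := by
  have h1 := hP v
  have h2 := norm_sub_le v (P v)
  have h3 := norm_nonneg v
  refine max_le ?_ ?_ <;> nlinarith

@[simp] theorem splitNorm_zero (P : V →L[ℝ] V) : splitNorm P 0 = 0 := by simp [splitNorm]

theorem continuous_splitNorm (P : V →L[ℝ] V) : Continuous (splitNorm P) := by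
  unfold splitNorm; fun_prop

theorem eq_zero_of_splitNorm_nonpos {P : V →L[ℝ] V} {v : V} (h : splitNorm P v ≤ 0) : v = 0 := by
  have := norm_le_two_mul_splitNorm P v
  exact norm_le_zero_iff.1 (by linarith)

/-- The pair `(v, v')` of a vector and its image behaves as under a map that contracts strongly the
range of the projection `P`, and that expands strongly its kernel, with approximate inverse `B` on
the kernel; `g` and `g'` are the scales of the norms in the source and in the target. -/
def HypPair (P P' B : V →L[ℝ] V) (g g' : ℝ) (v v' : V) : Prop :=
  ‖P' v'‖ / g' ≤ splitNorm P v / g / 2 ∧ ‖v - P v - B v'‖ / g ≤ splitNorm P v / g / 4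

/-- `B` is a strong contraction from the kernel of `P'` to the kernel of `P`. -/
structure IsBackward (P P' B : V →L[ℝ] V) (g g' : ℝ) : Prop where
  apply_eq_zero : ∀ w, P (B w) = 0
  injective : ∀ w, B w = 0 → P' w = w
  norm_le : ∀ w, ‖B w‖ / g ≤ ‖w - P' w‖ / g' / 4

/-- The kernel component of `v` is almost `B v'`, so it is controlled backwards by the kernel
component of `v'`. Together with the forward control of `P' v'` this is the only source of the
estimates below. -/
theorem HypPair.splitNorm_le {P P' B : V →L[ℝ] V} {g g' : ℝ} (hg : 0 < g) {v v' : V}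
    (hB : IsBackward P P' B g g') (h : HypPair P P' B g g' v v') :
    ‖v - P v‖ / g ≤ splitNorm P v / g / 4 + ‖v' - P' v'‖ / g' / 4 := by
  have h1 := h.2
  have h2 := hB.norm_le v'
  have h3 : ‖v - P v‖ / g ≤ ‖v - P v - B v'‖ / g + ‖B v'‖ / g := by
    rw [← add_div]
    gcongr
    simpa using norm_add_le (v - P v - B v') (B v')
  linarith

/-- The complement of the stable cone is mapped into itself and expanded. -/
theorem HypPair.expand {P P' B : V →L[ℝ] V} {g g' : ℝ} (hg : 0 < g) (hg' : 0 < g') {v v' : V}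
    (hB : IsBackward P P' B g g') (h : HypPair P P' B g g' v v') (hv : ‖P v‖ ≤ ‖v - P v‖) :
    ‖P' v'‖ ≤ ‖v' - P' v'‖ ∧ 3 * (splitNorm P v / g) ≤ splitNorm P' v' / g' := by
  have h1 := HypPair.splitNorm_le hg hB h
  have h2 : splitNorm P v = ‖v - P v‖ := max_eq_right hv
  have h3 := h.1
  have h0 : 0 ≤ splitNorm P v / g := div_nonneg (splitNorm_nonneg _ _) hg.le
  have h4 : 3 * (splitNorm P v / g) ≤ ‖v' - P' v'‖ / g' := by
    rw [← h2] at h1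
    linarith
  refine ⟨?_, h4.trans ?_⟩
  · rw [← div_le_div_iff_of_pos_right hg']
    linarith
  · gcongr
    exact norm_sub_apply_le_splitNorm _ _

/-- The stable cone is mapped into itself by the inverse, which expands it. -/
theorem HypPair.contract {P P' B : V →L[ℝ] V} {g g' : ℝ} (hg : 0 < g) (hg' : 0 < g') {v v' : V}
    (hB : IsBackward P P' B g g') (h : HypPair P P' B g g' v v') (hv : ‖v' - P' v'‖ ≤ ‖P' v'‖) :
    ‖v - P v‖ ≤ ‖P v‖ ∧ splitNorm P' v' / g' ≤ splitNorm P v / g / 2 := by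
  have h2 : splitNorm P' v' = ‖P' v'‖ := max_eq_left hv
  refine ⟨?_, h2 ▸ h.1⟩
  by_contra! h5
  have h6 := HypPair.expand hg hg' hB h h5.le
  have h0 : 0 ≤ splitNorm P v / g := div_nonneg (splitNorm_nonneg _ _) hg.le
  have h7 := h.1
  rw [h2] at h6
  have h8 : splitNorm P v / g ≤ 0 := by linarith
  have h9 : splitNorm P v ≤ 0 := by
    by_contra! h10
    exact absurd h8 (not_le.2 (div_pos h10 hg))
  have := norm_sub_apply_le_splitNorm P v
  have := norm_nonneg (P v)
  linarith

end SplitNorm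

/-! ### Uniqueness and existence of cyclic orbits of hyperbolic maps -/

section CyclicOrbits

variable {V : Type*} [NormedAddCommGroup V] [NormedSpace ℝ V]
  {ι : Type*} [Fintype ι]

/-- Two cyclic orbits whose differences form hyperbolic pairs are equal. -/
theorem cyclic_orbit_unique (σ : Equiv.Perm ι) (P B : ι → V →L[ℝ] V) (g : ι → ℝ)
    (hg : ∀ j, 0 < g j)
    (hB : ∀ j, IsBackward (P j) (P (σ j)) (B j) (g j) (g (σ j))) (v : ι → V)
    (h : ∀ j, HypPair (P j) (P (σ j)) (B j) (g j) (g (σ j)) (v j) (v (σ j))) (j : ι) :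
    v j = 0 := by
  have hne : (Finset.univ : Finset ι).Nonempty := ⟨j, Finset.mem_univ j⟩
  -- Where the rescaled norm is maximal, the range component is at most half of the maximum by the
  -- predecessor, and the kernel component at most a quarter plus a quarter by the vector itself and
  -- its successor.
  obtain ⟨i, -, hi⟩ := Finset.exists_max_image Finset.univ
    (fun j => splitNorm (P j) (v j) / g j) hne
  set m := splitNorm (P i) (v i) / g i with hm
  have h1 : ‖P i (v i)‖ / g i ≤ m / 2 := by
    have h2 := (h (σ.symm i)).1
    have h3 := hi (σ.symm i) (Finset.mem_univ _)
    simp only [Equiv.apply_symm_apply] at h2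
    linarith
  have h2 : ‖v i - P i (v i)‖ / g i ≤ m / 2 := by
    have h3 := HypPair.splitNorm_le (hg i) (hB i) (h i)
    have h4 := hi (σ i) (Finset.mem_univ _)
    have h5 : ‖v (σ i) - P (σ i) (v (σ i))‖ / g (σ i) ≤ splitNorm (P (σ i)) (v (σ i)) / g (σ i) :=
      div_le_div_of_nonneg_right (norm_sub_apply_le_splitNorm _ _) (hg _).le
    linarith
  have h3 : m ≤ m / 2 := by
    have h4 : m = max (‖P i (v i)‖ / g i) (‖v i - P i (v i)‖ / g i) := by
      rw [hm, splitNorm, max_div_div_right (hg i).le]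
    exact h4.trans_le (max_le h1 h2)
  have h4 : splitNorm (P j) (v j) / g j ≤ 0 := (hi j (Finset.mem_univ _)).trans (by linarith)
  apply eq_zero_of_splitNorm_nonpos (P := P j)
  by_contra! h10
  exact absurd h4 (not_le.2 (div_pos h10 (hg j)))

/-- A cyclic pseudo-orbit of uniformly hyperbolic maps is shadowed by a cyclic orbit. -/
theorem exists_cyclic_orbit [FiniteDimensional ℝ V] [Nonempty ι] (σ : Equiv.Perm ι)
    (P B : ι → V →L[ℝ] V) (g : ι → ℝ) (hg : ∀ j, 0 < g j) (hP : ∀ j v, P j (P j v) = P j v)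
    (hB : ∀ j, IsBackward (P j) (P (σ j)) (B j) (g j) (g (σ j))) (F : ι → V → V)
    {r : ℝ} (hr : 0 ≤ r)
    (hFc : ∀ j, ContinuousOn (F j) {v | splitNorm (P j) v / g j ≤ r})
    (hF : ∀ j u v, splitNorm (P j) u / g j ≤ r → splitNorm (P j) v / g j ≤ r →
      HypPair (P j) (P (σ j)) (B j) (g j) (g (σ j)) (u - v) (F j u - F j v))
    (hF0 : ∀ j, splitNorm (P (σ j)) (F j 0) / g (σ j) ≤ r / 2) :
    ∃ v : ι → V, ∀ j, splitNorm (P j) (v j) / g j ≤ r ∧ F j (v j) = v (σ j) := by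
  classical
  -- Graph transform: the range component is pushed forward from the predecessor, and the kernel
  -- component is corrected by pulling the defect at the successor back with `B`. Its fixed points
  -- are exactly the cyclic orbits, and it halves rescaled distances.
  let T : (ι → V) → ι → V := fun v j =>
    P j (F (σ.symm j) (v (σ.symm j))) + (v j - P j (v j)) + B j (v (σ j) - F j (v j))
  let D : Set (ι → V) := Set.univ.pi fun j => {v | splitNorm (P j) v / g j ≤ r}
  have hPT : ∀ v j, P j (T v j) = P j (F (σ.symm j) (v (σ.symm j))) := by
    intro v j
    simp only [T, map_add, map_sub, hP, (hB j).apply_eq_zero, sub_self, add_zero]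
  have hQT : ∀ v j, T v j - P j (T v j) = (v j - P j (v j)) + B j (v (σ j) - F j (v j)) := by
    intro v j
    rw [hPT]
    simp only [T]
    abel
  have key : ∀ u ∈ D, ∀ v ∈ D, ∀ m : ℝ, (∀ j, splitNorm (P j) (u j - v j) / g j ≤ m) →
      ∀ j, splitNorm (P j) (T u j - T v j) / g j ≤ m / 2 := by
    intro u hu v hv m hm j
    have hu' : ∀ j, splitNorm (P j) (u j) / g j ≤ r := fun j => hu j (mem_univ j)
    have hv' : ∀ j, splitNorm (P j) (v j) / g j ≤ r := fun j => hv j (mem_univ j)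
    rw [splitNorm, ← max_div_div_right (hg j).le]
    refine max_le ?_ ?_
    · have h2 := (hF (σ.symm j) _ _ (hu' _) (hv' _)).1
      have h3 := hm (σ.symm j)
      simp only [Equiv.apply_symm_apply, map_sub] at h2
      rw [map_sub, hPT, hPT]
      linarith
    · have h2 := (hF j _ _ (hu' _) (hv' _)).2
      have h3 := hm j
      have h4 := hm (σ j)
      have h5 := (hB j).norm_le (u (σ j) - v (σ j))
      have h6 : ‖(u (σ j) - v (σ j)) - P (σ j) (u (σ j) - v (σ j))‖ / g (σ j) ≤ m :=
        (div_le_div_of_nonneg_right (norm_sub_apply_le_splitNorm _ _) (hg _).le).trans h4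
      have h7 : T u j - T v j - P j (T u j - T v j) =
          ((u j - v j) - P j (u j - v j) - B j (F j (u j) - F j (v j)))
            + B j (u (σ j) - v (σ j)) := by
        have : T u j - T v j - P j (T u j - T v j) =
          (T u j - P j (T u j)) - (T v j - P j (T v j)) := by
          rw [map_sub]; abel
        rw [this, hQT, hQT]
        simp only [map_sub]
        abel
      have h8 := norm_add_le ((u j - v j) - P j (u j - v j) - B j (F j (u j) - F j (v j)))
        (B j (u (σ j) - v (σ j)))
      rw [← h7] at h8
      have h9 := div_le_div_of_nonneg_right h8 (hg j).le
      rw [add_div] at h9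
      linarith
  have hD0 : (0 : ι → V) ∈ D := fun j _ => by simpa using hr
  have hT0 : ∀ j, splitNorm (P j) (T 0 j) / g j ≤ r / 2 := by
    intro j
    rw [splitNorm, ← max_div_div_right (hg j).le]
    refine max_le ?_ ?_
    · rw [hPT]
      have h := hF0 (σ.symm j)
      simp only [Equiv.apply_symm_apply] at h
      exact (div_le_div_of_nonneg_right (norm_apply_le_splitNorm _ _) (hg _).le).trans h
    · rw [hQT]
      have h5 := (hB j).norm_le (F j 0)
      have h6 := (div_le_div_of_nonneg_right (norm_sub_apply_le_splitNorm (P (σ j)) (F j 0))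
        (hg (σ j)).le).trans (hF0 j)
      simp only [Pi.zero_apply, map_zero, sub_zero, zero_sub, zero_add, map_neg, norm_neg]
      linarith
  have hTD : ∀ v ∈ D, T v ∈ D := by
    intro v hv j _
    have h1 := key v hv 0 hD0 r (fun j => by simpa using hv j (mem_univ j)) j
    have h2 := hT0 j
    have h3 : splitNorm (P j) (T v j) ≤ splitNorm (P j) (T v j - T 0 j) + splitNorm (P j) (T 0 j) := by
      refine max_le ?_ ?_
      · calc ‖P j (T v j)‖ = ‖P j (T v j - T 0 j) + P j (T 0 j)‖ := by simp
          _ ≤ _ := (norm_add_le _ _).trans (add_le_add (norm_apply_le_splitNorm _ _)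
            (norm_apply_le_splitNorm _ _))
      · calc ‖T v j - P j (T v j)‖
            = ‖(T v j - T 0 j - P j (T v j - T 0 j)) + (T 0 j - P j (T 0 j))‖ := by
              congr 1; rw [map_sub]; abel
          _ ≤ _ := (norm_add_le _ _).trans (add_le_add (norm_sub_apply_le_splitNorm _ _)
            (norm_sub_apply_le_splitNorm _ _))
    have h4 := div_le_div_of_nonneg_right h3 (hg j).le
    rw [add_div] at h4
    show splitNorm (P j) (T v j) / g j ≤ r
    linarith
  have hDc : IsCompact D := by
    refine isCompact_univ_pi fun j => ?_
    refine IsCompact.of_isClosed_subset (isCompact_closedBall (0 : V) (2 * (r * g j))) ?_ ?_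
    · exact isClosed_le ((continuous_splitNorm _).div_const _) continuous_const
    · intro v hv
      have h1 : splitNorm (P j) v ≤ r * g j := (div_le_iff₀ (hg j)).1 hv
      have h2 := norm_le_two_mul_splitNorm (P j) v
      rw [mem_closedBall_zero_iff]
      linarith
  have hTc : ∀ j, ContinuousOn (fun v => T v j) D := by
    intro j
    have h1 : ∀ i, ContinuousOn (fun v : ι → V => F i (v i)) D := fun i =>
      (hFc i).comp (continuous_apply i).continuousOn fun v hv => hv i (mem_univ i)
    have h2 : ∀ i, ContinuousOn (fun v : ι → V => v i) D := fun i =>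
      (continuous_apply i).continuousOn
    exact (((P j).continuous.comp_continuousOn (h1 _)).add
      ((h2 j).sub ((P j).continuous.comp_continuousOn (h2 j)))).add
      ((B j).continuous.comp_continuousOn ((h2 _).sub (h1 _)))
  -- The largest rescaled displacement attains its minimum `m` on the compact set `D`. Applying `T`
  -- halves the displacement, so `m ≤ m / 2` and the minimiser is a fixed point.
  have hcont : ContinuousOn (fun v => Finset.univ.sup' Finset.univ_nonempty
      fun j => splitNorm (P j) (T v j - v j) / g j) D := by
    apply ContinuousOn.finset_sup'_apply
    intro j _
    exact ((continuous_splitNorm (P j)).comp_continuousOn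
      ((hTc j).sub (continuous_apply j).continuousOn)).div_const _
  obtain ⟨v, hv, hmin⟩ := hDc.exists_isMinOn ⟨0, hD0⟩ hcont
  set m := Finset.univ.sup' Finset.univ_nonempty fun j => splitNorm (P j) (T v j - v j) / g j
    with hm
  have h1 : ∀ j, splitNorm (P j) (T v j - v j) / g j ≤ m := fun j =>
    Finset.le_sup' (fun j => splitNorm (P j) (T v j - v j) / g j) (Finset.mem_univ j)
  have h2 : m ≤ m / 2 := by
    refine (hmin (hTD v hv)).trans ?_
    exact Finset.sup'_le _ _ fun j _ => key _ (hTD v hv) _ hv m h1 j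
  have hfix : ∀ j, T v j = v j := by
    intro j
    have h3 : splitNorm (P j) (T v j - v j) / g j ≤ 0 := (h1 j).trans (by linarith)
    have := eq_zero_of_splitNorm_nonpos (P := P j) (v := T v j - v j) (by
      by_contra! h10
      exact absurd h3 (not_le.2 (div_pos h10 (hg j))))
    exact sub_eq_zero.1 this
  refine ⟨v, fun j => ⟨hv j (mem_univ j), ?_⟩⟩
  have h3 : P (σ j) (F j (v j)) = P (σ j) (v (σ j)) := by
    have := hPT v (σ j)
    rw [hfix] at this
    simpa using this.symm
  -- The defect has zero range component by `h3`; being killed by `B`, it equals its range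
  -- component, so it vanishes.
  have h4 : B j (v (σ j) - F j (v j)) = 0 := by
    have := hQT v j
    rw [hfix] at this
    simpa using this
  have h5 := (hB j).injective _ h4
  rw [map_sub, h3, sub_self] at h5
  exact (sub_eq_zero.1 h5.symm).symm

end CyclicOrbits

/-! ### Bounded orbits lie in cones and decay geometrically -/

section LinearCocycles

variable {V : Type*} [NormedAddCommGroup V] [NormedSpace ℝ V]

theorem nonpos_of_geometric_growth {u : ℕ → ℝ} {C c : ℝ} (hc : 1 < c) (hu : ∀ j, u j ≤ C)
    (h : ∀ j, c * u j ≤ u (j + 1)) : u 0 ≤ 0 := by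
  by_contra! h0
  have h1 : ∀ j, c ^ j * u 0 ≤ u j := by
    intro j
    induction j with
    | zero => simp
    | succ j ih =>
      refine le_trans ?_ (h j)
      rw [pow_succ']
      nlinarith
  obtain ⟨j, hj⟩ := pow_unbounded_of_one_lt (C / u 0) hc
  rw [div_lt_iff₀ h0] at hj
  linarith [h1 j, hu j]

theorem norm_apply_pos_of_lt {P : V →L[ℝ] V} {v : V} {g : ℝ} (hg : 0 < g)
    (h : ‖P v‖ < ‖v - P v‖ ∨ ‖v - P v‖ < ‖P v‖) : 0 < splitNorm P v / g := by
  refine div_pos ?_ hg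
  have h1 := norm_apply_le_splitNorm P v
  have h2 := norm_sub_apply_le_splitNorm P v
  have h3 := norm_nonneg (P v)
  have h4 := norm_nonneg (v - P v)
  rcases h with h | h <;> linarith

/-- A bounded forward orbit stays in the stable cones. -/
theorem forward_bounded_cone {P B : ℕ → V →L[ℝ] V} {g : ℕ → ℝ} (hg : ∀ j, 0 < g j)
    (hB : ∀ j, IsBackward (P j) (P (j + 1)) (B j) (g j) (g (j + 1))) {v : ℕ → V}
    (h : ∀ j, HypPair (P j) (P (j + 1)) (B j) (g j) (g (j + 1)) (v j) (v (j + 1)))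
    {C : ℝ} (hC : ∀ j, splitNorm (P j) (v j) / g j ≤ C) (j : ℕ) :
    ‖v j - P j (v j)‖ ≤ ‖P j (v j)‖ := by
  by_contra! h0
  have h1 : ∀ i, ‖P (j + i) (v (j + i))‖ ≤ ‖v (j + i) - P (j + i) (v (j + i))‖ := by
    intro i
    induction i with
    | zero => exact h0.le
    | succ i ih => exact ((h (j + i)).expand (hg _) (hg _) (hB _) ih).1
  have h2 := nonpos_of_geometric_growth (c := 3) (by norm_num) (fun i => hC (j + i))
    (fun i => ((h (j + i)).expand (hg _) (hg _) (hB _) (h1 i)).2)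
  exact absurd h2 (not_le.2 (norm_apply_pos_of_lt (hg j) (Or.inl h0)))

/-- Boundedness keeps the orbit in the stable cones, and there each step halves the rescaled norm.
-/
theorem forward_bounded_contract {P B : ℕ → V →L[ℝ] V} {g : ℕ → ℝ} (hg : ∀ j, 0 < g j)
    (hB : ∀ j, IsBackward (P j) (P (j + 1)) (B j) (g j) (g (j + 1))) {v : ℕ → V}
    (h : ∀ j, HypPair (P j) (P (j + 1)) (B j) (g j) (g (j + 1)) (v j) (v (j + 1)))
    {C : ℝ} (hC : ∀ j, splitNorm (P j) (v j) / g j ≤ C) (j : ℕ) :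
    splitNorm (P j) (v j) / g j ≤ (1 / 2) ^ j * (splitNorm (P 0) (v 0) / g 0) := by
  induction j with
  | zero => simp
  | succ j ih =>
    have := ((h j).contract (hg _) (hg _) (hB _) (forward_bounded_cone hg hB h hC (j + 1))).2
    rw [pow_succ]
    linarith

/-- A bounded backward orbit stays in the unstable cones. -/
theorem backward_bounded_cone {P B : ℕ → V →L[ℝ] V} {g : ℕ → ℝ} (hg : ∀ j, 0 < g j)
    (hB : ∀ j, IsBackward (P (j + 1)) (P j) (B j) (g (j + 1)) (g j)) {v : ℕ → V}
    (h : ∀ j, HypPair (P (j + 1)) (P j) (B j) (g (j + 1)) (g j) (v (j + 1)) (v j))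
    {C : ℝ} (hC : ∀ j, splitNorm (P j) (v j) / g j ≤ C) (j : ℕ) :
    ‖P j (v j)‖ ≤ ‖v j - P j (v j)‖ := by
  by_contra! h0
  have h1 : ∀ i, ‖v (j + i) - P (j + i) (v (j + i))‖ ≤ ‖P (j + i) (v (j + i))‖ := by
    intro i
    induction i with
    | zero => exact h0.le
    | succ i ih => exact ((h (j + i)).contract (hg _) (hg _) (hB _) ih).1
  have h2 := nonpos_of_geometric_growth (c := 2) (by norm_num) (fun i => hC (j + i))
    (fun i => by
      have := ((h (j + i)).contract (hg _) (hg _) (hB _) (h1 i)).2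
      rw [← add_assoc]
      linarith)
  exact absurd h2 (not_le.2 (norm_apply_pos_of_lt (hg j) (Or.inr h0)))

theorem backward_bounded_contract {P B : ℕ → V →L[ℝ] V} {g : ℕ → ℝ} (hg : ∀ j, 0 < g j)
    (hB : ∀ j, IsBackward (P (j + 1)) (P j) (B j) (g (j + 1)) (g j)) {v : ℕ → V}
    (h : ∀ j, HypPair (P (j + 1)) (P j) (B j) (g (j + 1)) (g j) (v (j + 1)) (v j))
    {C : ℝ} (hC : ∀ j, splitNorm (P j) (v j) / g j ≤ C) (j : ℕ) :
    splitNorm (P j) (v j) / g j ≤ (1 / 2) ^ j * (splitNorm (P 0) (v 0) / g 0) := by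
  induction j with
  | zero => simp
  | succ j ih =>
    have h1 := ((h j).expand (hg _) (hg _) (hB _) (backward_bounded_cone hg hB h hC (j + 1))).2
    have h2 : 0 ≤ splitNorm (P (j + 1)) (v (j + 1)) / g (j + 1) :=
      div_nonneg (splitNorm_nonneg _ _) (hg _).le
    rw [pow_succ]
    linarith

end LinearCocycles

/-! ### Stable and unstable subspaces by compactness -/

section Cones

variable {V : Type*} [NormedAddCommGroup V] [InnerProductSpace ℝ V] [FiniteDimensional ℝ V]

/-- If each set of a decreasing sequence of closed sets contains a subspace of dimension `s`, then
so does the intersection. -/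
theorem exists_submodule_subset_iInter {C : ℕ → Set V} (hC : ∀ m, IsClosed (C m))
    (hanti : ∀ m, C (m + 1) ⊆ C m) {s : ℕ}
    (h : ∀ m, ∃ W : Submodule ℝ V, Module.finrank ℝ W = s ∧ (W : Set V) ⊆ C m) :
    ∃ W : Submodule ℝ V, Module.finrank ℝ W = s ∧ ∀ m, (W : Set V) ⊆ C m := by
  -- Subspaces are encoded by orthonormal frames, which form a compact set; containment of the span
  -- in `C m` is a closed condition on the frame.
  let S : ℕ → Set (Fin s → V) := fun m =>
    {b | Orthonormal ℝ b} ∩ {b | ∀ c : Fin s → ℝ, ∑ i, c i • b i ∈ C m}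
  have hO : IsClosed {b : Fin s → V | Orthonormal ℝ b} := by
    simp only [orthonormal_iff_ite, ofPred_forall]
    refine isClosed_iInter fun i => isClosed_iInter fun j => isClosed_eq ?_ continuous_const
    fun_prop
  have hcl : ∀ m, IsClosed (S m) := fun m => hO.inter (by
    rw [ofPred_forall]
    exact isClosed_iInter fun c => (hC m).preimage (by fun_prop))
  obtain ⟨b, hb⟩ := IsCompact.nonempty_iInter_of_sequence_nonempty_isCompact_isClosed S
    (fun m => by
      rintro b ⟨h1, h2⟩
      exact ⟨h1, fun c => hanti m (h2 c)⟩)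
    (fun m => by
      obtain ⟨W, hW, hWC⟩ := h m
      let e := (stdOrthonormalBasis ℝ W).reindex (finCongr hW)
      refine ⟨fun i => (e i : V), ?_, fun c => hWC ?_⟩
      · exact e.orthonormal.comp_linearIsometry W.subtypeₗᵢ
      · exact W.sum_mem fun i _ => W.smul_mem _ (e i).2)
    (by
      refine IsCompact.of_isClosed_subset
        (isCompact_univ_pi fun _ : Fin s => isCompact_closedBall (0 : V) 1) (hcl 0) ?_
      rintro b ⟨h1, -⟩ i -
      simp [h1.1 i])
    hcl
  rw [mem_iInter] at hb
  refine ⟨Submodule.span ℝ (range b), ?_, fun m => ?_⟩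
  · rw [finrank_span_eq_card (hb 0).1.linearIndependent, Fintype.card_fin]
  · intro w hw
    obtain ⟨c, rfl⟩ := (Submodule.mem_span_range_iff_exists_fun ℝ).1 hw
    exact (hb m).2 c

/-- The preimage under `Φ m` of the range of `P m` has dimension `s`, and by backward invariance of
the stable cones it lies in the cones at all times up to `m`. Compactness then lets `m` tend to
infinity. The unstable case is the same with kernels and forward invariance of the unstable cones.
-/
theorem exists_stable_subspace {P B : ℕ → V →L[ℝ] V} {g : ℕ → ℝ} (hg : ∀ j, 0 < g j)
    (hB : ∀ j, IsBackward (P j) (P (j + 1)) (B j) (g j) (g (j + 1)))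
    (hP : ∀ j v, P j (P j v) = P j v) {s : ℕ}
    (hs : ∀ j, Module.finrank ℝ (LinearMap.range (P j : V →ₗ[ℝ] V)) = s) (Φ : ℕ → V ≃L[ℝ] V)
    (h : ∀ j v, HypPair (P j) (P (j + 1)) (B j) (g j) (g (j + 1)) (Φ j v) (Φ (j + 1) v)) :
    ∃ W : Submodule ℝ V, Module.finrank ℝ W = s ∧
      ∀ w ∈ W, ∀ j, ‖Φ j w - P j (Φ j w)‖ ≤ ‖P j (Φ j w)‖ := by
  obtain ⟨W, hW, hWC⟩ := exists_submodule_subset_iInter (s := s)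
    (C := fun m => {w : V | ∀ i ≤ m, ‖Φ i w - P i (Φ i w)‖ ≤ ‖P i (Φ i w)‖})
    (fun m => by
      simp only [ofPred_forall]
      exact isClosed_iInter fun i => isClosed_iInter fun _ => isClosed_le (by fun_prop)
        (by fun_prop))
    (fun m w hw i hi => hw i (hi.trans m.le_succ))
    (fun m => by
      refine ⟨(LinearMap.range (P m : V →ₗ[ℝ] V)).map
        ((Φ m).symm.toLinearEquiv : V →ₗ[ℝ] V), ?_, ?_⟩
      · rw [← hs m]
        exact LinearEquiv.finrank_map_eq (Φ m).symm.toLinearEquiv _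
      · rintro w ⟨u, ⟨x, rfl⟩, rfl⟩
        have h0 : ∀ k ≤ m, ∀ w, Φ m w = P m x → ‖Φ (m - k) w - P (m - k) (Φ (m - k) w)‖
            ≤ ‖P (m - k) (Φ (m - k) w)‖ := by
          intro k hk w hw
          induction k with
          | zero => simp [hw, hP]
          | succ k ih =>
            have h1 := ih (by omega)
            have h2 := h (m - (k + 1)) w
            have h3 := hB (m - (k + 1))
            rw [show m - (k + 1) + 1 = m - k by omega] at h2 h3
            exact (h2.contract (hg _) (hg _) h3 h1).1
        intro i hi
        have := h0 (m - i) (by omega) ((Φ m).symm (P m x)) (by simp)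
        rwa [show m - (m - i) = i by omega] at this)
  exact ⟨W, hW, fun w hw j => hWC j hw j le_rfl⟩

theorem exists_unstable_subspace {P B : ℕ → V →L[ℝ] V} {g : ℕ → ℝ} (hg : ∀ j, 0 < g j)
    (hB : ∀ j, IsBackward (P (j + 1)) (P j) (B j) (g (j + 1)) (g j))
    {s : ℕ}
    (hs : ∀ j, Module.finrank ℝ (LinearMap.ker (P j : V →ₗ[ℝ] V)) = s) (Φ : ℕ → V ≃L[ℝ] V)
    (h : ∀ j v, HypPair (P (j + 1)) (P j) (B j) (g (j + 1)) (g j) (Φ (j + 1) v) (Φ j v)) :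
    ∃ W : Submodule ℝ V, Module.finrank ℝ W = s ∧
      ∀ w ∈ W, ∀ j, ‖P j (Φ j w)‖ ≤ ‖Φ j w - P j (Φ j w)‖ := by
  obtain ⟨W, hW, hWC⟩ := exists_submodule_subset_iInter (s := s)
    (C := fun m => {w : V | ∀ i ≤ m, ‖P i (Φ i w)‖ ≤ ‖Φ i w - P i (Φ i w)‖})
    (fun m => by
      simp only [ofPred_forall]
      exact isClosed_iInter fun i => isClosed_iInter fun _ => isClosed_le (by fun_prop)
        (by fun_prop))
    (fun m w hw i hi => hw i (hi.trans m.le_succ))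
    (fun m => by
      refine ⟨(LinearMap.ker (P m : V →ₗ[ℝ] V)).map
        ((Φ m).symm.toLinearEquiv : V →ₗ[ℝ] V), ?_, ?_⟩
      · rw [← hs m]
        exact LinearEquiv.finrank_map_eq (Φ m).symm.toLinearEquiv _
      · rintro w ⟨u, hu, rfl⟩
        have hu' : P m u = 0 := hu
        have h0 : ∀ k ≤ m, ∀ w, Φ m w = u → ‖P (m - k) (Φ (m - k) w)‖
            ≤ ‖Φ (m - k) w - P (m - k) (Φ (m - k) w)‖ := by
          intro k hk w hw
          induction k with
          | zero => simp [hw, hu']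
          | succ k ih =>
            have h1 := ih (by omega)
            have h2 := h (m - (k + 1)) w
            have h3 := hB (m - (k + 1))
            rw [show m - (k + 1) + 1 = m - k by omega] at h2 h3
            exact (h2.expand (hg _) (hg _) h3 h1).1
        intro i hi
        have := h0 (m - i) (by omega) ((Φ m).symm u) (by simp)
        rwa [show m - (m - i) = i by omega] at this)
  exact ⟨W, hW, fun w hw j => hWC j hw j le_rfl⟩

end Cones

/-! ### Perturbations of hyperbolic linear maps give hyperbolic pairs -/

section Step

variable {V : Type*} [NormedAddCommGroup V] [NormedSpace ℝ V]

/-- The approximate inverse, on the kernel of `Q`, of a linear map `A`. -/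
def backwardMap (P Q : V →L[ℝ] V) (A : V ≃L[ℝ] V) : V →L[ℝ] V :=
  (ContinuousLinearMap.id ℝ V - P) ∘L (A.symm : V →L[ℝ] V) ∘L (ContinuousLinearMap.id ℝ V - Q)

theorem backwardMap_apply (P Q : V →L[ℝ] V) (A : V ≃L[ℝ] V) (w : V) :
    backwardMap P Q A w = A.symm (w - Q w) - P (A.symm (w - Q w)) := by
  simp [backwardMap]
  abel

/-- `A` maps the splitting given by `P` to the one given by `P₁`, which is close to the one
given by `P'`, it contracts the first subspace by the factor `a`, and its inverse contracts the
second one by the factor `b`, after rescaling by `g` and `g'`. -/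
structure IsHypStep (P P₁ P' : V →L[ℝ] V) (A : V ≃L[ℝ] V) (g g' C D Θ ζ : ℝ) : Prop where
  proj : ∀ v, P (P v) = P v
  comm : ∀ v, A (P v) = P₁ (A v)
  proj' : ∀ v, P' (P' v) = P' v
  norm_proj : ∀ v, ‖P v‖ ≤ C * ‖v‖
  norm_proj' : ∀ v, ‖P' v‖ ≤ C * ‖v‖
  norm_map : ∀ v, ‖A v‖ ≤ D * ‖v‖
  norm_symm : ∀ v, ‖A.symm v‖ ≤ D * ‖v‖
  close : ∀ v, ‖P' v - P₁ v‖ ≤ ζ * ‖v‖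
  pos : 0 < g
  pos' : 0 < g'
  contract : ∀ v, P v = v → ‖A v‖ * g ≤ g' / 8 * ‖v‖
  expand : ∀ v, P₁ v = 0 → ‖A.symm v‖ * g' ≤ g / 8 * ‖v‖
  ratio : g ≤ Θ * g'
  one_le_C : 1 ≤ C
  one_le_D : 1 ≤ D
  one_le_Θ : 1 ≤ Θ
  nonneg : 0 ≤ ζ
  small : ζ * (16 * (C + 1) ^ 2 * D ^ 2 * Θ) ≤ 1

variable {P P₁ P' : V →L[ℝ] V} {A : V ≃L[ℝ] V} {g g' C D Θ ζ : ℝ}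

theorem IsHypStep.symm_comm (h : IsHypStep P P₁ P' A g g' C D Θ ζ) (v : V) :
    A.symm (P₁ v) = P (A.symm v) := by
  rw [ContinuousLinearEquiv.symm_apply_eq, h.comm, A.apply_symm_apply]

theorem IsHypStep.small_C (h : IsHypStep P P₁ P' A g g' C D Θ ζ) : 16 * ζ ≤ 1 := by
  have h1 : 1 ≤ (C + 1) ^ 2 := one_le_pow₀ (by linarith [h.one_le_C])
  have h2 : 1 ≤ D ^ 2 := one_le_pow₀ h.one_le_D
  have h3 : 1 ≤ (C + 1) ^ 2 * D ^ 2 * Θ :=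
    one_le_mul_of_one_le_of_one_le (one_le_mul_of_one_le_of_one_le h1 h2) h.one_le_Θ
  have := h.small
  have := mul_le_mul_of_nonneg_left h3 (mul_nonneg (by norm_num : (0:ℝ) ≤ 16) h.nonneg)
  linarith

/-- On the kernel of `P'` the nearby projection `P₁` has norm at most `ζ`, so moving into the kernel
of `P₁` changes a vector by a small fraction of its length. This gives injectivity, and it degrades
the rate `1 / 8` of `expand` to no worse than `1 / 4`. -/
theorem IsHypStep.isBackward (h : IsHypStep P P₁ P' A g g' C D Θ ζ) :
    IsBackward P P' (backwardMap P P' A) g g' := by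
  have hsmall := h.small_C
  have hB : ∀ w, backwardMap P P' A w = A.symm ((w - P' w) - P₁ (w - P' w)) := by
    intro w
    rw [backwardMap_apply, ← h.symm_comm, ← map_sub]
  have hclose : ∀ w, ‖P₁ (w - P' w)‖ ≤ ζ * ‖w - P' w‖ := by
    intro w
    have h1 := h.close (w - P' w)
    have h2 : P' (w - P' w) = 0 := by rw [map_sub, h.proj', sub_self]
    rwa [h2, zero_sub, norm_neg] at h1
  have hn : ∀ w : V, ζ * ‖w‖ ≤ 1 / 16 * ‖w‖ := fun w => by
    have := norm_nonneg w
    nlinarith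
  refine ⟨fun w => ?_, fun w hw => ?_, fun w => ?_⟩
  · rw [backwardMap_apply, map_sub, h.proj, sub_self]
  · rw [hB, map_eq_zero_iff _ A.symm.injective] at hw
    have h1 := hclose w
    rw [← sub_eq_zero.1 hw] at h1
    have h2 := hn (w - P' w)
    have h3 : ‖w - P' w‖ ≤ 0 := by linarith [norm_nonneg (w - P' w)]
    exact (sub_eq_zero.1 (norm_le_zero_iff.1 h3)).symm
  · have h1 : P₁ ((w - P' w) - P₁ (w - P' w)) = 0 := by
      have : ∀ u, P₁ (P₁ u) = P₁ u := fun u => by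
        have h2 := h.comm (P (A.symm u))
        rw [h.proj, h.comm, A.apply_symm_apply] at h2
        exact h2.symm
      rw [map_sub, this, sub_self]
    have h2 := h.expand _ h1
    have h3 := norm_sub_le (w - P' w) (P₁ (w - P' w))
    have h4 := hclose w
    have h5 := hn (w - P' w)
    have h6 : ‖(w - P' w) - P₁ (w - P' w)‖ ≤ 2 * ‖w - P' w‖ := by
      linarith [norm_nonneg (w - P' w)]
    have h7 := mul_le_mul_of_nonneg_left h6 h.pos.le
    rw [hB, div_div, div_le_div_iff₀ h.pos (by linarith [h.pos'])]
    linarith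

/-- In the range component the linear part contributes `1 / 8` and the errors, of size `ζ * ‖v‖`,
must be compared with the scale `g'` of the target; this is where `g ≤ Θ * g'` enters. In the kernel
component the linear part cancels exactly and only errors remain, measured at the scale `g` of the
source. -/
theorem IsHypStep.hypPair (h : IsHypStep P P₁ P' A g g' C D Θ ζ) {v v' : V}
    (hv : ‖v' - A v‖ ≤ ζ * ‖v‖) : HypPair P P' (backwardMap P P' A) g g' v v' := by
  have hg := h.pos
  have hg' := h.pos'
  have hC := h.one_le_C
  have hD := h.one_le_D
  have hΘ := h.one_le_Θ
  have hζ := h.nonneg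
  set m := splitNorm P v with hm
  have hm0 : 0 ≤ m := splitNorm_nonneg P v
  have hvm : ‖v‖ ≤ 2 * m := norm_le_two_mul_splitNorm P v
  have he : ‖v' - A v‖ ≤ ζ * (2 * m) := hv.trans (by gcongr)
  have hAv : ‖A v‖ ≤ D * (2 * m) := (h.norm_map v).trans (by gcongr)
  have hcl : ‖P' (A v) - P₁ (A v)‖ ≤ ζ * (D * (2 * m)) := (h.close _).trans (by gcongr)
  constructor
  · have e1 : P' v' = A (P v) + (P' (A v) - P₁ (A v)) + P' (v' - A v) := by
      rw [h.comm, map_sub]; abel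
    have n1 : ‖P' (v' - A v)‖ ≤ C * (ζ * (2 * m)) := (h.norm_proj' _).trans (by gcongr)
    have n2 : ‖A (P v)‖ * g ≤ g' / 8 * m :=
      (h.contract _ (h.proj v)).trans (by gcongr; exact norm_apply_le_splitNorm P v)
    have n3 : ‖P' v'‖ ≤ ‖A (P v)‖ + ζ * (D * (2 * m)) + C * (ζ * (2 * m)) := by
      rw [e1]
      refine (norm_add₃_le).trans ?_
      gcongr
    have n4 : ζ * (D + C) * Θ * 8 ≤ 1 := by
      refine le_trans ?_ h.small
      have : D + C ≤ (C + 1) * D := by nlinarith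
      have h2 : (C + 1) * D ≤ ((C + 1) * D) ^ 2 := by
        have : 1 ≤ (C + 1) * D := by nlinarith
        nlinarith
      have h3 : (D + C) ≤ (C + 1) ^ 2 * D ^ 2 := by rw [← mul_pow]; linarith
      calc ζ * (D + C) * Θ * 8 = 8 * (ζ * Θ) * (D + C) := by ring
        _ ≤ 8 * (ζ * Θ) * ((C + 1) ^ 2 * D ^ 2) := by gcongr
        _ ≤ 16 * (ζ * Θ) * ((C + 1) ^ 2 * D ^ 2) := by gcongr; norm_num
        _ = _ := by ring
    have n5 : ζ * (D + C) * g ≤ g' / 8 := by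
      calc ζ * (D + C) * g ≤ ζ * (D + C) * (Θ * g') := by gcongr; exact h.ratio
        _ = (ζ * (D + C) * Θ * 8) * (g' / 8) := by ring
        _ ≤ 1 * (g' / 8) := by gcongr
        _ = g' / 8 := one_mul _
    rw [div_div, div_le_div_iff₀ hg' (by linarith)]
    have n6 := mul_le_mul_of_nonneg_right n3 hg.le
    have n7 := mul_le_mul_of_nonneg_right n5 hm0
    nlinarith
  · have e1 : v - P v - backwardMap P P' A v' =
        (A.symm (P' (A v) - P₁ (A v)) - P (A.symm (P' (A v) - P₁ (A v))))
          - backwardMap P P' A (v' - A v) := by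
      have e2 : backwardMap P P' A v' = backwardMap P P' A (A v) + backwardMap P P' A (v' - A v) := by
        rw [← map_add, add_sub_cancel]
      have e3 : v - P v = A.symm (A v - P₁ (A v)) - P (A.symm (A v - P₁ (A v))) := by
        simp only [map_sub, h.symm_comm, A.symm_apply_apply, h.proj]
        abel
      rw [e2, e3, backwardMap_apply P P' A (A v)]
      simp only [map_sub]
      abel
    have nQ : ∀ u, ‖u - P u‖ ≤ (C + 1) * ‖u‖ := fun u => by
      have := norm_sub_le u (P u)
      have := h.norm_proj u
      linarith
    have nQ' : ∀ u, ‖u - P' u‖ ≤ (C + 1) * ‖u‖ := fun u => by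
      have := norm_sub_le u (P' u)
      have := h.norm_proj' u
      linarith
    have n1 : ‖A.symm (P' (A v) - P₁ (A v)) - P (A.symm (P' (A v) - P₁ (A v)))‖
        ≤ (C + 1) * (D * (ζ * (D * (2 * m)))) :=
      (nQ _).trans (by gcongr; exact (h.norm_symm _).trans (by gcongr))
    have n2 : ‖backwardMap P P' A (v' - A v)‖ ≤ (C + 1) * (D * ((C + 1) * (ζ * (2 * m)))) := by
      rw [backwardMap_apply]
      refine (nQ _).trans ?_
      gcongr
      refine (h.norm_symm _).trans ?_
      gcongr
      exact (nQ' _).trans (by gcongr)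
    have n3 : ζ * ((C + 1) * D * (D + (C + 1))) * 8 ≤ 1 := by
      refine le_trans ?_ h.small
      have h1 : D + (C + 1) ≤ 2 * ((C + 1) * D) := by nlinarith
      calc ζ * ((C + 1) * D * (D + (C + 1))) * 8
          ≤ ζ * ((C + 1) * D * (2 * ((C + 1) * D))) * 8 := by gcongr
        _ = ζ * (16 * (C + 1) ^ 2 * D ^ 2 * 1) := by ring
        _ ≤ ζ * (16 * (C + 1) ^ 2 * D ^ 2 * Θ) := by gcongr
    rw [div_right_comm]
    gcongr
    rw [e1]
    refine (norm_sub_le _ _).trans ?_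
    have n4 := mul_le_mul_of_nonneg_right n3 hm0
    nlinarith

end Step

/-! ### Scales that make all the blocks of a segment hyperbolic -/

section Weights

/-- Scales along a finite orbit segment with a dominated splitting, hyperbolic at its two ends,
which make all the steps hyperbolic. -/
theorem exists_weights {A B : ℕ → ℝ} {q : ℕ} {κ θ D : ℝ} (hκ : 0 < κ) (hθ : 0 < θ)
    (hA : ∀ r < q, θ ≤ A r) (hB0 : ∀ r < q, 0 ≤ B r) (hB : ∀ r < q, B r ≤ D)
    (hAp : ∀ l ≤ q, ∏ r ∈ Finset.range l, A r ≤ κ ^ l)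
    (hBp : ∀ l ≤ q, ∏ r ∈ Finset.Ico l q, B r ≤ κ ^ (q - l))
    (hAB : ∀ r < q, A r * B r ≤ κ ^ 2) :
    ∃ g : ℕ → ℝ, g 0 = 1 ∧ g q = 1 ∧ ∀ r ≤ q, 0 < g r ∧ g r ≤ 1 ∧ (r < q →
      A r * g r ≤ κ * g (r + 1) ∧ B r * g (r + 1) ≤ κ * g r ∧
      g r ≤ max (κ / θ) (D / κ) * g (r + 1)) := by
  -- The scale is `max p b`. By construction `p` satisfies the inequality for `A`, and `b` the one
  -- for `B`, with equality; the two mixed inequalities are exactly `A r * B r ≤ κ ^ 2`. The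
  -- hypotheses at the two ends give `p ≤ 1` and `b ≤ 1`, while `p 0 = 1` and `b q = 1`.
  let p : ℕ → ℝ := fun l => ∏ r ∈ Finset.range l, (A r / κ)
  let b : ℕ → ℝ := fun l => ∏ r ∈ Finset.Ico l q, (B r / κ)
  have hp0 : ∀ l ≤ q, 0 < p l := fun l hl => Finset.prod_pos fun r hr =>
    div_pos (hθ.trans_le (hA r ((Finset.mem_range.1 hr).trans_le hl))) hκ
  have hb0 : ∀ l, 0 ≤ b l := fun l => Finset.prod_nonneg fun r hr =>
    div_nonneg (hB0 r (Finset.mem_Ico.1 hr).2) hκ.le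
  have hp1 : ∀ l ≤ q, p l ≤ 1 := by
    intro l hl
    simp only [p, Finset.prod_div_distrib, Finset.prod_const, Finset.card_range]
    exact div_le_one_of_le₀ (hAp l hl) (by positivity)
  have hb1 : ∀ l ≤ q, b l ≤ 1 := by
    intro l hl
    simp only [b, Finset.prod_div_distrib, Finset.prod_const, Nat.card_Ico]
    exact div_le_one_of_le₀ (hBp l hl) (by positivity)
  have hps : ∀ l, A l * p l = κ * p (l + 1) := by
    intro l
    simp only [p, Finset.prod_range_succ]
    field_simp
  have hbs : ∀ l < q, κ * b l = B l * b (l + 1) := by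
    intro l hl
    simp only [b]
    rw [Finset.prod_eq_prod_Ico_succ_bot hl]
    field_simp
  refine ⟨fun l => max (p l) (b l), ?_, ?_, fun r hr => ⟨?_, ?_, fun hrq => ⟨?_, ?_, ?_⟩⟩⟩
  · have : p 0 = 1 := by simp [p]
    simpa [this] using hb1 0 (Nat.zero_le _)
  · have : b q = 1 := by simp [b]
    simpa [this] using hp1 q le_rfl
  · exact lt_max_of_lt_left (hp0 r hr)
  · exact max_le (hp1 r hr) (hb1 r hr)
  · have hAr := hθ.trans_le (hA r hrq)
    rw [mul_max_of_nonneg _ _ hAr.le, mul_max_of_nonneg _ _ hκ.le]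
    refine max_le_max (hps r).le ?_
    refine le_of_mul_le_mul_left ?_ hκ
    calc κ * (A r * b r) = A r * (κ * b r) := by ring
      _ = (A r * B r) * b (r + 1) := by rw [hbs r hrq]; ring
      _ ≤ κ ^ 2 * b (r + 1) := mul_le_mul_of_nonneg_right (hAB r hrq) (hb0 _)
      _ = κ * (κ * b (r + 1)) := by ring
  · rw [mul_max_of_nonneg _ _ (hB0 r hrq), mul_max_of_nonneg _ _ hκ.le]
    refine max_le_max ?_ (hbs r hrq).ge
    refine le_of_mul_le_mul_left ?_ hκ
    calc κ * (B r * p (r + 1)) = B r * (κ * p (r + 1)) := by ring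
      _ = (A r * B r) * p r := by rw [← hps r]; ring
      _ ≤ κ ^ 2 * p r := mul_le_mul_of_nonneg_right (hAB r hrq) (hp0 _ hr).le
      _ = κ * (κ * p r) := by ring
  · have hpr := hp0 (r + 1) hrq
    have h1 : p r ≤ κ / θ * p (r + 1) := by
      rw [div_mul_eq_mul_div, le_div_iff₀ hθ, ← hps r, mul_comm]
      exact mul_le_mul_of_nonneg_right (hA r hrq) (hp0 r hr).le
    have h2 : b r ≤ D / κ * b (r + 1) := by
      rw [div_mul_eq_mul_div, le_div_iff₀ hκ, mul_comm, hbs r hrq]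
      exact mul_le_mul_of_nonneg_right (hB r hrq) (hb0 _)
    refine max_le ?_ ?_
    · exact h1.trans (mul_le_mul (le_max_left _ _) (le_max_left _ _) hpr.le
        (le_max_of_le_left (by positivity)))
    · exact h2.trans (mul_le_mul (le_max_right _ _) (le_max_right _ _) (hb0 _)
        (le_max_of_le_left (by positivity)))

end Weights

/-! ### Tangent maps and projections read in charts -/

section Frames

variable (d : ℕ) {M : Type*} [TopologicalSpace M] [ChartedSpace (EuclideanSpace ℝ (Fin d)) M]
  [IsManifold (𝓡 d) ∞ M]

local notation "𝔼" => EuclideanSpace ℝ (Fin d)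

open Classical in
/-- The identification of the tangent space at `x` with the model space, given by the chart at `c`
if `x` is in its source. -/
def frame (c x : M) : TangentSpace (𝓡 d) x ≃L[ℝ] 𝔼 :=
  if hx : x ∈ (chartAt 𝔼 c).source then
    (trivializationAt 𝔼 (TangentSpace (𝓡 d)) c).continuousLinearEquivAt ℝ x hx
  else ContinuousLinearEquiv.refl ℝ 𝔼

variable {d}

theorem frame_eq {c x : M} (hx : x ∈ (chartAt 𝔼 c).source) :
    frame d c x =
      (trivializationAt 𝔼 (TangentSpace (𝓡 d)) c).continuousLinearEquivAt ℝ x hx :=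
  dif_pos hx

theorem coe_frame_eq_trivializationAt {c x : M} (hx : x ∈ (chartAt 𝔼 c).source) :
    (frame d c x : TangentSpace (𝓡 d) x →L[ℝ] 𝔼) =
      (trivializationAt 𝔼 (TangentSpace (𝓡 d)) c).continuousLinearMapAt ℝ x := by
  rw [frame_eq hx]
  exact Trivialization.coe_continuousLinearEquivAt_eq'
    (trivializationAt 𝔼 (TangentSpace (𝓡 d)) c) hx

theorem coe_frame {c x : M} (hx : x ∈ (chartAt 𝔼 c).source) :
    (frame d c x : TangentSpace (𝓡 d) x →L[ℝ] 𝔼) =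
      mfderiv (𝓡 d) 𝓘(ℝ, 𝔼) (extChartAt (𝓡 d) c) x := by
  rw [← TangentBundle.continuousLinearMapAt_trivializationAt hx, coe_frame_eq_trivializationAt hx]

theorem coe_frame_symm {c x : M} (hx : x ∈ (chartAt 𝔼 c).source) :
    ((frame d c x).symm : 𝔼 →L[ℝ] TangentSpace (𝓡 d) x) =
      (trivializationAt 𝔼 (TangentSpace (𝓡 d)) c).symmL ℝ x := by
  rw [frame_eq hx]
  exact Trivialization.symm_continuousLinearEquivAt_eq'
    (trivializationAt 𝔼 (TangentSpace (𝓡 d)) c) hx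

omit [IsManifold (𝓡 d) ∞ M] in
theorem derivNormOn_le [RiemannianBundle (fun x : M => TangentSpace (𝓡 d) x)]
    (f : M → M) (E : (x : M) → Submodule ℝ (TangentSpace (𝓡 d) x)) (x : M)
    {v : TangentSpace (𝓡 d) x} (hv : v ∈ E x) :
    ‖mfderiv (𝓡 d) (𝓡 d) f x v‖ ≤ derivNormOn f E x * ‖v‖ :=
  ((mfderiv (𝓡 d) (𝓡 d) f x).comp (E x).subtypeL).le_opNorm ⟨v, hv⟩

theorem eventually_norm_frame_le [RiemannianBundle (fun x : M => TangentSpace (𝓡 d) x)]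
    [IsContinuousRiemannianBundle 𝔼 (fun x : M => TangentSpace (𝓡 d) x)] (c : M) :
    ∃ C : ℝ, ∀ᶠ x in 𝓝 c, ∀ v : TangentSpace (𝓡 d) x,
      ‖frame d c x v‖ ≤ C * ‖v‖ ∧ ‖v‖ ≤ C * ‖frame d c x v‖ := by
  obtain ⟨C, hC, h1⟩ := eventually_norm_trivializationAt_lt 𝔼
    (fun x : M => TangentSpace (𝓡 d) x) c
  obtain ⟨C', hC', h2⟩ := eventually_norm_symmL_trivializationAt_lt 𝔼
    (fun x : M => TangentSpace (𝓡 d) x) c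
  refine ⟨max C C', ?_⟩
  filter_upwards [h1, h2, (chartAt 𝔼 c).open_source.mem_nhds (mem_chart_source _ c)]
    with x h1 h2 hx v
  constructor
  · have h3 := ((trivializationAt 𝔼 (fun x : M => TangentSpace (𝓡 d) x) c).continuousLinearMapAt
      ℝ x).le_opNorm v
    have h4 : frame d c x v = (trivializationAt 𝔼
      (fun x : M => TangentSpace (𝓡 d) x) c).continuousLinearMapAt ℝ x v :=
      congrArg (fun L => L v) (coe_frame_eq_trivializationAt hx)
    rw [h4]
    exact h3.trans (mul_le_mul_of_nonneg_right (h1.le.trans (le_max_left _ _)) (norm_nonneg _))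
  · have h3 := ((trivializationAt 𝔼 (fun x : M => TangentSpace (𝓡 d) x) c).symmL
      ℝ x).le_opNorm (frame d c x v)
    have h4 : (trivializationAt 𝔼 (fun x : M => TangentSpace (𝓡 d) x) c).symmL ℝ x
        (frame d c x v) = v := by
      have := congrArg (fun L => L (frame d c x v)) (coe_frame_symm hx)
      exact this.symm.trans ((frame d c x).symm_apply_apply v)
    rw [h4] at h3
    exact h3.trans (mul_le_mul_of_nonneg_right (h2.le.trans (le_max_right _ _)) (norm_nonneg _))

theorem isContinuousRiemannianBundle_of_isContMDiff
    [RiemannianBundle (fun x : M => TangentSpace (𝓡 d) x)]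
    [h : IsContMDiffRiemannianBundle (𝓡 d) ∞ 𝔼 (fun x : M => TangentSpace (𝓡 d) x)] :
    IsContinuousRiemannianBundle 𝔼 (fun x : M => TangentSpace (𝓡 d) x) := by
  obtain ⟨g, hg, hg'⟩ := h.exists_contMDiff
  exact ⟨g, hg.continuous, hg'⟩

/-- The section `P` of the bundle of endomorphisms, read in the chart at `c`. -/
def localProj (P : (x : M) → TangentSpace (𝓡 d) x →L[ℝ] TangentSpace (𝓡 d) x) (c x : M) :
    𝔼 →L[ℝ] 𝔼 :=
  (frame d c x : TangentSpace (𝓡 d) x →L[ℝ] 𝔼) ∘L P x ∘L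
    ((frame d c x).symm : 𝔼 →L[ℝ] TangentSpace (𝓡 d) x)

/-- The trivialization of the endomorphism bundle at `c` is conjugation by the frames at `c`, so
continuity of the section is continuity of its matrix in the chart. -/
theorem continuousOn_localProj
    {P : (x : M) → TangentSpace (𝓡 d) x →L[ℝ] TangentSpace (𝓡 d) x} {K : Set M}
    (hP : ContinuousOn (fun x : M => Bundle.TotalSpace.mk' (𝔼 →L[ℝ] 𝔼)
      (E := fun x : M => TangentSpace (𝓡 d) x →L[ℝ] TangentSpace (𝓡 d) x) x (P x)) K) (c : M) :
    ContinuousOn (localProj P c) (K ∩ (chartAt 𝔼 c).source) := by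
  have h1 : ContinuousOn (fun x => ((trivializationAt (𝔼 →L[ℝ] 𝔼)
      (fun x : M => TangentSpace (𝓡 d) x →L[ℝ] TangentSpace (𝓡 d) x) c)
      (Bundle.TotalSpace.mk' (𝔼 →L[ℝ] 𝔼)
        (E := fun x : M => TangentSpace (𝓡 d) x →L[ℝ] TangentSpace (𝓡 d) x) x (P x))).2)
      (K ∩ (chartAt 𝔼 c).source) := by
    refine continuous_snd.comp_continuousOn ?_
    refine (trivializationAt (𝔼 →L[ℝ] 𝔼) (fun x : M =>
      TangentSpace (𝓡 d) x →L[ℝ] TangentSpace (𝓡 d) x) c).continuousOn.comp (hP.mono inter_subset_left) ?_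
    intro x hx
    rw [hom_trivializationAt_source]
    exact ⟨hx.2, hx.2⟩
  refine h1.congr fun x hx => ?_
  have h2 := congrArg Prod.snd (hom_trivializationAt_apply (σ := RingHom.id ℝ) (F₁ := 𝔼)
    (E₁ := fun x : M => TangentSpace (𝓡 d) x) (F₂ := 𝔼)
    (E₂ := fun x : M => TangentSpace (𝓡 d) x) c ⟨x, P x⟩)
  refine Eq.trans ?_ h2.symm
  unfold localProj
  rw [coe_frame_eq_trivializationAt hx.2, coe_frame_symm hx.2]
  rfl

theorem localProj_apply (P : (x : M) → TangentSpace (𝓡 d) x →L[ℝ] TangentSpace (𝓡 d) x)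
    (c x : M) (v : 𝔼) :
    localProj P c x v = frame d c x (P x ((frame d c x).symm v)) := rfl

/-- The derivative of `h` at `x`, read in the charts at `c` and `c'`. -/
def chartDeriv (h : M → M) (c c' x : M) : 𝔼 →L[ℝ] 𝔼 :=
  (frame d c' (h x) : TangentSpace (𝓡 d) (h x) →L[ℝ] 𝔼) ∘L mfderiv (𝓡 d) (𝓡 d) h x ∘L
    ((frame d c x).symm : 𝔼 →L[ℝ] TangentSpace (𝓡 d) x)

theorem chartDeriv_apply (h : M → M) (c c' x : M) (v : 𝔼) :
    chartDeriv h c c' x v =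
      frame d c' (h x) (mfderiv (𝓡 d) (𝓡 d) h x ((frame d c x).symm v)) := rfl

theorem chartDeriv_comp {h k : M → M} (c c' c'' : M) {x : M}
    (hh : MDifferentiableAt (𝓡 d) (𝓡 d) h x) (hk : MDifferentiableAt (𝓡 d) (𝓡 d) k (h x)) :
    chartDeriv (k ∘ h) c c'' x = chartDeriv k c' c'' (h x) ∘L chartDeriv (d := d) h c c' x := by
  ext v : 1
  simp only [ContinuousLinearMap.comp_apply, chartDeriv_apply, mfderiv_comp x hk hh,
    ContinuousLinearEquiv.symm_apply_apply]
  rfl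

theorem chartDeriv_id (c x : M) :
    chartDeriv (id : M → M) c c x = ContinuousLinearMap.id ℝ 𝔼 := by
  ext v : 1
  rw [chartDeriv_apply, mfderiv_id]
  exact (frame d c x).apply_symm_apply v

/-- The map `h`, read in the charts at `c` and `c'`. -/
def chartMap (h : M → M) (c c' : M) (u : 𝔼) : 𝔼 :=
  extChartAt (𝓡 d) c' (h ((extChartAt (𝓡 d) c).symm u))

/-- This identifies the manifold derivative in the frames with the Fréchet derivative of the map in
coordinates, so that calculus in the model space applies. -/
theorem hasFDerivAt_chartMap {h : M → M} {c c' x : M} (hx : x ∈ (chartAt 𝔼 c).source)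
    (hx' : h x ∈ (chartAt 𝔼 c').source) (hh : MDifferentiableAt (𝓡 d) (𝓡 d) h x) :
    HasFDerivAt (chartMap h c c') (chartDeriv (d := d) h c c' x) (extChartAt (𝓡 d) c x) := by
  have hxs : x ∈ (extChartAt (𝓡 d) c).source := by rwa [extChartAt_source]
  have hinv : (extChartAt (𝓡 d) c).symm (extChartAt (𝓡 d) c x) = x :=
    (extChartAt (𝓡 d) c).left_inv hxs
  have h1 : HasMFDerivAt (𝓡 d) 𝓘(ℝ, 𝔼) (extChartAt (𝓡 d) c') (h x)
      (frame d c' (h x) : TangentSpace (𝓡 d) (h x) →L[ℝ] 𝔼) := by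
    rw [coe_frame hx']
    exact (mdifferentiableAt_extChartAt hx').hasMFDerivAt
  have h2 : HasMFDerivAt 𝓘(ℝ, 𝔼) (𝓡 d) (extChartAt (𝓡 d) c).symm (extChartAt (𝓡 d) c x)
      ((frame d c x).symm : 𝔼 →L[ℝ] TangentSpace (𝓡 d) x) := by
    rw [coe_frame_symm hx, TangentBundle.symmL_trivializationAt hx]
    have h3 := (mdifferentiableWithinAt_extChartAt_symm (I := 𝓡 d) (x := c)
      ((extChartAt (𝓡 d) c).map_source hxs)).hasMFDerivWithinAt
    have hr : range (𝓡 d) = univ := (𝓡 d).range_eq_univ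
    rw [hr] at h3 ⊢
    exact hasMFDerivWithinAt_univ.1 h3
  have h3 : HasMFDerivAt (𝓡 d) 𝓘(ℝ, 𝔼) (extChartAt (𝓡 d) c' ∘ h)
      ((extChartAt (𝓡 d) c).symm (extChartAt (𝓡 d) c x))
      ((frame d c' (h x) : TangentSpace (𝓡 d) (h x) →L[ℝ] 𝔼) ∘L mfderiv (𝓡 d) (𝓡 d) h x) := by
    rw [hinv]
    exact h1.comp x hh.hasMFDerivAt
  exact hasMFDerivAt_iff_hasFDerivAt.1 (h3.comp _ h2)

omit [IsManifold (𝓡 d) ∞ M] in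
theorem isOpen_chartMap_domain {h : M → M} (hh : Continuous h) (c c' : M) :
    IsOpen ((extChartAt (𝓡 d) c).target ∩
      (extChartAt (𝓡 d) c).symm ⁻¹' (h ⁻¹' (chartAt 𝔼 c').source)) :=
  (continuousOn_extChartAt_symm c).isOpen_inter_preimage (isOpen_extChartAt_target c)
    ((chartAt 𝔼 c').open_source.preimage hh)

theorem contDiffOn_chartMap {h : M → M} (hh : ContMDiff (𝓡 d) (𝓡 d) 1 h) (c c' : M) :
    ContDiffOn ℝ 1 (chartMap (d := d) h c c') ((extChartAt (𝓡 d) c).target ∩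
      (extChartAt (𝓡 d) c).symm ⁻¹' (h ⁻¹' (chartAt 𝔼 c').source)) := by
  rw [← contMDiffOn_iff_contDiffOn]
  have h1 : ContMDiffOn 𝓘(ℝ, 𝔼) (𝓡 d) 1 (extChartAt (𝓡 d) c).symm (extChartAt (𝓡 d) c).target :=
    contMDiffOn_extChartAt_symm c
  have h2 : ContMDiffOn (𝓡 d) 𝓘(ℝ, 𝔼) 1 (extChartAt (𝓡 d) c') (chartAt 𝔼 c').source :=
    contMDiffOn_extChartAt
  exact h2.comp (hh.comp_contMDiffOn (h1.mono inter_subset_left)) fun u hu => hu.2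

end Frames

/-! ### Uniform strict differentiability and finitely many simultaneous choices -/

section UniformC1

variable {V W : Type*} [NormedAddCommGroup V] [NormedSpace ℝ V] [FiniteDimensional ℝ V]
  [NormedAddCommGroup W] [NormedSpace ℝ W]

/-- A `C¹` map is uniformly strictly differentiable near a compact set. -/
theorem exists_uniform_C1 {F : V → W} {O Q : Set V} (hO : IsOpen O) (hF : ContDiffOn ℝ 1 F O)
    (hQ : IsCompact Q) (hQO : Q ⊆ O) {ζ : ℝ} (hζ : 0 < ζ) :
    ∃ ρ > 0, ∀ q ∈ Q, Metric.closedBall q ρ ⊆ O ∧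
      (∀ u ∈ Metric.closedBall q ρ, ∀ v ∈ Metric.closedBall q ρ,
        ‖F u - F v - fderiv ℝ F q (u - v)‖ ≤ ζ * ‖u - v‖) ∧
      ∀ u ∈ Metric.closedBall q ρ, ‖fderiv ℝ F u - fderiv ℝ F q‖ ≤ ζ := by
  have := FiniteDimensional.proper_real V
  obtain ⟨δ, hδ, hδO⟩ := hQ.exists_cthickening_subset_open hO hQO
  have hK : IsCompact (Metric.cthickening δ Q) := hQ.cthickening
  have hc : ContinuousOn (fderiv ℝ F) (Metric.cthickening δ Q) :=
    (hF.continuousOn_fderiv_of_isOpen hO le_rfl).mono hδO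
  obtain ⟨ρ, hρ, h⟩ := Metric.uniformContinuousOn_iff_le.1
    (hK.uniformContinuousOn_of_continuous hc) ζ hζ
  refine ⟨min ρ δ, lt_min hρ hδ, fun q hq => ?_⟩
  have hsub : Metric.closedBall q (min ρ δ) ⊆ Metric.cthickening δ Q :=
    (Metric.closedBall_subset_closedBall (min_le_right _ _)).trans
      (Metric.closedBall_subset_cthickening hq δ)
  have hd : ∀ u ∈ Metric.closedBall q (min ρ δ), ‖fderiv ℝ F u - fderiv ℝ F q‖ ≤ ζ := by
    intro u hu
    rw [← dist_eq_norm]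
    exact h u (hsub hu) q (Metric.self_subset_cthickening Q hq)
      ((Metric.mem_closedBall.1 hu).trans (min_le_left _ _))
  refine ⟨hsub.trans hδO, fun u hu v hv => ?_, hd⟩
  exact (convex_closedBall q _).norm_image_sub_le_of_norm_fderiv_le'
    (fun w hw => (hF.differentiableOn one_ne_zero).differentiableAt
      (hO.mem_nhds (hδO (hsub hw)))) hd hv hu

end UniformC1

/-- Used to choose one radius for the finitely many charts and iterates, since every condition in
question survives shrinking the radius. -/
theorem exists_pos_forall_mem_finset {ι α : Type*} [LinearOrder α] [Zero α] (h0 : ∃ a : α, 0 < a)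
    (s : Finset ι) {p : ι → α → Prop} (hp : ∀ i a b, a ≤ b → p i b → p i a)
    (h : ∀ i ∈ s, ∃ a > 0, p i a) : ∃ a > 0, ∀ i ∈ s, p i a := by
  classical
  induction s using Finset.induction_on with
  | empty =>
    obtain ⟨a, ha⟩ := h0
    exact ⟨a, ha, by simp⟩
  | insert i s _ ih =>
    obtain ⟨a, ha, h1⟩ := ih fun j hj => h j (Finset.mem_insert_of_mem hj)
    obtain ⟨b, hb, h2⟩ := h i (Finset.mem_insert_self _ _)
    refine ⟨min a b, lt_min ha hb, fun j hj => ?_⟩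
    rcases Finset.mem_insert.1 hj with rfl | hj
    · exact hp _ _ _ (min_le_right _ _) h2
    · exact hp _ _ _ (min_le_left _ _) (h1 j hj)

theorem exists_forall_mem_finset_of_mono {ι : Type*} (s : Finset ι) {p : ι → ℝ → Prop}
    (hp : ∀ i a b, a ≤ b → p i a → p i b) (h : ∀ i ∈ s, ∃ a, p i a) : ∃ a ≥ 1, ∀ i ∈ s, p i a := by
  classical
  induction s using Finset.induction_on with
  | empty => exact ⟨1, le_rfl, by simp⟩
  | insert i s _ ih =>
    obtain ⟨a, ha, h1⟩ := ih fun j hj => h j (Finset.mem_insert_of_mem hj)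
    obtain ⟨b, h2⟩ := h i (Finset.mem_insert_self _ _)
    refine ⟨max a b, ha.trans (le_max_left _ _), fun j hj => ?_⟩
    rcases Finset.mem_insert.1 hj with rfl | hj
    · exact hp _ _ _ (le_max_right _ _) h2
    · exact hp _ _ _ (le_max_left _ _) (h1 j hj)

/-! ### A finite atlas with uniform constants -/

section Atlas

variable {d : ℕ} {M : Type*} [EMetricSpace M] [ChartedSpace (EuclideanSpace ℝ (Fin d)) M]
  [IsManifold (𝓡 d) ∞ M]

local notation "𝔼" => EuclideanSpace ℝ (Fin d)

/-- The family of norms `ν` on the tangent spaces is locally comparable to the norms given by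
the charts. -/
def IsLocallyBounded (ν : (x : M) → TangentSpace (𝓡 d) x → ℝ) : Prop :=
  ∀ c : M, ∃ C : ℝ, ∀ᶠ x in 𝓝 c, ∀ v : TangentSpace (𝓡 d) x,
    ‖frame d c x v‖ ≤ C * ν x v ∧ ν x v ≤ C * ‖frame d c x v‖

/-- A finite family of compact sets contained in chart domains, with Lebesgue number `r₀`, on which
the two families of norms are comparable to the norms given by the charts and the projections `P`
are bounded. -/
structure IsGoodAtlas (ν ν' : (x : M) → TangentSpace (𝓡 d) x → ℝ)
    (P : (x : M) → TangentSpace (𝓡 d) x →L[ℝ] TangentSpace (𝓡 d) x) (Λ : Set M)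
    (T : Finset M) (B : M → Set M) (C : ℝ) (r₀ : ℝ≥0∞) : Prop where
  one_le : 1 ≤ C
  pos : 0 < r₀
  isCompact : ∀ c ∈ T, IsCompact (B c)
  subset : ∀ c ∈ T, B c ⊆ (chartAt 𝔼 c).source
  cover : ∀ x, ∃ c ∈ T, ∀ y, edist y x < r₀ → y ∈ B c
  norm_frame_le : ∀ c ∈ T, ∀ x ∈ B c, ∀ v : TangentSpace (𝓡 d) x,
    ‖frame d c x v‖ ≤ C * ν x v ∧ ν x v ≤ C * ‖frame d c x v‖
  norm_frame_le' : ∀ c ∈ T, ∀ x ∈ B c, ∀ v : TangentSpace (𝓡 d) x,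
    ‖frame d c x v‖ ≤ C * ν' x v ∧ ν' x v ≤ C * ‖frame d c x v‖
  norm_localProj_le : ∀ c ∈ T, ∀ x ∈ Λ ∩ B c, ∀ v, ‖localProj P c x v‖ ≤ C * ‖v‖
  continuousOn : ∀ c ∈ T, ContinuousOn (localProj P c) (Λ ∩ B c)

/-- Each point has a compact neighbourhood in its chart on which all the comparisons hold with some
constant. Finitely many of their interiors cover `M`, and `r₀` is a Lebesgue number of this cover.
-/
theorem exists_isGoodAtlas [CompactSpace M] {ν ν' : (x : M) → TangentSpace (𝓡 d) x → ℝ}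
    (hν : IsLocallyBounded ν) (hν' : IsLocallyBounded ν') (hν0 : ∀ x v, 0 ≤ ν x v)
    (hν0' : ∀ x v, 0 ≤ ν' x v)
    {P : (x : M) → TangentSpace (𝓡 d) x →L[ℝ] TangentSpace (𝓡 d) x} {Λ : Set M}
    (hΛ : IsCompact Λ) (hP : ∀ c : M, ContinuousOn (localProj P c) (Λ ∩ (chartAt 𝔼 c).source)) :
    ∃ T B C r₀, IsGoodAtlas ν ν' P Λ T B C r₀ := by
  have h1 : ∀ c : M, ∃ B ∈ 𝓝 c, B ⊆ (chartAt 𝔼 c).source ∧ IsCompact B ∧ ∃ C : ℝ,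
      (∀ x ∈ B, ∀ v : TangentSpace (𝓡 d) x,
        ‖frame d c x v‖ ≤ C * ν x v ∧ ν x v ≤ C * ‖frame d c x v‖) ∧
      (∀ x ∈ B, ∀ v : TangentSpace (𝓡 d) x,
        ‖frame d c x v‖ ≤ C * ν' x v ∧ ν' x v ≤ C * ‖frame d c x v‖) ∧
      ∀ x ∈ Λ ∩ B, ∀ v, ‖localProj P c x v‖ ≤ C * ‖v‖ := by
    intro c
    obtain ⟨C₁, h1⟩ := hν c
    obtain ⟨C₂, h2⟩ := hν' c
    obtain ⟨B, hB, hBs, hBc⟩ := local_compact_nhds (inter_mem (inter_mem h1 h2)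
      ((chartAt 𝔼 c).open_source.mem_nhds (mem_chart_source 𝔼 c)))
    have h3 : ContinuousOn (localProj P c) (Λ ∩ B) :=
      (hP c).mono (inter_subset_inter_right _ fun x hx => (hBs hx).2)
    obtain ⟨C₃, h4⟩ := (hΛ.inter hBc).exists_bound_of_continuousOn h3
    refine ⟨B, hB, fun x hx => (hBs hx).2, hBc, max C₁ (max C₂ C₃), fun x hx v => ?_,
      fun x hx v => ?_, fun x hx v => ?_⟩
    · obtain ⟨h5, h6⟩ := (hBs hx).1.1 v
      exact ⟨h5.trans (mul_le_mul_of_nonneg_right (le_max_left _ _) (hν0 x v)),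
        h6.trans (mul_le_mul_of_nonneg_right (le_max_left _ _) (norm_nonneg _))⟩
    · obtain ⟨h5, h6⟩ := (hBs hx).1.2 v
      have : C₂ ≤ max C₁ (max C₂ C₃) := (le_max_left _ _).trans (le_max_right _ _)
      exact ⟨h5.trans (mul_le_mul_of_nonneg_right this (hν0' x v)),
        h6.trans (mul_le_mul_of_nonneg_right this (norm_nonneg _))⟩
    · refine ((localProj P c x).le_opNorm v).trans (mul_le_mul_of_nonneg_right ?_ (norm_nonneg _))
      exact (h4 x hx).trans ((le_max_right _ _).trans (le_max_right _ _))
  choose B hB hBs hBc C hC1 hC2 hC3 using h1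
  obtain ⟨T, hT⟩ := CompactSpace.elim_nhds_subcover (fun c => interior (B c))
    fun c => interior_mem_nhds.2 (hB c)
  obtain ⟨r₀, hr₀, hr⟩ := lebesgue_number_lemma_of_emetric (isCompact_univ (X := M))
    (c := fun c : T => interior (B c)) (fun c => isOpen_interior) (by
      intro x _
      have : x ∈ ⋃ c ∈ T, interior (B c) := hT ▸ mem_univ x
      simpa using this)
  obtain ⟨C', hC', hCC'⟩ := exists_forall_mem_finset_of_mono T (p := fun c a => C c ≤ a)
    (fun i a b hab h => h.trans hab) fun c _ => ⟨C c, le_rfl⟩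
  refine ⟨T, B, C', r₀, hC', hr₀, fun c _ => hBc c, fun c _ => hBs c, fun x => ?_,
    fun c hc x hx v => ?_, fun c hc x hx v => ?_, fun c hc x hx v => ?_, fun c hc => ?_⟩
  · obtain ⟨c, hc⟩ := hr x (mem_univ x)
    exact ⟨c, c.2, fun y hy => interior_subset (hc hy)⟩
  · obtain ⟨h5, h6⟩ := hC1 c x hx v
    exact ⟨h5.trans (mul_le_mul_of_nonneg_right (hCC' c hc) (hν0 x v)),
        h6.trans (mul_le_mul_of_nonneg_right (hCC' c hc) (norm_nonneg _))⟩
  · obtain ⟨h5, h6⟩ := hC2 c x hx v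
    exact ⟨h5.trans (mul_le_mul_of_nonneg_right (hCC' c hc) (hν0' x v)),
        h6.trans (mul_le_mul_of_nonneg_right (hCC' c hc) (norm_nonneg _))⟩
  · exact (hC3 c x hx v).trans (mul_le_mul_of_nonneg_right (hCC' c hc) (norm_nonneg _))
  · exact (hP c).mono (inter_subset_inter_right _ (hBs c))

/-- `x` is at distance at most `ρ` from `y` in the chart at `c`. -/
def Near (c y : M) (ρ : ℝ) (x : M) : Prop :=
  x ∈ (chartAt 𝔼 c).source ∧ ‖extChartAt (𝓡 d) c x - extChartAt (𝓡 d) c y‖ ≤ ρ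

omit [IsManifold (𝓡 d) ∞ M] in
theorem Near.mono {c y x : M} {ρ ρ' : ℝ} (h : Near (d := d) c y ρ x) (hρ : ρ ≤ ρ') :
    Near (d := d) c y ρ' x := ⟨h.1, h.2.trans hρ⟩

omit [IsManifold (𝓡 d) ∞ M] in
theorem exists_near_of_edist_lt {c : M} {B : Set M} (hB : IsCompact B)
    (hBs : B ⊆ (chartAt 𝔼 c).source) {ρ : ℝ} (hρ : 0 < ρ) :
    ∃ δ > (0 : ℝ≥0∞), ∀ y ∈ B, ∀ x ∈ B, edist x y < δ → Near (d := d) c y ρ x := by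
  have h1 : ContinuousOn (extChartAt (𝓡 d) c) B := (continuousOn_extChartAt c).mono (by
    rwa [extChartAt_source])
  obtain ⟨δ, hδ, h⟩ := EMetric.uniformContinuousOn_iff.1
    (hB.uniformContinuousOn_of_continuous h1) (ENNReal.ofReal ρ) (by simpa using hρ)
  refine ⟨δ, hδ, fun y hy x hx hxy => ⟨hBs hx, ?_⟩⟩
  have := h hx hy hxy
  rw [edist_dist, ENNReal.ofReal_lt_ofReal_iff hρ, dist_eq_norm] at this
  exact this.le

omit [IsManifold (𝓡 d) ∞ M] in
-- The point `x` is not assumed to lie in `B`, so uniform continuity of the inverse chart is used on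
-- a compact thickening of the image of `B` inside the target.
theorem exists_edist_lt_of_near {c : M} {B : Set M} (hB : IsCompact B)
    (hBs : B ⊆ (chartAt 𝔼 c).source) {δ : ℝ≥0∞} (hδ : 0 < δ) :
    ∃ ρ > (0 : ℝ), ∀ y ∈ B, ∀ x, Near (d := d) c y ρ x → edist x y < δ := by
  have hBs' : B ⊆ (extChartAt (𝓡 d) c).source := by rwa [extChartAt_source]
  have hQ : IsCompact (extChartAt (𝓡 d) c '' B) :=
    hB.image_of_continuousOn ((continuousOn_extChartAt c).mono hBs')
  obtain ⟨ρ₁, hρ₁, hsub⟩ := hQ.exists_cthickening_subset_open (isOpen_extChartAt_target c)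
    (by rintro _ ⟨x, hx, rfl⟩; exact (extChartAt (𝓡 d) c).map_source (hBs' hx))
  obtain ⟨ρ₂, hρ₂, h⟩ := EMetric.uniformContinuousOn_iff.1
    (hQ.cthickening.uniformContinuousOn_of_continuous
      ((continuousOn_extChartAt_symm c).mono hsub)) δ hδ
  obtain ⟨ρ₃, hρ₃, hρ₃'⟩ : ∃ ρ₃ > (0 : ℝ), ENNReal.ofReal ρ₃ < ρ₂ := by
    obtain ⟨a, ha, ha'⟩ := ENNReal.lt_iff_exists_nnreal_btwn.1 hρ₂
    exact ⟨a, by simpa using ha, by simpa using ha'⟩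
  refine ⟨min ρ₁ ρ₃, lt_min hρ₁ hρ₃, fun y hy x hx => ?_⟩
  have hxs : x ∈ (extChartAt (𝓡 d) c).source := by rw [extChartAt_source]; exact hx.1
  have h1 := h (a := extChartAt (𝓡 d) c x) (b := extChartAt (𝓡 d) c y)
    (Metric.mem_cthickening_of_dist_le _ _ _ _ (mem_image_of_mem _ hy)
      (by rw [dist_eq_norm]; exact hx.2.trans (min_le_left _ _)))
    (Metric.self_subset_cthickening _ (mem_image_of_mem _ hy)) (by
      rw [edist_dist, dist_eq_norm]
      exact (ENNReal.ofReal_le_ofReal (hx.2.trans (min_le_right _ _))).trans_lt hρ₃')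
  rwa [(extChartAt (𝓡 d) c).left_inv hxs, (extChartAt (𝓡 d) c).left_inv (hBs' hy)] at h1

theorem exists_norm_chartDeriv_le (h : M ≃ₘ^1⟮𝓡 d, 𝓡 d⟯ M) {c c' : M} {B B' : Set M}
    (hB : IsCompact B) (hB' : IsCompact B') (hBs : B ⊆ (chartAt 𝔼 c).source)
    (hBs' : B' ⊆ (chartAt 𝔼 c').source) :
    ∃ D : ℝ, ∀ x ∈ B, h x ∈ B' → ∀ v, ‖chartDeriv (d := d) h c c' x v‖ ≤ D * ‖v‖ := by
  have hQ : IsCompact (B ∩ h ⁻¹' B') := hB.inter_right (hB'.isClosed.preimage h.continuous)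
  have hsrc : B ⊆ (extChartAt (𝓡 d) c).source := by rwa [extChartAt_source]
  have hd : ContinuousOn (fun x => fderiv ℝ (chartMap (d := d) h c c') (extChartAt (𝓡 d) c x))
      (B ∩ h ⁻¹' B') := by
    refine ((contDiffOn_chartMap h.contMDiff c c').continuousOn_fderiv_of_isOpen
      (isOpen_chartMap_domain h.continuous c c') le_rfl).comp
      ((continuousOn_extChartAt c).mono (inter_subset_left.trans hsrc)) ?_
    rintro x ⟨hx, hx'⟩
    refine ⟨(extChartAt (𝓡 d) c).map_source (hsrc hx), ?_⟩
    simp only [mem_preimage, (extChartAt (𝓡 d) c).left_inv (hsrc hx)]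
    exact hBs' hx'
  obtain ⟨D, hD⟩ := hQ.exists_bound_of_continuousOn hd
  refine ⟨D, fun x hx hx' v => ?_⟩
  have h1 := hD x ⟨hx, hx'⟩
  rw [(hasFDerivAt_chartMap (hBs hx) (hBs' hx') (h.mdifferentiable one_ne_zero x)).fderiv] at h1
  exact ((chartDeriv h c c' x).le_opNorm v).trans (mul_le_mul_of_nonneg_right h1 (norm_nonneg _))

theorem exists_chartMap_uniform (h : M ≃ₘ^1⟮𝓡 d, 𝓡 d⟯ M) {c c' : M} {B B' : Set M}
    (hB : IsCompact B) (hB' : IsCompact B') (hBs : B ⊆ (chartAt 𝔼 c).source)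
    (hBs' : B' ⊆ (chartAt 𝔼 c').source) {ζ : ℝ} (hζ : 0 < ζ) :
    ∃ ρ > (0 : ℝ), ∀ y ∈ B, h y ∈ B' →
      (∀ u, ‖u - extChartAt (𝓡 d) c y‖ ≤ ρ → u ∈ (extChartAt (𝓡 d) c).target) ∧
      (∀ x, Near (d := d) c y ρ x → h x ∈ (chartAt 𝔼 c').source ∧
        ∀ v, ‖chartDeriv (d := d) h c c' x v - chartDeriv (d := d) h c c' y v‖ ≤ ζ * ‖v‖) ∧
      ∀ x, Near (d := d) c y ρ x → ∀ x', Near (d := d) c y ρ x' →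
        ‖(extChartAt (𝓡 d) c' (h x) - extChartAt (𝓡 d) c' (h x')) - chartDeriv (d := d) h c c' y
          (extChartAt (𝓡 d) c x - extChartAt (𝓡 d) c x')‖
          ≤ ζ * ‖extChartAt (𝓡 d) c x - extChartAt (𝓡 d) c x'‖ := by
  have hQ : IsCompact (B ∩ h ⁻¹' B') := hB.inter_right (hB'.isClosed.preimage h.continuous)
  have hsrc : B ⊆ (extChartAt (𝓡 d) c).source := by rwa [extChartAt_source]
  obtain ⟨ρ, hρ, H⟩ := exists_uniform_C1 (isOpen_chartMap_domain h.continuous c c')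
    (contDiffOn_chartMap h.contMDiff c c') (Q := extChartAt (𝓡 d) c '' (B ∩ h ⁻¹' B'))
    (hQ.image_of_continuousOn ((continuousOn_extChartAt c).mono (inter_subset_left.trans hsrc)))
    (by
      rintro _ ⟨x, ⟨hx, hx'⟩, rfl⟩
      refine ⟨(extChartAt (𝓡 d) c).map_source (hsrc hx), ?_⟩
      simp only [mem_preimage, (extChartAt (𝓡 d) c).left_inv (hsrc hx)]
      exact hBs' hx') hζ
  refine ⟨ρ, hρ, fun y hy hy' => ?_⟩
  obtain ⟨H1, H2, H3⟩ := H _ (mem_image_of_mem _ ⟨hy, hy'⟩)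
  have hfy := (hasFDerivAt_chartMap (hBs hy) (hBs' hy') (h.mdifferentiable one_ne_zero y)).fderiv
  have hmem : ∀ x, Near (d := d) c y ρ x → extChartAt (𝓡 d) c x ∈
      Metric.closedBall (extChartAt (𝓡 d) c y) ρ := fun x hx => by
    rw [Metric.mem_closedBall, dist_eq_norm]; exact hx.2
  have hinv : ∀ x, Near (d := d) c y ρ x → (extChartAt (𝓡 d) c).symm (extChartAt (𝓡 d) c x) = x :=
    fun x hx => (extChartAt (𝓡 d) c).left_inv (by rw [extChartAt_source]; exact hx.1)
  refine ⟨fun u hu => (H1 (by rwa [Metric.mem_closedBall, dist_eq_norm])).1, fun x hx => ?_,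
    fun x hx x' hx' => ?_⟩
  · have h1 : h x ∈ (chartAt 𝔼 c').source := by
      have := (H1 (hmem x hx)).2
      simpa only [mem_preimage, hinv x hx] using this
    refine ⟨h1, fun v => ?_⟩
    have h2 := H3 _ (hmem x hx)
    rw [hfy, (hasFDerivAt_chartMap hx.1 h1 (h.mdifferentiable one_ne_zero x)).fderiv] at h2
    exact (ContinuousLinearMap.le_opNorm (chartDeriv h c c' x - chartDeriv h c c' y) v).trans
      (mul_le_mul_of_nonneg_right h2 (norm_nonneg _))
  · have h2 := H2 _ (hmem x hx) _ (hmem x' hx')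
    rw [hfy] at h2
    simpa only [chartMap, hinv x hx, hinv x' hx'] using h2

/-- The derivative of a diffeomorphism, read in charts. -/
def chartDerivEquiv (h : M ≃ₘ^1⟮𝓡 d, 𝓡 d⟯ M) (c c' x : M) : 𝔼 ≃L[ℝ] 𝔼 :=
  ((frame d c x).symm.trans (h.mfderivToContinuousLinearEquiv one_ne_zero x)).trans
    (frame d c' (h x))

theorem chartDerivEquiv_apply (h : M ≃ₘ^1⟮𝓡 d, 𝓡 d⟯ M) (c c' x : M) (v : 𝔼) :
    chartDerivEquiv h c c' x v = chartDeriv h c c' x v := rfl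

theorem chartDerivEquiv_symm_apply (h : M ≃ₘ^1⟮𝓡 d, 𝓡 d⟯ M) (c c' x : M) (v : 𝔼) :
    (chartDerivEquiv h c c' x).symm v = chartDeriv h.symm c' c (h x) v := by
  rw [ContinuousLinearEquiv.symm_apply_eq, chartDerivEquiv_apply]
  have h1 : chartDeriv (d := d) (h.symm ∘ h) c c x = ContinuousLinearMap.id ℝ 𝔼 := by
    rw [show (h.symm ∘ h : M → M) = id from funext h.symm_apply_apply, chartDeriv_id]
  rw [chartDeriv_comp c c' c (h.mdifferentiable one_ne_zero x)
    (h.symm.mdifferentiable one_ne_zero (h x))] at h1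
  obtain ⟨w, rfl⟩ := (chartDerivEquiv h c c' x).surjective v
  rw [chartDerivEquiv_apply]
  congr 1
  exact (congrArg (fun L => L w) h1).symm

end Atlas

/-! ### Dominated splittings along iterates -/

section Iterates

variable {d : ℕ} {M : Type*} [EMetricSpace M] [ChartedSpace (EuclideanSpace ℝ (Fin d)) M]

local notation "𝔼" => EuclideanSpace ℝ (Fin d)

/-- The iterates of a diffeomorphism. -/
def iterDiffeo (f : M ≃ₘ^1⟮𝓡 d, 𝓡 d⟯ M) (t : ℕ) : M ≃ₘ^1⟮𝓡 d, 𝓡 d⟯ M where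
  toFun := f^[t]
  invFun := f.symm^[t]
  left_inv := Function.LeftInverse.iterate f.symm_apply_apply t
  right_inv := Function.RightInverse.iterate f.apply_symm_apply t
  contMDiff_toFun := f.contMDiff.iterate t
  contMDiff_invFun := f.symm.contMDiff.iterate t

theorem mdifferentiableAt_iterate (f : M ≃ₘ^1⟮𝓡 d, 𝓡 d⟯ M) (t : ℕ) (x : M) :
    MDifferentiableAt (𝓡 d) (𝓡 d) f^[t] x :=
  (iterDiffeo f t).mdifferentiable one_ne_zero x

theorem mfderiv_iterate_succ (f : M ≃ₘ^1⟮𝓡 d, 𝓡 d⟯ M) (t : ℕ) (x : M)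
    (v : TangentSpace (𝓡 d) x) :
    mfderiv (𝓡 d) (𝓡 d) (f ∘ f^[t]) x v =
      mfderiv (𝓡 d) (𝓡 d) f (f^[t] x) (mfderiv (𝓡 d) (𝓡 d) f^[t] x v) := by
  rw [mfderiv_comp x (f.mdifferentiable one_ne_zero _) (mdifferentiableAt_iterate f t x)]
  rfl

/-- The splitting `E ⊕ F` over `Λ` is invariant and given by the projections `P`; `α` and `β` bound
the expansion of the norms `ν` along `E` by `f` and along `F` by the inverse of `f`, and `α'` and
`β'` those of `ν'`, for which the splitting is dominated. -/
structure IsDominatedData (f : M ≃ₘ^1⟮𝓡 d, 𝓡 d⟯ M) (Λ : Set M)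
    (E F : (x : M) → Submodule ℝ (TangentSpace (𝓡 d) x)) (s : ℕ)
    (P : (x : M) → TangentSpace (𝓡 d) x →L[ℝ] TangentSpace (𝓡 d) x)
    (ν ν' : (x : M) → TangentSpace (𝓡 d) x → ℝ) (α β α' β' : M → ℝ) : Prop where
  invariant : IsInvariantSplitting f Λ E F s
  image_subset : ∀ x ∈ Λ, f x ∈ Λ
  proj_left : ∀ x ∈ Λ, ∀ v ∈ E x, P x v = v
  proj_right : ∀ x ∈ Λ, ∀ v ∈ F x, P x v = 0
  nonneg : ∀ x, 0 ≤ α x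
  nonneg_right : ∀ x, 0 ≤ β x
  nonneg' : ∀ x, 0 ≤ α' x
  nonneg_right' : ∀ x, 0 ≤ β' x
  left : ∀ x ∈ Λ, ∀ v ∈ E x, ν (f x) (mfderiv (𝓡 d) (𝓡 d) f x v) ≤ α x * ν x v
  right : ∀ x ∈ Λ, ∀ v ∈ F x, ν x v ≤ β x * ν (f x) (mfderiv (𝓡 d) (𝓡 d) f x v)
  left' : ∀ x ∈ Λ, ∀ v ∈ E x, ν' (f x) (mfderiv (𝓡 d) (𝓡 d) f x v) ≤ α' x * ν' x v
  right' : ∀ x ∈ Λ, ∀ v ∈ F x, ν' x v ≤ β' x * ν' (f x) (mfderiv (𝓡 d) (𝓡 d) f x v)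
  dominated : ∀ x ∈ Λ, α' x * β' x ≤ 1 / 2

variable {f : M ≃ₘ^1⟮𝓡 d, 𝓡 d⟯ M} {Λ : Set M}
    {E F : (x : M) → Submodule ℝ (TangentSpace (𝓡 d) x)} {s : ℕ}
    {P : (x : M) → TangentSpace (𝓡 d) x →L[ℝ] TangentSpace (𝓡 d) x}
    {ν ν' : (x : M) → TangentSpace (𝓡 d) x → ℝ} {α β α' β' : M → ℝ}

theorem iterate_mem_of_maps (h : ∀ x ∈ Λ, f x ∈ Λ) {x : M} (hx : x ∈ Λ) (t : ℕ) :
    f^[t] x ∈ Λ := MapsTo.iterate (s := Λ) h t hx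

theorem mfderiv_iterate_mem (h : ∀ x ∈ Λ, f x ∈ Λ)
    (hE : ∀ x ∈ Λ, (E x).map (mfderiv (𝓡 d) (𝓡 d) f x :
      TangentSpace (𝓡 d) x →ₗ[ℝ] TangentSpace (𝓡 d) (f x)) = E (f x))
    {x : M} (hx : x ∈ Λ) {v : TangentSpace (𝓡 d) x} (hv : v ∈ E x) (t : ℕ) :
    mfderiv (𝓡 d) (𝓡 d) f^[t] x v ∈ E (f^[t] x) := by
  induction t with
  | zero =>
    rw [show f^[0] = (id : M → M) from rfl, mfderiv_id]
    exact hv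
  | succ t ih =>
    have h1 : f^[t + 1] = f ∘ f^[t] := Function.iterate_succ' f t
    rw [h1, mfderiv_iterate_succ]
    show _ ∈ E (f (f^[t] x))
    rw [← hE _ (iterate_mem_of_maps h hx t)]
    exact Submodule.mem_map_of_mem ih

theorem norm_mfderiv_iterate_le (h : ∀ x ∈ Λ, f x ∈ Λ)
    (hE : ∀ x ∈ Λ, (E x).map (mfderiv (𝓡 d) (𝓡 d) f x :
      TangentSpace (𝓡 d) x →ₗ[ℝ] TangentSpace (𝓡 d) (f x)) = E (f x)) (hα : ∀ x, 0 ≤ α x)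
    (hle : ∀ x ∈ Λ, ∀ v ∈ E x, ν (f x) (mfderiv (𝓡 d) (𝓡 d) f x v) ≤ α x * ν x v)
    {x : M} (hx : x ∈ Λ) {v : TangentSpace (𝓡 d) x} (hv : v ∈ E x) (t : ℕ) :
    ν (f^[t] x) (mfderiv (𝓡 d) (𝓡 d) f^[t] x v) ≤ (∏ i ∈ Finset.range t, α (f^[i] x)) * ν x v := by
  induction t with
  | zero =>
    rw [show f^[0] = (id : M → M) from rfl, mfderiv_id]
    simp
  | succ t ih =>
    have h1 : f^[t + 1] = f ∘ f^[t] := Function.iterate_succ' f t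
    rw [h1, mfderiv_iterate_succ, Finset.prod_range_succ]
    refine (hle _ (iterate_mem_of_maps h hx t) _ (mfderiv_iterate_mem h hE hx hv t)).trans ?_
    calc _ ≤ α (f^[t] x) * ((∏ i ∈ Finset.range t, α (f^[i] x)) * ν x v) :=
          mul_le_mul_of_nonneg_left ih (hα _)
      _ = _ := by ring

theorem norm_le_mfderiv_iterate (h : ∀ x ∈ Λ, f x ∈ Λ)
    (hF : ∀ x ∈ Λ, (F x).map (mfderiv (𝓡 d) (𝓡 d) f x :
      TangentSpace (𝓡 d) x →ₗ[ℝ] TangentSpace (𝓡 d) (f x)) = F (f x)) (hβ : ∀ x, 0 ≤ β x)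
    (hle : ∀ x ∈ Λ, ∀ v ∈ F x, ν x v ≤ β x * ν (f x) (mfderiv (𝓡 d) (𝓡 d) f x v))
    {x : M} (hx : x ∈ Λ) {v : TangentSpace (𝓡 d) x} (hv : v ∈ F x) (t : ℕ) :
    ν x v ≤ (∏ i ∈ Finset.range t, β (f^[i] x)) *
      ν (f^[t] x) (mfderiv (𝓡 d) (𝓡 d) f^[t] x v) := by
  induction t with
  | zero =>
    rw [show f^[0] = (id : M → M) from rfl, mfderiv_id]
    simp
  | succ t ih =>
    have h1 : f^[t + 1] = f ∘ f^[t] := Function.iterate_succ' f t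
    rw [h1, mfderiv_iterate_succ, Finset.prod_range_succ]
    have h2 := hle _ (iterate_mem_of_maps h hx t) _ (mfderiv_iterate_mem h hF hx hv t)
    calc _ ≤ _ := ih
      _ ≤ (∏ i ∈ Finset.range t, β (f^[i] x)) * (β (f^[t] x) *
          ν (f (f^[t] x)) (mfderiv (𝓡 d) (𝓡 d) f (f^[t] x) (mfderiv (𝓡 d) (𝓡 d) f^[t] x v))) :=
        mul_le_mul_of_nonneg_left h2 (Finset.prod_nonneg fun i _ => hβ _)
      _ = _ := by rw [mul_assoc]; rfl

namespace IsDominatedData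

variable (H : IsDominatedData f Λ E F s P ν ν' α β α' β')

include H

theorem proj_mem {x : M} (hx : x ∈ Λ) (v : TangentSpace (𝓡 d) x) :
    P x v ∈ E x ∧ v - P x v ∈ F x := by
  have h : v ∈ E x ⊔ F x := by rw [(H.invariant.isCompl x hx).sup_eq_top]; trivial
  obtain ⟨e, he, w, hw, rfl⟩ := Submodule.mem_sup.1 h
  rw [map_add, H.proj_left x hx e he, H.proj_right x hx w hw, add_zero, add_sub_cancel_left]
  exact ⟨he, hw⟩

theorem proj_proj {x : M} (hx : x ∈ Λ) (v : TangentSpace (𝓡 d) x) : P x (P x v) = P x v :=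
  H.proj_left x hx _ (H.proj_mem hx v).1

theorem mem_left_iff {x : M} (hx : x ∈ Λ) (v : TangentSpace (𝓡 d) x) : v ∈ E x ↔ P x v = v :=
  ⟨H.proj_left x hx v, fun h => h ▸ (H.proj_mem hx v).1⟩

theorem mem_right_iff {x : M} (hx : x ∈ Λ) (v : TangentSpace (𝓡 d) x) : v ∈ F x ↔ P x v = 0 :=
  ⟨H.proj_right x hx v, fun h => by simpa [h] using (H.proj_mem hx v).2⟩

theorem proj_mfderiv {x : M} (hx : x ∈ Λ) (t : ℕ) (v : TangentSpace (𝓡 d) x) :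
    mfderiv (𝓡 d) (𝓡 d) f^[t] x (P x v) = P (f^[t] x) (mfderiv (𝓡 d) (𝓡 d) f^[t] x v) := by
  have hxt := iterate_mem_of_maps H.image_subset hx t
  have h1 := H.proj_left _ hxt _
    (mfderiv_iterate_mem H.image_subset H.invariant.map_left hx (H.proj_mem hx v).1 t)
  have h2 := H.proj_right _ hxt _
    (mfderiv_iterate_mem H.image_subset H.invariant.map_right hx (H.proj_mem hx v).2 t)
  rw [map_sub, map_sub, sub_eq_zero] at h2
  rw [← h1, h2]

variable [IsManifold (𝓡 d) ∞ M]

theorem localProj_localProj (c : M) {x : M} (hx : x ∈ Λ) (v : 𝔼) :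
    localProj P c x (localProj P c x v) = localProj P c x v := by
  simp only [localProj_apply, ContinuousLinearEquiv.symm_apply_apply, H.proj_proj hx]

theorem chartDerivEquiv_localProj (c c' : M) {x : M} (hx : x ∈ Λ) (t : ℕ) (v : 𝔼) :
    chartDerivEquiv (iterDiffeo f t) c c' x (localProj P c x v) =
      localProj P c' (f^[t] x) (chartDerivEquiv (iterDiffeo f t) c c' x v) := by
  simp only [chartDerivEquiv_apply, chartDeriv_apply, localProj_apply,
    ContinuousLinearEquiv.symm_apply_apply]
  have h := H.proj_mfderiv hx t ((frame d c x).symm v)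
  exact (congrArg (frame d c' (f^[t] x)) h).trans
    (congrArg (fun w => frame d c' (f^[t] x) (P (f^[t] x) w))
      ((frame d c' (f^[t] x)).symm_apply_apply _).symm)

theorem finrank_range_localProj (c : M) {x : M} (hx : x ∈ Λ) :
    Module.finrank ℝ (LinearMap.range (localProj P c x : 𝔼 →ₗ[ℝ] 𝔼)) = s := by
  have h : LinearMap.range (localProj P c x : 𝔼 →ₗ[ℝ] 𝔼) =
      (E x).map ((frame d c x).toLinearEquiv : TangentSpace (𝓡 d) x →ₗ[ℝ] 𝔼) := by
    ext v
    simp only [LinearMap.mem_range, Submodule.mem_map]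
    constructor
    · rintro ⟨w, rfl⟩
      exact ⟨P x ((frame d c x).symm w), (H.proj_mem hx _).1, rfl⟩
    · rintro ⟨u, hu, rfl⟩
      refine ⟨frame d c x u, ?_⟩
      show localProj P c x (frame d c x u) = frame d c x u
      rw [localProj_apply, ContinuousLinearEquiv.symm_apply_apply, H.proj_left x hx u hu]
  rw [h]
  exact (LinearEquiv.finrank_map_eq (frame d c x).toLinearEquiv (E x)).trans
    (H.invariant.finrank_eq x hx)

variable {T : Finset M} {B : M → Set M} {C : ℝ} {r₀ : ℝ≥0∞}

/-- The minimum keeps both sources of information: `α` carries the Pesin rate for the given norm,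
`α'` the domination for the other one. Charts are changed only at the two ends, so the loss is `C ^
2` whatever the length `t`. -/
theorem norm_chartDeriv_le_of_proj (hA : IsGoodAtlas ν ν' P Λ T B C r₀) {c c' x : M} (hc : c ∈ T)
    (hc' : c' ∈ T) (hx : x ∈ Λ) (hxc : x ∈ B c) {t : ℕ} (hxt : f^[t] x ∈ B c') {v : 𝔼}
    (hv : localProj P c x v = v) :
    ‖chartDerivEquiv (iterDiffeo f t) c c' x v‖ ≤
      min (C ^ 2 * ∏ i ∈ Finset.range t, α (f^[i] x)) (C ^ 2 * ∏ i ∈ Finset.range t, α' (f^[i] x))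
        * ‖v‖ := by
  set u := (frame d c x).symm v with hu
  have hC : 0 ≤ C := zero_le_one.trans hA.one_le
  have huE : u ∈ E x := by
    rw [H.mem_left_iff hx]
    apply (frame d c x).injective
    rw [hu, ← localProj_apply, hv, ContinuousLinearEquiv.apply_symm_apply]
  have hvu : v = frame d c x u := by rw [hu, ContinuousLinearEquiv.apply_symm_apply]
  have h1 := norm_mfderiv_iterate_le H.image_subset H.invariant.map_left H.nonneg H.left hx huE t
  have h1' := norm_mfderiv_iterate_le H.image_subset H.invariant.map_left H.nonneg' H.left' hx huE t
  have h2 := (hA.norm_frame_le c' hc' _ hxt (mfderiv (𝓡 d) (𝓡 d) f^[t] x u)).1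
  have h2' := (hA.norm_frame_le' c' hc' _ hxt (mfderiv (𝓡 d) (𝓡 d) f^[t] x u)).1
  have h3 := (hA.norm_frame_le c hc _ hxc u).2
  have h3' := (hA.norm_frame_le' c hc _ hxc u).2
  rw [← hvu] at h3 h3'
  have h4 : chartDerivEquiv (iterDiffeo f t) c c' x v =
    frame d c' (f^[t] x) (mfderiv (𝓡 d) (𝓡 d) f^[t] x u) := rfl
  have p1 : 0 ≤ ∏ i ∈ Finset.range t, α (f^[i] x) := Finset.prod_nonneg fun i _ => H.nonneg _
  have p2 : 0 ≤ ∏ i ∈ Finset.range t, α' (f^[i] x) := Finset.prod_nonneg fun i _ => H.nonneg' _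
  rw [min_mul_of_nonneg _ _ (norm_nonneg v), h4]
  refine le_min ?_ ?_
  · calc _ ≤ C * ((∏ i ∈ Finset.range t, α (f^[i] x)) * (C * ‖v‖)) :=
        h2.trans (mul_le_mul_of_nonneg_left (h1.trans (mul_le_mul_of_nonneg_left h3 p1)) hC)
      _ = _ := by ring
  · calc _ ≤ C * ((∏ i ∈ Finset.range t, α' (f^[i] x)) * (C * ‖v‖)) :=
        h2'.trans (mul_le_mul_of_nonneg_left (h1'.trans (mul_le_mul_of_nonneg_left h3' p2)) hC)
      _ = _ := by ring

theorem norm_chartDeriv_symm_le_of_proj (hA : IsGoodAtlas ν ν' P Λ T B C r₀) {c c' x : M}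
    (hc : c ∈ T) (hc' : c' ∈ T) (hx : x ∈ Λ) (hxc : x ∈ B c) {t : ℕ} (hxt : f^[t] x ∈ B c') {v : 𝔼}
    (hv : localProj P c' (f^[t] x) v = 0) :
    ‖(chartDerivEquiv (iterDiffeo f t) c c' x).symm v‖ ≤
      min (C ^ 2 * ∏ i ∈ Finset.range t, β (f^[i] x)) (C ^ 2 * ∏ i ∈ Finset.range t, β' (f^[i] x))
        * ‖v‖ := by
  set w := (chartDerivEquiv (iterDiffeo f t) c c' x).symm v with hw
  have hvw : v = chartDerivEquiv (iterDiffeo f t) c c' x w := by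
    rw [hw, ContinuousLinearEquiv.apply_symm_apply]
  set u := (frame d c x).symm w with hu
  have hwu : w = frame d c x u := by rw [hu, ContinuousLinearEquiv.apply_symm_apply]
  have hC : 0 ≤ C := zero_le_one.trans hA.one_le
  have huF : u ∈ F x := by
    rw [H.mem_right_iff hx]
    apply (frame d c x).injective
    rw [hu, ← localProj_apply, map_zero]
    rw [hvw, ← H.chartDerivEquiv_localProj c c' hx] at hv
    exact (map_eq_zero_iff _ (chartDerivEquiv (iterDiffeo f t) c c' x).injective).1 hv
  have h1 := norm_le_mfderiv_iterate H.image_subset H.invariant.map_right H.nonneg_right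
    H.right hx huF t
  have h1' := norm_le_mfderiv_iterate H.image_subset H.invariant.map_right H.nonneg_right'
    H.right' hx huF t
  have h4 : v = frame d c' (f^[t] x) (mfderiv (𝓡 d) (𝓡 d) f^[t] x u) := hvw
  have h2 := (hA.norm_frame_le c' hc' _ hxt (mfderiv (𝓡 d) (𝓡 d) f^[t] x u)).2
  have h2' := (hA.norm_frame_le' c' hc' _ hxt (mfderiv (𝓡 d) (𝓡 d) f^[t] x u)).2
  rw [← h4] at h2 h2'
  have h3 := (hA.norm_frame_le c hc _ hxc u).1
  have h3' := (hA.norm_frame_le' c hc _ hxc u).1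
  rw [← hwu] at h3 h3'
  have p1 : 0 ≤ ∏ i ∈ Finset.range t, β (f^[i] x) :=
    Finset.prod_nonneg fun i _ => H.nonneg_right _
  have p2 : 0 ≤ ∏ i ∈ Finset.range t, β' (f^[i] x) :=
    Finset.prod_nonneg fun i _ => H.nonneg_right' _
  rw [min_mul_of_nonneg _ _ (norm_nonneg v)]
  refine le_min ?_ ?_
  · calc _ ≤ C * ((∏ i ∈ Finset.range t, β (f^[i] x)) * (C * ‖v‖)) :=
        h3.trans (mul_le_mul_of_nonneg_left (h1.trans (mul_le_mul_of_nonneg_left h2 p1)) hC)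
      _ = _ := by ring
  · calc _ ≤ C * ((∏ i ∈ Finset.range t, β' (f^[i] x)) * (C * ‖v‖)) :=
        h3'.trans (mul_le_mul_of_nonneg_left (h1'.trans (mul_le_mul_of_nonneg_left h2' p2)) hC)
      _ = _ := by ring

end IsDominatedData

end Iterates

/-! ### Cutting orbit segments into blocks -/

theorem prod_Ico_prod_range_sub {a : ℕ → ℝ} {σ : ℕ → ℕ} {q : ℕ}
    (hσ : ∀ r < q, σ r ≤ σ (r + 1)) {l m : ℕ} (hlm : l ≤ m) (hmq : m ≤ q) :
    σ l ≤ σ m ∧ ∏ r ∈ Finset.Ico l m, ∏ i ∈ Finset.range (σ (r + 1) - σ r), a (σ r + i) =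
      ∏ i ∈ Finset.Ico (σ l) (σ m), a i := by
  induction m, hlm using Nat.le_induction with
  | base => simp
  | succ m hlm ih =>
    obtain ⟨h1, h2⟩ := ih (by omega)
    have h3 := hσ m (by omega)
    refine ⟨h1.trans h3, ?_⟩
    rw [Finset.prod_Ico_succ_top hlm, h2, ← Finset.prod_Ico_eq_prod_range,
      Finset.prod_Ico_consecutive _ h1 h3]

/-- The times that cut `{0, …, n}` into `n / N` blocks of lengths between `N` and `2 * N`. -/
def cutTime (n N r : ℕ) : ℕ := if r < n / N then r * N else n

theorem cutTime_zero {n N : ℕ} (hN : 0 < N) (hn : N ≤ n) : cutTime n N 0 = 0 := by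
  simp [cutTime, Nat.div_pos hn hN]

@[simp] theorem cutTime_last (n N : ℕ) : cutTime n N (n / N) = n := by simp [cutTime]

theorem cutTime_succ {n N r : ℕ} (hN : 0 < N) (hr : r < n / N) :
    cutTime n N r + N ≤ cutTime n N (r + 1) ∧ cutTime n N (r + 1) ≤ cutTime n N r + 2 * N ∧
      cutTime n N (r + 1) ≤ n := by
  have h1 := Nat.div_mul_le_self n N
  have h2 := Nat.lt_div_mul_add hN (a := n)
  have h3 : (r + 1) * N ≤ n / N * N := Nat.mul_le_mul_right N hr
  have h4 : (r + 1) * N = r * N + N := by ring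
  unfold cutTime
  rw [if_pos hr]
  split_ifs with h
  · omega
  · have h5 : r + 1 = n / N := by omega
    rw [← h5] at h1 h2
    omega

theorem mul_le_cutTime_sub {n N l m : ℕ} (hN : 0 < N) (hlm : l ≤ m) (hm : m ≤ n / N) :
    cutTime n N l + (m - l) * N ≤ cutTime n N m := by
  induction m, hlm using Nat.le_induction with
  | base => simp
  | succ m hlm ih =>
    have h1 := ih (by omega)
    have h2 := (cutTime_succ (n := n) hN (r := m) (by omega)).1
    have h3 : (m + 1 - l) * N = (m - l) * N + N := by
      rw [show m + 1 - l = (m - l) + 1 by omega]; ring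
    omega

/-! ### Networks of orbit blocks and uniform choices over the atlas -/

section Network

variable {d : ℕ} {M : Type*} [EMetricSpace M] [ChartedSpace (EuclideanSpace ℝ (Fin d)) M]

local notation "𝔼" => EuclideanSpace ℝ (Fin d)

/-- The successor relation between the nodes `(i, r)`, `r < q`: the node `(i, r)` is followed by
`(i, r + 1)`, and the nodes `(i, q - 1)` are followed by all the nodes `(j, 0)`. -/
def NodeSucc {k : ℕ} (q : ℕ) (a b : Fin k × ℕ) : Prop :=
  a.2 < q ∧ ((a.2 + 1 < q ∧ b = (a.1, a.2 + 1)) ∨ (a.2 + 1 = q ∧ b.2 = 0))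

variable [IsManifold (𝓡 d) ∞ M]

/-- The orbit segments of length `n` of the points `p i`, cut at the times `σ r`, form a network
along which the iterates of `f` are uniformly hyperbolic in the charts at `c a`. -/
structure IsNetwork (f : M ≃ₘ^1⟮𝓡 d, 𝓡 d⟯ M) (s n k q : ℕ) (p : Fin k → M)
    (ν : (x : M) → TangentSpace (𝓡 d) x → ℝ) (C : ℝ) (δ : ℝ≥0∞) (σ : ℕ → ℕ)
    (c : Fin k × ℕ → M) (y : Fin k × ℕ → M) (t : Fin k × ℕ → ℕ) (P : Fin k × ℕ → 𝔼 →L[ℝ] 𝔼)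
    (B : Fin k × ℕ → Fin k × ℕ → 𝔼 →L[ℝ] 𝔼)
    (g : Fin k × ℕ → ℝ) (ρ r : ℝ) : Prop where
  pos_q : 0 < q
  cut_zero : σ 0 = 0
  cut_last : σ q = n
  cut_lt : ∀ j < q, σ j < σ (j + 1)
  point_eq : ∀ a, y a = f^[σ a.2] (p a.1)
  time_eq : ∀ a, t a = σ (a.2 + 1) - σ a.2
  one_le : 1 ≤ C
  pos_rad : 0 < r
  rad_le : 2 * r ≤ ρ
  mem_source : ∀ a, a.2 < q → y a ∈ (chartAt 𝔼 (c a)).source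
  proj : ∀ a, a.2 < q → ∀ v, P a (P a v) = P a v
  finrank : ∀ a, a.2 < q → Module.finrank ℝ (LinearMap.range (P a : 𝔼 →ₗ[ℝ] 𝔼)) = s
  pos : ∀ a, a.2 < q → 0 < g a
  le_one : ∀ a, a.2 < q → g a ≤ 1
  norm_frame_le : ∀ a, a.2 < q → ∀ x, edist x (y a) ≤ 3 * δ → ∀ v : TangentSpace (𝓡 d) x,
    ‖frame d (c a) x v‖ ≤ C * ν x v ∧ ν x v ≤ C * ‖frame d (c a) x v‖
  near : ∀ a, a.2 < q → ∀ x, edist x (y a) ≤ 3 * δ → Near (d := d) (c a) (y a) ρ x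
  close : ∀ a, a.2 < q → ∀ x, Near (d := d) (c a) (y a) (2 * r) x → ∀ l ≤ t a,
    edist (f^[l] x) (f^[l] (y a)) ≤ δ
  target : ∀ a, a.2 < q → ∀ u, ‖u - extChartAt (𝓡 d) (c a) (y a)‖ ≤ ρ →
    u ∈ (extChartAt (𝓡 d) (c a)).target
  backward : ∀ a b, NodeSucc q a b → IsBackward (P a) (P b) (B a b) (g a) (g b)
  map_source : ∀ a b, NodeSucc q a b → ∀ x, Near (d := d) (c a) (y a) ρ x →
    f^[t a] x ∈ (chartAt 𝔼 (c b)).source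
  pair : ∀ a b, NodeSucc q a b → ∀ x, Near (d := d) (c a) (y a) ρ x → ∀ x',
    Near (d := d) (c a) (y a) ρ x' → HypPair (P a) (P b) (B a b) (g a) (g b)
      (extChartAt (𝓡 d) (c a) x - extChartAt (𝓡 d) (c a) x')
      (extChartAt (𝓡 d) (c b) (f^[t a] x) - extChartAt (𝓡 d) (c b) (f^[t a] x'))
  deriv : ∀ a b, NodeSucc q a b → ∀ x, Near (d := d) (c a) (y a) ρ x → ∀ v,
    HypPair (P a) (P b) (B a b) (g a) (g b) v (chartDerivEquiv (iterDiffeo f (t a)) (c a) (c b) x v)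
  jump : ∀ a b, NodeSucc q a b →
    splitNorm (P b) (extChartAt (𝓡 d) (c b) (f^[t a] (y a)) - extChartAt (𝓡 d) (c b) (y b)) / g b
      ≤ r / 2

variable {f : M ≃ₘ^1⟮𝓡 d, 𝓡 d⟯ M} {Λ : Set M}
    {E F : (x : M) → Submodule ℝ (TangentSpace (𝓡 d) x)} {s : ℕ}
    {P : (x : M) → TangentSpace (𝓡 d) x →L[ℝ] TangentSpace (𝓡 d) x}
    {ν ν' : (x : M) → TangentSpace (𝓡 d) x → ℝ} {α β α' β' : M → ℝ}
    {T : Finset M} {A : M → Set M} {C : ℝ} {r₀ : ℝ≥0∞}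

namespace IsGoodAtlas

variable (hA : IsGoodAtlas ν ν' P Λ T A C r₀)

include hA

theorem exists_norm_chartDerivEquiv_le (f : M ≃ₘ^1⟮𝓡 d, 𝓡 d⟯ M) (m : ℕ) :
    ∃ D : ℝ, 1 ≤ D ∧ ∀ t < m, ∀ c ∈ T, ∀ c' ∈ T, ∀ x ∈ A c, f^[t] x ∈ A c' → ∀ v : 𝔼,
      ‖chartDerivEquiv (iterDiffeo f t) c c' x v‖ ≤ D * ‖v‖ ∧
      ‖(chartDerivEquiv (iterDiffeo f t) c c' x).symm v‖ ≤ D * ‖v‖ := by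
  obtain ⟨D, hD, h⟩ := exists_forall_mem_finset_of_mono (Finset.range m ×ˢ T ×ˢ T)
    (p := fun a D => ∀ x ∈ A a.2.1, f^[a.1] x ∈ A a.2.2 → ∀ v : 𝔼,
      ‖chartDerivEquiv (iterDiffeo f a.1) a.2.1 a.2.2 x v‖ ≤ D * ‖v‖ ∧
      ‖(chartDerivEquiv (iterDiffeo f a.1) a.2.1 a.2.2 x).symm v‖ ≤ D * ‖v‖)
    (fun a D D' hDD h x hx hx' v => ⟨(h x hx hx' v).1.trans (by gcongr),
      (h x hx hx' v).2.trans (by gcongr)⟩)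
    (by
      rintro ⟨t, c, c'⟩ hmem
      simp only [Finset.mem_product] at hmem
      obtain ⟨-, hc, hc'⟩ := hmem
      obtain ⟨D₁, h1⟩ := exists_norm_chartDeriv_le (iterDiffeo f t) (hA.isCompact c hc)
        (hA.isCompact c' hc') (hA.subset c hc) (hA.subset c' hc')
      obtain ⟨D₂, h2⟩ := exists_norm_chartDeriv_le (iterDiffeo f t).symm (hA.isCompact c' hc')
        (hA.isCompact c hc) (hA.subset c' hc') (hA.subset c hc)
      refine ⟨max D₁ D₂, fun x hx hx' v => ⟨?_, ?_⟩⟩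
      · rw [chartDerivEquiv_apply]
        exact (h1 x hx hx' v).trans (by gcongr; exact le_max_left _ _)
      · rw [chartDerivEquiv_symm_apply]
        refine (h2 (iterDiffeo f t x) hx' ?_ v).trans (by gcongr; exact le_max_right _ _)
        rwa [Diffeomorph.symm_apply_apply])
  exact ⟨D, hD, fun t ht c hc c' hc' => h (t, c, c') (by simp [ht, hc, hc'])⟩

theorem exists_chartMap_uniform (f : M ≃ₘ^1⟮𝓡 d, 𝓡 d⟯ M) (m : ℕ) {ζ : ℝ} (hζ : 0 < ζ) :
    ∃ ρ > (0 : ℝ), ∀ t < m, ∀ c ∈ T, ∀ c' ∈ T, ∀ y ∈ A c, f^[t] y ∈ A c' →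
      (∀ u, ‖u - extChartAt (𝓡 d) c y‖ ≤ ρ → u ∈ (extChartAt (𝓡 d) c).target) ∧
      (∀ x, Near (d := d) c y ρ x → f^[t] x ∈ (chartAt 𝔼 c').source ∧
        ∀ v : 𝔼, ‖chartDerivEquiv (iterDiffeo f t) c c' x v -
          chartDerivEquiv (iterDiffeo f t) c c' y v‖ ≤ ζ * ‖v‖) ∧
      ∀ x, Near (d := d) c y ρ x → ∀ x', Near (d := d) c y ρ x' →
        ‖(extChartAt (𝓡 d) c' (f^[t] x) - extChartAt (𝓡 d) c' (f^[t] x')) -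
          chartDerivEquiv (iterDiffeo f t) c c' y
            (extChartAt (𝓡 d) c x - extChartAt (𝓡 d) c x')‖
          ≤ ζ * ‖extChartAt (𝓡 d) c x - extChartAt (𝓡 d) c x'‖ := by
  obtain ⟨ρ, hρ, h⟩ := exists_pos_forall_mem_finset (α := ℝ) ⟨1, one_pos⟩
    (Finset.range m ×ˢ T ×ˢ T)
    (p := fun a ρ => ∀ y ∈ A a.2.1, f^[a.1] y ∈ A a.2.2 →
      (∀ u, ‖u - extChartAt (𝓡 d) a.2.1 y‖ ≤ ρ → u ∈ (extChartAt (𝓡 d) a.2.1).target) ∧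
      (∀ x, Near (d := d) a.2.1 y ρ x → f^[a.1] x ∈ (chartAt 𝔼 a.2.2).source ∧
        ∀ v : 𝔼, ‖chartDerivEquiv (iterDiffeo f a.1) a.2.1 a.2.2 x v -
          chartDerivEquiv (iterDiffeo f a.1) a.2.1 a.2.2 y v‖ ≤ ζ * ‖v‖) ∧
      ∀ x, Near (d := d) a.2.1 y ρ x → ∀ x', Near (d := d) a.2.1 y ρ x' →
        ‖(extChartAt (𝓡 d) a.2.2 (f^[a.1] x) - extChartAt (𝓡 d) a.2.2 (f^[a.1] x')) -
          chartDerivEquiv (iterDiffeo f a.1) a.2.1 a.2.2 y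
            (extChartAt (𝓡 d) a.2.1 x - extChartAt (𝓡 d) a.2.1 x')‖
          ≤ ζ * ‖extChartAt (𝓡 d) a.2.1 x - extChartAt (𝓡 d) a.2.1 x'‖)
    (fun a b b' hbb h y hy hy' => by
      obtain ⟨h1, h2, h3⟩ := h y hy hy'
      exact ⟨fun u hu => h1 u (hu.trans hbb), fun x hx => h2 x (hx.mono hbb),
        fun x hx x' hx' => h3 x (hx.mono hbb) x' (hx'.mono hbb)⟩)
    (by
      rintro ⟨t, c, c'⟩ hmem
      simp only [Finset.mem_product] at hmem
      obtain ⟨-, hc, hc'⟩ := hmem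
      exact DominatedHorseshoe.exists_chartMap_uniform (iterDiffeo f t) (hA.isCompact c hc)
        (hA.isCompact c' hc') (hA.subset c hc) (hA.subset c' hc') hζ)
  exact ⟨ρ, hρ, fun t ht c hc c' hc' => h (t, c, c') (by simp [ht, hc, hc'])⟩

theorem exists_localProj_close (hΛ : IsCompact Λ) {ζ : ℝ} (hζ : 0 < ζ) :
    ∃ η > (0 : ℝ≥0∞), ∀ c ∈ T, ∀ x ∈ Λ ∩ A c, ∀ y ∈ Λ ∩ A c, edist x y < η → ∀ v : 𝔼,
      ‖localProj P c x v - localProj P c y v‖ ≤ ζ * ‖v‖ := by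
  refine exists_pos_forall_mem_finset ⟨1, one_pos⟩ T
    (fun c a b hab h x hx y hy hxy => h x hx y hy (hxy.trans_le hab)) fun c hc => ?_
  obtain ⟨η, hη, h⟩ := EMetric.uniformContinuousOn_iff.1
    ((hΛ.inter (hA.isCompact c hc)).uniformContinuousOn_of_continuous (hA.continuousOn c hc))
    (ENNReal.ofReal ζ) (by simpa using hζ)
  refine ⟨η, hη, fun x hx y hy hxy v => ?_⟩
  have h1 := h hx hy hxy
  rw [edist_dist, ENNReal.ofReal_lt_ofReal_iff hζ, dist_eq_norm] at h1
  exact ((localProj P c x - localProj P c y).le_opNorm v).trans (by gcongr)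

theorem exists_near {ρ : ℝ} (hρ : 0 < ρ) :
    ∃ δ > (0 : ℝ≥0∞), ∀ c ∈ T, ∀ y ∈ A c, ∀ x ∈ A c, edist x y < δ → Near (d := d) c y ρ x :=
  exists_pos_forall_mem_finset ⟨1, one_pos⟩ T
    (fun _ _ _ hab h y hy x hx hxy => h y hy x hx (hxy.trans_le hab))
    fun c hc => exists_near_of_edist_lt (hA.isCompact c hc) (hA.subset c hc) hρ

theorem exists_edist_iterate_le [CompactSpace M] (f : M ≃ₘ^1⟮𝓡 d, 𝓡 d⟯ M) (m : ℕ) {δ : ℝ≥0∞}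
    (hδ : 0 < δ) :
    ∃ r > (0 : ℝ), ∀ c ∈ T, ∀ y ∈ A c, ∀ x, Near (d := d) c y r x → ∀ l < m,
      edist (f^[l] x) (f^[l] y) ≤ δ := by
  obtain ⟨δ', hδ', h1⟩ : ∃ δ' > (0 : ℝ≥0∞), ∀ l ∈ Finset.range m, ∀ x y, edist x y < δ' →
      edist (f^[l] x) (f^[l] y) ≤ δ := by
    refine exists_pos_forall_mem_finset ⟨1, one_pos⟩ _
      (fun l a b hab h x y hxy => h x y (hxy.trans_le hab)) fun l _ => ?_
    obtain ⟨η, hη, h⟩ := EMetric.uniformContinuous_iff.1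
      (CompactSpace.uniformContinuous_of_continuous (f.continuous.iterate l)) δ hδ
    exact ⟨η, hη, fun x y hxy => (h hxy).le⟩
  obtain ⟨r, hr, h2⟩ : ∃ r > (0 : ℝ), ∀ c ∈ T, ∀ y ∈ A c, ∀ x, Near (d := d) c y r x →
      edist x y < δ' :=
    exists_pos_forall_mem_finset ⟨1, one_pos⟩ T
      (fun _ _ _ hab h y hy x hx => h y hy x (hx.mono hab))
      fun c hc => exists_edist_lt_of_near (hA.isCompact c hc) (hA.subset c hc) hδ'
  exact ⟨r, hr, fun c hc y hy x hx l hl => h1 l (Finset.mem_range.2 hl) x y (h2 c hc y hy x hx)⟩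

end IsGoodAtlas

end Network

/-- Each of the `m - l` blocks costs one factor `C` but contains at least `N` iterates on average,
so `lam ^ N` pays for it. -/
theorem prod_blocks_le {a w : ℕ → ℝ} {σ : ℕ → ℕ} {q l m N : ℕ} {C lam κ : ℝ}
    (hσ : ∀ r < q, σ r ≤ σ (r + 1)) (hlm : l ≤ m) (hmq : m ≤ q)
    (hN : σ l + (m - l) * N ≤ σ m) (hw0 : ∀ r < q, 0 ≤ w r)
    (hw : ∀ r < q, w r ≤ C * ∏ i ∈ Finset.range (σ (r + 1) - σ r), a (σ r + i))
    (ha : ∏ i ∈ Finset.Ico (σ l) (σ m), a i ≤ lam ^ (σ m - σ l)) (hC : 0 ≤ C) (h0 : 0 ≤ lam)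
    (h1 : lam ≤ 1) (hκ : C * lam ^ N ≤ κ) :
    ∏ r ∈ Finset.Ico l m, w r ≤ κ ^ (m - l) := by
  calc ∏ r ∈ Finset.Ico l m, w r
      ≤ ∏ r ∈ Finset.Ico l m, (C * ∏ i ∈ Finset.range (σ (r + 1) - σ r), a (σ r + i)) :=
        Finset.prod_le_prod (fun r hr => hw0 r ((Finset.mem_Ico.1 hr).2.trans_le hmq))
          fun r hr => hw r ((Finset.mem_Ico.1 hr).2.trans_le hmq)
    _ = C ^ (m - l) * ∏ i ∈ Finset.Ico (σ l) (σ m), a i := by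
        rw [Finset.prod_mul_distrib, Finset.prod_const, Nat.card_Ico,
          (prod_Ico_prod_range_sub hσ hlm hmq).2]
    _ ≤ C ^ (m - l) * lam ^ (N * (m - l)) := by
        refine mul_le_mul_of_nonneg_left (ha.trans ?_) (pow_nonneg hC _)
        refine pow_le_pow_of_le_one h0 h1 ?_
        rw [mul_comm]
        omega
    _ = (C * lam ^ N) ^ (m - l) := by rw [pow_mul, mul_pow]
    _ ≤ κ ^ (m - l) := pow_le_pow_left₀ (by positivity) hκ _

/-! ### Scales along a dominated orbit segment -/

section Network

variable {d : ℕ} {M : Type*} [EMetricSpace M] [ChartedSpace (EuclideanSpace ℝ (Fin d)) M]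
  [IsManifold (𝓡 d) ∞ M]

local notation "𝔼" => EuclideanSpace ℝ (Fin d)

variable {f : M ≃ₘ^1⟮𝓡 d, 𝓡 d⟯ M} {Λ : Set M}
    {E F : (x : M) → Submodule ℝ (TangentSpace (𝓡 d) x)} {s : ℕ}
    {P : (x : M) → TangentSpace (𝓡 d) x →L[ℝ] TangentSpace (𝓡 d) x}
    {ν ν' : (x : M) → TangentSpace (𝓡 d) x → ℝ} {α β α' β' : M → ℝ}
    {T : Finset M} {A : M → Set M} {C : ℝ} {r₀ : ℝ≥0∞}

/-- The abstract scales are applied with `κ = 1 / 8` to bounds for the block norms. The products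
from the start and up to the end of the segment are controlled by the Pesin rate through `hlam`, the
product of the two norms of one block by domination through `hdom`. -/
theorem IsDominatedData.exists_weights (H : IsDominatedData f Λ E F s P ν ν' α β α' β')
    (hA : IsGoodAtlas ν ν' P Λ T A C r₀) {lam D : ℝ} {N n : ℕ} (h0 : 0 ≤ lam) (h1 : lam ≤ 1)
    (hN : 0 < N) (hn : N ≤ n) (hD1 : 1 ≤ D)
    (hD : ∀ t < 2 * N + 1, ∀ c ∈ T, ∀ c' ∈ T, ∀ x ∈ A c, f^[t] x ∈ A c' → ∀ v : 𝔼,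
      ‖chartDerivEquiv (iterDiffeo f t) c c' x v‖ ≤ D * ‖v‖ ∧
      ‖(chartDerivEquiv (iterDiffeo f t) c c' x).symm v‖ ≤ D * ‖v‖)
    (hlam : C ^ 2 * lam ^ N ≤ 1 / 8) (hdom : C ^ 4 * (1 / 2) ^ N ≤ 1 / 64) {x : M} (hx : x ∈ Λ)
    (hα : ∀ m ≤ n, ∏ i ∈ Finset.range m, α (f^[i] x) ≤ lam ^ m)
    (hβ : ∀ m ≤ n, ∏ i ∈ Finset.Ico (n - m) n, β (f^[i] x) ≤ lam ^ m) {c : ℕ → M}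
    (hc : ∀ r ≤ n / N, c r ∈ T ∧ f^[cutTime n N r] x ∈ A (c r)) :
    ∃ g : ℕ → ℝ, g 0 = 1 ∧ g (n / N) = 1 ∧ ∀ r ≤ n / N, 0 < g r ∧ g r ≤ 1 ∧ (r < n / N →
      (∀ v : 𝔼, localProj P (c r) (f^[cutTime n N r] x) v = v →
        ‖chartDerivEquiv (iterDiffeo f (cutTime n N (r + 1) - cutTime n N r)) (c r) (c (r + 1))
          (f^[cutTime n N r] x) v‖ * g r ≤ g (r + 1) / 8 * ‖v‖) ∧
      (∀ v : 𝔼, localProj P (c (r + 1)) (f^[cutTime n N (r + 1)] x) v = 0 →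
        ‖(chartDerivEquiv (iterDiffeo f (cutTime n N (r + 1) - cutTime n N r)) (c r) (c (r + 1))
          (f^[cutTime n N r] x)).symm v‖ * g (r + 1) ≤ g r / 8 * ‖v‖) ∧
      g r ≤ 8 * D * g (r + 1)) := by
  classical
  set σ := cutTime n N with hσ
  set q := n / N with hq
  have hσs : ∀ r < q, σ r + N ≤ σ (r + 1) ∧ σ (r + 1) ≤ σ r + 2 * N ∧ σ (r + 1) ≤ n :=
    fun r hr => cutTime_succ hN hr
  have hσm : ∀ r < q, σ r ≤ σ (r + 1) := fun r hr => by have := hσs r hr; omega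
  have hit : ∀ r < q, f^[σ (r + 1) - σ r] (f^[σ r] x) = f^[σ (r + 1)] x := fun r hr => by
    rw [← Function.iterate_add_apply, Nat.sub_add_cancel (hσm r hr)]
  have hpr : ∀ (a : M → ℝ) r, ∏ i ∈ Finset.range (σ (r + 1) - σ r), a (f^[i] (f^[σ r] x)) =
      ∏ i ∈ Finset.range (σ (r + 1) - σ r), a (f^[σ r + i] x) := fun a r =>
    Finset.prod_congr rfl fun i _ => by rw [← Function.iterate_add_apply, add_comm]
  have hΛ : ∀ r, f^[σ r] x ∈ Λ := fun r => iterate_mem_of_maps H.image_subset hx _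
  have hC0 : 0 ≤ C := zero_le_one.trans hA.one_le
  let a₁ : ℕ → ℝ := fun r => C ^ 2 * ∏ i ∈ Finset.range (σ (r + 1) - σ r), α (f^[σ r + i] x)
  let a₂ : ℕ → ℝ := fun r => C ^ 2 * ∏ i ∈ Finset.range (σ (r + 1) - σ r), α' (f^[σ r + i] x)
  let b₁ : ℕ → ℝ := fun r => C ^ 2 * ∏ i ∈ Finset.range (σ (r + 1) - σ r), β (f^[σ r + i] x)
  let b₂ : ℕ → ℝ := fun r => C ^ 2 * ∏ i ∈ Finset.range (σ (r + 1) - σ r), β' (f^[σ r + i] x)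
  have ha₁ : ∀ r, 0 ≤ a₁ r := fun r =>
    mul_nonneg (by positivity) (Finset.prod_nonneg fun i _ => H.nonneg _)
  have ha₂ : ∀ r, 0 ≤ a₂ r := fun r =>
    mul_nonneg (by positivity) (Finset.prod_nonneg fun i _ => H.nonneg' _)
  have hb₁ : ∀ r, 0 ≤ b₁ r := fun r =>
    mul_nonneg (by positivity) (Finset.prod_nonneg fun i _ => H.nonneg_right _)
  have hb₂ : ∀ r, 0 ≤ b₂ r := fun r =>
    mul_nonneg (by positivity) (Finset.prod_nonneg fun i _ => H.nonneg_right' _)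
  set θ : ℝ := 1 / (64 * D) with hθ
  have hD0 : 0 < D := by linarith
  have hθ0 : 0 < θ := by positivity
  have hθ64 : θ ≤ 1 / 64 := by
    rw [hθ, div_le_div_iff₀ (by positivity) (by norm_num)]; linarith
  have hθD : θ * D = 1 / 64 := by rw [hθ]; field_simp
  -- The construction of scales needs a positive lower bound for `Ar`. If `s = 0`, the left subspace
  -- is zero and any number bounds the derivative on it; `θ` is chosen with `θ * D = (1 / 8) ^ 2`,
  -- as needed for `hAB`. The cap `D` in `Br` bounds the ratio of consecutive scales.
  let Ar : ℕ → ℝ := fun r => if s = 0 then θ else min (a₁ r) (a₂ r)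
  let Br : ℕ → ℝ := fun r => min (min (b₁ r) (b₂ r)) D
  have hcontract : ∀ r < q, ∀ v : 𝔼, localProj P (c r) (f^[σ r] x) v = v →
      ‖chartDerivEquiv (iterDiffeo f (σ (r + 1) - σ r)) (c r) (c (r + 1)) (f^[σ r] x) v‖ ≤
        min (a₁ r) (a₂ r) * ‖v‖ := fun r hr v hv => by
    have h2 := H.norm_chartDeriv_le_of_proj hA (hc r hr.le).1 (hc (r + 1) hr).1 (hΛ r)
      (hc r hr.le).2 (t := σ (r + 1) - σ r) (by rw [hit r hr]; exact (hc (r + 1) hr).2) hv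
    rwa [hpr, hpr] at h2
  have hexpand : ∀ r < q, ∀ v : 𝔼, localProj P (c (r + 1)) (f^[σ (r + 1)] x) v = 0 →
      ‖(chartDerivEquiv (iterDiffeo f (σ (r + 1) - σ r)) (c r) (c (r + 1)) (f^[σ r] x)).symm v‖ ≤
        Br r * ‖v‖ := fun r hr v hv => by
    have h2 := H.norm_chartDeriv_symm_le_of_proj hA (hc r hr.le).1 (hc (r + 1) hr).1 (hΛ r)
      (hc r hr.le).2 (t := σ (r + 1) - σ r) (by rw [hit r hr]; exact (hc (r + 1) hr).2)
      (v := v) (by rw [hit r hr]; exact hv)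
    rw [hpr, hpr] at h2
    have h3 := (hD (σ (r + 1) - σ r) (by have := hσs r hr; omega) _ (hc r hr.le).1 _
      (hc (r + 1) hr).1 _ (hc r hr.le).2 (by rw [hit r hr]; exact (hc (r + 1) hr).2) v).2
    simp only [Br]
    rw [min_mul_of_nonneg _ _ (norm_nonneg v)]
    exact le_min h2 h3
  -- A nonzero vector of the left subspace exists if `s ≠ 0`; as the inverse derivative has norm at
  -- most `D`, its contraction factor is at least `1 / D`.
  have hArθ : ∀ r < q, θ ≤ Ar r := by
    intro r hr
    simp only [Ar]
    split_ifs with hs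
    · exact le_rfl
    · have h2 := H.finrank_range_localProj (c r) (hΛ r)
      have h3 : Nontrivial (LinearMap.range (localProj P (c r) (f^[σ r] x) : 𝔼 →ₗ[ℝ] 𝔼)) :=
        Module.nontrivial_of_finrank_pos (R := ℝ) (by omega)
      obtain ⟨⟨v, w, hw⟩, hv⟩ := exists_ne
        (0 : LinearMap.range (localProj P (c r) (f^[σ r] x) : 𝔼 →ₗ[ℝ] 𝔼))
      have hv0 : 0 < ‖v‖ := norm_pos_iff.2 fun h => hv (Subtype.ext h)
      have hPv : localProj P (c r) (f^[σ r] x) v = v := by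
        rw [← hw]; exact H.localProj_localProj _ (hΛ r) w
      have h4 := hcontract r hr v hPv
      have h5 := (hD (σ (r + 1) - σ r) (by have := hσs r hr; omega) _ (hc r hr.le).1 _
        (hc (r + 1) hr).1 _ (hc r hr.le).2 (by rw [hit r hr]; exact (hc (r + 1) hr).2)
        (chartDerivEquiv (iterDiffeo f (σ (r + 1) - σ r)) (c r) (c (r + 1)) (f^[σ r] x) v)).2
      rw [ContinuousLinearEquiv.symm_apply_apply] at h5
      have h6 : ‖v‖ ≤ D * (min (a₁ r) (a₂ r)) * ‖v‖ := by
        rw [mul_assoc]; exact h5.trans (by gcongr)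
      have h7 : 1 ≤ D * min (a₁ r) (a₂ r) := by
        by_contra! h
        nlinarith
      rw [hθ, div_le_iff₀ (by positivity)]
      nlinarith
  have hArp : ∀ l ≤ q, ∏ r ∈ Finset.range l, Ar r ≤ (1 / 8) ^ l := by
    intro l hl
    simp only [Ar]
    split_ifs with hs
    · rw [Finset.prod_const, Finset.card_range]
      exact pow_le_pow_left₀ hθ0.le (by linarith) _
    · have h2 := mul_le_cutTime_sub (n := n) hN (Nat.zero_le l) hl
      rw [← hσ] at h2
      have h3 : σ 0 = 0 := cutTime_zero hN hn
      have h4 : σ l ≤ n := by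
        have := (prod_Ico_prod_range_sub (a := fun _ => 1) hσm hl le_rfl).1
        rwa [show σ q = n from cutTime_last n N] at this
      have h5 := prod_blocks_le (a := fun i => α (f^[i] x)) (w := fun r => min (a₁ r) (a₂ r))
        (C := C ^ 2) (lam := lam) (κ := 1 / 8) hσm (Nat.zero_le l) hl h2
        (fun r _ => le_min (ha₁ r) (ha₂ r)) (fun r _ => min_le_left _ _)
        (by rw [h3]; simpa using hα (σ l) h4) (by positivity) h0 h1 hlam
      simpa using h5
  have hBr0 : ∀ r < q, 0 ≤ Br r := fun r _ => le_min (le_min (hb₁ r) (hb₂ r)) hD0.le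
  have hBrp : ∀ l ≤ q, ∏ r ∈ Finset.Ico l q, Br r ≤ (1 / 8) ^ (q - l) := by
    intro l hl
    have h2 := mul_le_cutTime_sub (n := n) hN hl le_rfl
    have h3 : σ q = n := cutTime_last n N
    have h4 : σ l ≤ n := by
      have := (prod_Ico_prod_range_sub (a := fun _ => 1) hσm hl le_rfl).1
      rwa [h3] at this
    refine prod_blocks_le (a := fun i => β (f^[i] x)) (C := C ^ 2) (lam := lam) hσm hl le_rfl h2
      hBr0 (fun r _ => (min_le_left _ _).trans (min_le_left _ _)) ?_ (by positivity) h0 h1 hlam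
    have := hβ (n - σ l) (Nat.sub_le _ _)
    rwa [Nat.sub_sub_self h4, ← h3] at this
  have hAB : ∀ r < q, Ar r * Br r ≤ (1 / 8) ^ 2 := by
    intro r hr
    simp only [Ar]
    split_ifs with hs
    · calc θ * Br r ≤ θ * D := mul_le_mul_of_nonneg_left (min_le_right _ _) hθ0.le
        _ = (1 / 8) ^ 2 := by rw [hθD]; norm_num
    · have h2 : ∏ i ∈ Finset.range (σ (r + 1) - σ r), (α' (f^[σ r + i] x) * β' (f^[σ r + i] x)) ≤
          ∏ i ∈ Finset.range (σ (r + 1) - σ r), (1 / 2 : ℝ) :=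
        Finset.prod_le_prod (fun i _ => mul_nonneg (H.nonneg' _) (H.nonneg_right' _)) fun i _ =>
          H.dominated _ (iterate_mem_of_maps H.image_subset hx _)
      rw [Finset.prod_const, Finset.card_range, Finset.prod_mul_distrib] at h2
      have h3 : ((1 : ℝ) / 2) ^ (σ (r + 1) - σ r) ≤ (1 / 2) ^ N :=
        pow_le_pow_of_le_one (by norm_num) (by norm_num) (by have := hσs r hr; omega)
      calc min (a₁ r) (a₂ r) * Br r ≤ a₂ r * b₂ r :=
            mul_le_mul (min_le_right _ _) ((min_le_left _ _).trans (min_le_right _ _))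
              (hBr0 r hr) (ha₂ r)
        _ = C ^ 4 * ((∏ i ∈ Finset.range (σ (r + 1) - σ r), α' (f^[σ r + i] x)) *
              ∏ i ∈ Finset.range (σ (r + 1) - σ r), β' (f^[σ r + i] x)) := by
            simp only [a₂, b₂]; ring
        _ ≤ C ^ 4 * (1 / 2) ^ N := by gcongr; exact h2.trans h3
        _ ≤ (1 / 8) ^ 2 := hdom.trans (by norm_num)
  obtain ⟨g, hg0, hgq, hg⟩ := DominatedHorseshoe.exists_weights (κ := 1 / 8) (θ := θ) (D := D)
    (by norm_num) hθ0 hArθ hBr0 (fun r _ => min_le_right _ _) hArp hBrp hAB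
  refine ⟨g, hg0, hgq, fun r hr => ⟨(hg r hr).1, (hg r hr).2.1, fun hrq => ?_⟩⟩
  obtain ⟨h2, h3, h4⟩ := (hg r hr).2.2 hrq
  have hgr := (hg r hr).1
  have hgr' := (hg (r + 1) hrq).1
  refine ⟨fun v hv => ?_, fun v hv => ?_, ?_⟩
  · have h5 := hcontract r hrq v hv
    by_cases hs : s = 0
    · have h6 : localProj P (c r) (f^[σ r] x) v ∈
          LinearMap.range (localProj P (c r) (f^[σ r] x) : 𝔼 →ₗ[ℝ] 𝔼) := ⟨v, rfl⟩
      rw [Submodule.finrank_eq_zero.1 ((H.finrank_range_localProj (c r) (hΛ r)).trans hs),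
        Submodule.mem_bot, hv] at h6
      simp [h6]
    · simp only [Ar, if_neg hs] at h2
      calc _ ≤ (min (a₁ r) (a₂ r) * ‖v‖) * g r := by gcongr
        _ = min (a₁ r) (a₂ r) * g r * ‖v‖ := by ring
        _ ≤ 1 / 8 * g (r + 1) * ‖v‖ := by gcongr
        _ = _ := by ring
  · calc _ ≤ (Br r * ‖v‖) * g (r + 1) := by gcongr; exact hexpand r hrq v hv
      _ = Br r * g (r + 1) * ‖v‖ := by ring
      _ ≤ 1 / 8 * g r * ‖v‖ := by gcongr
      _ = _ := by ring
  · have h5 : max (1 / 8 / θ) (D / (1 / 8)) = 8 * D := by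
      rw [hθ]
      have : (1 : ℝ) / 8 / (1 / (64 * D)) = 8 * D := by field_simp; norm_num
      rw [this, max_eq_left]
      linarith
    rwa [h5] at h4

end Network

/-! ### Construction of the network -/

section Network

variable {d : ℕ} {M : Type*} [EMetricSpace M] [ChartedSpace (EuclideanSpace ℝ (Fin d)) M]
  [IsManifold (𝓡 d) ∞ M]

local notation "𝔼" => EuclideanSpace ℝ (Fin d)

variable {f : M ≃ₘ^1⟮𝓡 d, 𝓡 d⟯ M} {Λ : Set M}
    {E F : (x : M) → Submodule ℝ (TangentSpace (𝓡 d) x)} {s : ℕ}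
    {P : (x : M) → TangentSpace (𝓡 d) x →L[ℝ] TangentSpace (𝓡 d) x}
    {ν ν' : (x : M) → TangentSpace (𝓡 d) x → ℝ} {α β α' β' : M → ℝ}
    {T : Finset M} {A : M → Set M} {C : ℝ} {r₀ : ℝ≥0∞}

/-- Periodic orbits which are close to each other at time `0` and along which the dominated
splitting is hyperbolic from time `0` on, in both directions, form a network. -/
theorem IsDominatedData.exists_network [CompactSpace M]
    (H : IsDominatedData f Λ E F s P ν ν' α β α' β') (hA : IsGoodAtlas ν ν' P Λ T A C r₀)
    (hΛ : IsCompact Λ) {lam : ℝ} (h0 : 0 ≤ lam) (h1 : lam < 1) :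
    ∃ N > 0, ∃ δ₀ > (0 : ℝ≥0∞), ∀ δ > 0, δ ≤ δ₀ → ∃ η > (0 : ℝ≥0∞), ∀ n ≥ N, ∀ k > 0,
      ∀ p : Fin k → M, (∀ i, p i ∈ Λ) → (∀ i, f^[n] (p i) = p i) →
      (∀ i, ∀ m ≤ n, ∏ j ∈ Finset.range m, α (f^[j] (p i)) ≤ lam ^ m) →
      (∀ i, ∀ m ≤ n, ∏ j ∈ Finset.Ico (n - m) n, β (f^[j] (p i)) ≤ lam ^ m) →
      (∀ i j, edist (p i) (p j) < η) →
      ∃ q σ c y t Q B g ρ r, IsNetwork f s n k q p ν C δ σ c y t Q B g ρ r := by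
  have hC := hA.one_le
  have hC0 : 0 < C := by linarith
  -- The block length depends only on the atlas constant and on `lam`; all later constants are
  -- uniform in `n` and `k`.
  obtain ⟨N, hlam, hdom, hN⟩ : ∃ N : ℕ, C ^ 2 * lam ^ N ≤ 1 / 8 ∧ C ^ 4 * (1 / 2) ^ N ≤ 1 / 64 ∧
      0 < N := by
    have l1 : Tendsto (fun N : ℕ => C ^ 2 * lam ^ N) atTop (𝓝 0) := by
      simpa using (tendsto_pow_atTop_nhds_zero_of_lt_one h0 h1).const_mul (C ^ 2)
    have l2 : Tendsto (fun N : ℕ => C ^ 4 * (1 / 2 : ℝ) ^ N) atTop (𝓝 0) := by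
      simpa using (tendsto_pow_atTop_nhds_zero_of_lt_one (r := (1 / 2 : ℝ)) (by norm_num)
        (by norm_num)).const_mul (C ^ 4)
    obtain ⟨N, hN⟩ := ((l1.eventually_le_const (by norm_num : (0 : ℝ) < 1 / 8)).and
      ((l2.eventually_le_const (by norm_num : (0 : ℝ) < 1 / 64)).and (eventually_gt_atTop 0))).exists
    exact ⟨N, hN⟩
  obtain ⟨D, hD1, hD⟩ := hA.exists_norm_chartDerivEquiv_le f (2 * N + 1)
  have hD0 : 0 < D := by linarith
  -- The largest value allowed by `IsHypStep.small`, with `Θ = 8 * D` the bound for the ratio of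
  -- consecutive scales.
  set ζ : ℝ := 1 / (16 * (C + 1) ^ 2 * D ^ 2 * (8 * D)) with hζ
  have hζ0 : 0 < ζ := by positivity
  obtain ⟨ρ, hρ, hmap⟩ := hA.exists_chartMap_uniform f (2 * N + 1) hζ0
  obtain ⟨δ₁, hδ₁, hnear⟩ := hA.exists_near hρ
  have hr₀ : 0 < r₀ / 2 := ENNReal.half_pos hA.pos.ne'
  obtain ⟨δ₀, hδ₀, hδ₀'⟩ := ENNReal.exists_nnreal_pos_mul_lt (a := 3)
    (b := min δ₁ (r₀ / 2)) (by norm_num) (lt_min hδ₁ hr₀).ne'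
  refine ⟨N, hN, δ₀, by simpa using hδ₀, fun δ hδ hδδ => ?_⟩
  have h3δ : 3 * δ < min δ₁ (r₀ / 2) := by
    refine lt_of_le_of_lt ?_ hδ₀'
    rw [mul_comm]
    gcongr
  obtain ⟨r₁, hr₁, hclose⟩ := hA.exists_edist_iterate_le f (2 * N + 1) hδ
  set r : ℝ := min r₁ ρ / 2 with hr
  have hr0 : 0 < r := by have := lt_min hr₁ hρ; positivity
  -- Passing to the split norm costs a factor `C + 1`, so this radius makes the jumps at most `r /
  -- 2`.
  obtain ⟨η₁, hη₁, hjump⟩ := hA.exists_near (ρ := r / (2 * (C + 1))) (by positivity)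
  obtain ⟨η₂, hη₂, hproj⟩ := hA.exists_localProj_close hΛ hζ0
  refine ⟨min (min η₁ η₂) (r₀ / 2), lt_min (lt_min hη₁ hη₂) hr₀,
    fun n hn k hk p hp hper hα hβ hpp => ?_⟩
  set q := n / N with hq
  have hq0 : 0 < q := Nat.div_pos hn hN
  set σ := cutTime n N with hσ
  have hσ0 : σ 0 = 0 := cutTime_zero hN hn
  have hσq : ∀ r, q ≤ r → σ r = n := fun r hr => by rw [hσ, cutTime, if_neg (by omega)]
  have hσs : ∀ r < q, σ r + N ≤ σ (r + 1) ∧ σ (r + 1) ≤ σ r + 2 * N ∧ σ (r + 1) ≤ n :=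
    fun r hr => cutTime_succ hN hr
  choose ch hchT hch using hA.cover
  set cs := ch (p ⟨0, hk⟩) with hcs
  -- All segments use the same chart `cs` at both ends, so that the end of one segment can be
  -- compared with the start of any other. This is possible because all the `p i` are within `r₀ /
  -- 2` of the first one.
  let cc : Fin k → ℕ → M := fun i r => if r = 0 ∨ q ≤ r then cs else ch (f^[σ r] (p i))
  have hccT : ∀ i r, cc i r ∈ T := by
    intro i r
    simp only [cc]
    split_ifs <;> exact hchT _
  have hcc0 : ∀ i, cc i 0 = cs := fun i => by simp [cc]
  have hccq : ∀ i, cc i q = cs := fun i => by simp [cc]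
  have hball : ∀ i r x, edist x (f^[σ r] (p i)) < r₀ / 2 → x ∈ A (cc i r) := by
    intro i r x hx
    simp only [cc]
    split_ifs with h
    · have h2 : f^[σ r] (p i) = p i := by
        rcases h with h | h
        · rw [h, hσ0]; rfl
        · rw [hσq r h, hper]
      rw [h2] at hx
      refine hch _ _ ((edist_triangle x (p i) _).trans_lt ?_)
      rw [← ENNReal.add_halves r₀]
      exact ENNReal.add_lt_add hx ((hpp i _).trans_le (min_le_right _ _))
    · exact hch _ _ (hx.trans_le ENNReal.half_le_self)
  have hball0 : ∀ i r, f^[σ r] (p i) ∈ A (cc i r) := fun i r => hball i r _ (by simpa using hr₀)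
  have hyΛ : ∀ i r, f^[σ r] (p i) ∈ Λ := fun i r => iterate_mem_of_maps H.image_subset (hp i) _
  choose gg hg0 hgq hg using fun i => H.exists_weights hA h0 h1.le hN hn hD1 hD hlam hdom (hp i)
    (hα i) (hβ i) (c := cc i) fun r _ => ⟨hccT i r, hball0 i r⟩
  let c : Fin k × ℕ → M := fun a => cc a.1 a.2
  let y : Fin k × ℕ → M := fun a => f^[σ a.2] (p a.1)
  let t : Fin k × ℕ → ℕ := fun a => σ (a.2 + 1) - σ a.2
  let Q : Fin k × ℕ → 𝔼 →L[ℝ] 𝔼 := fun a => localProj P (c a) (y a)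
  let B : Fin k × ℕ → Fin k × ℕ → 𝔼 →L[ℝ] 𝔼 := fun a b =>
    backwardMap (Q a) (Q b) (chartDerivEquiv (iterDiffeo f (t a)) (c a) (c b) (y a))
  let g : Fin k × ℕ → ℝ := fun a => gg a.1 a.2
  have ht : ∀ a : Fin k × ℕ, a.2 < q → t a < 2 * N + 1 := fun a ha => by
    have := hσs a.2 ha
    simp only [t]
    omega
  have hit : ∀ a : Fin k × ℕ, a.2 < q → f^[t a] (y a) = f^[σ (a.2 + 1)] (p a.1) := fun a ha => by
    simp only [t, y]
    rw [← Function.iterate_add_apply, Nat.sub_add_cancel (by have := hσs a.2 ha; omega)]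
  have hmap' : ∀ a : Fin k × ℕ, a.2 < q → _ := fun a ha =>
    hmap (t a) (ht a ha) (c a) (hccT _ _) (cc a.1 (a.2 + 1)) (hccT _ _) (y a) (hball0 _ _)
      (by rw [hit a ha]; exact hball0 _ _)
  -- Along each arrow the chart and scale of the target are those at the end of the block of `a`:
  -- either the segment continues, without error, or it has ended, where all charts are `cs` and all
  -- scales are `1`.
  have hsucc : ∀ a b : Fin k × ℕ, NodeSucc q a b → c b = cc a.1 (a.2 + 1) ∧
      g b = gg a.1 (a.2 + 1) ∧ (f^[t a] (y a) = y b ∨ g b = 1) ∧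
      edist (f^[t a] (y a)) (y b) < min η₁ η₂ := by
    rintro a b ⟨ha, ⟨h2, rfl⟩ | ⟨h2, h3⟩⟩
    · refine ⟨rfl, rfl, Or.inl (hit a ha), ?_⟩
      rw [hit a ha]
      simpa [y] using ⟨hη₁, hη₂⟩
    · have hgb : g b = 1 := by simp only [g, h3]; exact hg0 _
      refine ⟨?_, ?_, Or.inr hgb, ?_⟩
      · simp only [c]
        rw [h3, h2, hcc0, hccq]
      · rw [hgb, h2, hgq]
      · rw [hit a ha, h2, hσq q le_rfl, hper]
        simp only [y]
        rw [h3, hσ0]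
        exact (hpp a.1 b.1).trans_le (min_le_left _ _)
  have hstep : ∀ a b : Fin k × ℕ, NodeSucc q a b → IsHypStep (Q a)
      (localProj P (c b) (f^[t a] (y a))) (Q b)
      (chartDerivEquiv (iterDiffeo f (t a)) (c a) (c b) (y a)) (g a) (g b) C D (8 * D) ζ := by
    intro a b hab
    obtain ⟨hcb, hgb, -, hzb⟩ := hsucc a b hab
    have ha := hab.1
    have hz : f^[t a] (y a) ∈ A (c b) := by rw [hit a ha, hcb]; exact hball0 _ _
    have hzΛ : f^[t a] (y a) ∈ Λ := by rw [hit a ha]; exact hyΛ _ _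
    have hg1 := hg a.1 a.2 ha.le
    have hg2 := hg a.1 (a.2 + 1) ha
    obtain ⟨h2, h3, h4⟩ := hg1.2.2 ha
    rw [← hgb] at hg2 h2 h3 h4
    exact
      { proj := fun v => H.localProj_localProj _ (hyΛ _ _) v
        comm := fun v => H.chartDerivEquiv_localProj _ _ (hyΛ _ _) _ v
        proj' := fun v => H.localProj_localProj _ (hyΛ _ _) v
        norm_proj := hA.norm_localProj_le _ (hccT _ _) _ ⟨hyΛ _ _, hball0 _ _⟩
        norm_proj' := hA.norm_localProj_le _ (hccT _ _) _ ⟨hyΛ _ _, hball0 _ _⟩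
        norm_map := fun v => (hD _ (ht a ha) _ (hccT _ _) _ (hccT _ _) _ (hball0 _ _) hz v).1
        norm_symm := fun v => (hD _ (ht a ha) _ (hccT _ _) _ (hccT _ _) _ (hball0 _ _) hz v).2
        close := fun v => by
          rw [norm_sub_rev]
          exact hproj _ (hccT _ _) _ ⟨hzΛ, hz⟩ _ ⟨hyΛ _ _, hball0 _ _⟩
            (hzb.trans_le (min_le_right _ _)) v
        pos := hg1.1
        pos' := hg2.1
        contract := fun v hv => by
          rw [hcb]
          exact h2 v hv
        expand := fun v hv => by
          rw [hcb, hit a ha] at hv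
          rw [hcb]
          exact h3 v hv
        ratio := h4
        one_le_C := hC
        one_le_D := hD1
        one_le_Θ := by linarith
        nonneg := hζ0.le
        small := by
          rw [hζ, one_div_mul_cancel (by positivity)] }
  refine ⟨q, σ, c, y, t, Q, B, g, ρ, r, ?_⟩
  refine
    { pos_q := hq0
      cut_zero := hσ0
      cut_last := hσq q le_rfl
      cut_lt := fun j hj => by have := hσs j hj; omega
      point_eq := fun a => rfl
      time_eq := fun a => rfl
      one_le := hC
      pos_rad := hr0
      rad_le := by rw [hr]; linarith [min_le_right r₁ ρ]
      mem_source := fun a ha => hA.subset _ (hccT _ _) (hball0 _ _)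
      proj := fun a ha v => H.localProj_localProj _ (hyΛ _ _) v
      finrank := fun a ha => H.finrank_range_localProj _ (hyΛ _ _)
      pos := fun a ha => (hg a.1 a.2 ha.le).1
      le_one := fun a ha => (hg a.1 a.2 ha.le).2.1
      norm_frame_le := fun a ha x hx => hA.norm_frame_le _ (hccT _ _) x
        (hball _ _ x (hx.trans_lt (h3δ.trans_le (min_le_right _ _))))
      near := fun a ha x hx => hnear _ (hccT _ _) _ (hball0 _ _) x
        (hball _ _ x (hx.trans_lt (h3δ.trans_le (min_le_right _ _))))
        (hx.trans_lt (h3δ.trans_le (min_le_left _ _)))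
      close := fun a ha x hx l hl => hclose _ (hccT _ _) _ (hball0 _ _) x
        (hx.mono (by rw [hr]; linarith [min_le_left r₁ ρ])) l (hl.trans_lt (ht a ha))
      target := fun a ha => (hmap' a ha).1
      backward := fun a b hab => (hstep a b hab).isBackward
      map_source := fun a b hab x hx => by
        rw [(hsucc a b hab).1]
        exact ((hmap' a hab.1).2.1 x hx).1
      pair := fun a b hab x hx x' hx' => by
        refine (hstep a b hab).hypPair ?_
        rw [(hsucc a b hab).1]
        exact (hmap' a hab.1).2.2 x hx x' hx'
      deriv := fun a b hab x hx v => by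
        refine (hstep a b hab).hypPair ?_
        rw [(hsucc a b hab).1]
        exact ((hmap' a hab.1).2.1 x hx).2 v
      jump := fun a b hab => ?_ }
  obtain ⟨hcb, hgb, h2, h3⟩ := hsucc a b hab
  rcases h2 with h2 | h2
  · rw [h2, sub_self, splitNorm_zero, zero_div]
    positivity
  · rw [h2, div_one]
    refine (splitNorm_le (hA.norm_localProj_le _ (hccT _ _) _ ⟨hyΛ b.1 b.2, hball0 b.1 b.2⟩) _).trans
      ?_
    have h4 := (hjump (c b) (hccT _ _) (y b) (hball0 _ _) (f^[t a] (y a))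
      (by rw [hit a hab.1, hcb]; exact hball0 _ _) (h3.trans_le (min_le_left _ _))).2
    calc _ ≤ (C + 1) * (r / (2 * (C + 1))) := by gcongr
      _ = r / 2 := by field_simp

end Network

/-! ### The compact invariant set of shadowing orbits -/

section Shadowing

variable {X : Type*} [EMetricSpace X] {n k : ℕ} {p : Fin k → X} {δ : ℝ≥0∞}

theorem homeomorph_pow_apply (φ : X ≃ₜ X) (l : ℕ) (x : X) : (φ ^ l) x = φ^[l] x := by
  induction l with
  | zero => rfl
  | succ l ih => rw [pow_succ', Homeomorph.mul_apply, ih, Function.iterate_succ_apply']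

theorem homeomorph_zpow_natCast (φ : X ≃ₜ X) (l : ℕ) (x : X) : (φ ^ (l : ℤ)) x = φ^[l] x := by
  rw [zpow_natCast, homeomorph_pow_apply]

theorem homeomorph_zpow_add_apply (φ : X ≃ₜ X) (i j : ℤ) (x : X) :
    (φ ^ (i + j)) x = (φ ^ i) ((φ ^ j) x) := by
  rw [zpow_add, Homeomorph.mul_apply]

/-- The orbit of `x` follows the concatenation of the orbit segments of length `n` of the points
`p (a m)`. -/
def IsShadowed (φ : X ≃ₜ X) (n : ℕ) (p : Fin k → X) (δ : ℝ≥0∞) (a : ℤ → Fin k) (x : X) : Prop :=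
  ∀ m : ℤ, ∀ l < n, edist ((φ ^ (n * m + l : ℤ)) x) (φ^[l] (p (a m))) ≤ δ

theorem IsShadowed.shift {φ : X ≃ₜ X} {a : ℤ → Fin k} {x : X} (h : IsShadowed φ n p δ a x)
    (j : ℤ) : IsShadowed φ n p δ (fun m => a (m + j)) ((φ ^ (n * j : ℤ)) x) := by
  intro m l hl
  rw [← homeomorph_zpow_add_apply, show (n * m + l + n * j : ℤ) = n * (m + j) + l by ring]
  exact h (m + j) l hl

/-- The points whose orbits follow concatenations of the orbit segments of the `p i`. -/
def shadowSet (φ : X ≃ₜ X) (n : ℕ) (p : Fin k → X) (δ : ℝ≥0∞) : Set X :=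
  {x | ∃ a, IsShadowed φ n p δ a x}

/-- The smallest invariant set that contains `shadowSet φ n p δ`. -/
def shadowHull (φ : X ≃ₜ X) (n : ℕ) (p : Fin k → X) (δ : ℝ≥0∞) : Set X :=
  ⋃ l ∈ Finset.range n, φ^[l] '' shadowSet φ n p δ

theorem mem_shadowHull {φ : X ≃ₜ X} {x : X} :
    x ∈ shadowHull φ n p δ ↔ ∃ l < n, ∃ z ∈ shadowSet φ n p δ, φ^[l] z = x := by
  simp [shadowHull]

theorem shadowSet_zpow {φ : X ≃ₜ X} {x : X} (hx : x ∈ shadowSet φ n p δ) (j : ℤ) :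
    (φ ^ (n * j : ℤ)) x ∈ shadowSet φ n p δ := by
  obtain ⟨a, ha⟩ := hx
  exact ⟨_, ha.shift j⟩

/-- Pairs of a point and a word that it shadows form a closed set, and the space of words is
compact, so the projection to the points is closed. -/
theorem isCompact_shadowSet [CompactSpace X] (φ : X ≃ₜ X) : IsCompact (shadowSet φ n p δ) := by
  have h1 : IsClosed {z : X × (ℤ → Fin k) | IsShadowed φ n p δ z.2 z.1} := by
    simp only [IsShadowed, ofPred_forall]
    refine isClosed_iInter fun m => isClosed_iInter fun l => isClosed_iInter fun _ => ?_
    have h2 : Continuous fun z : X × (ℤ → Fin k) => (φ ^ (n * m + l : ℤ)) z.1 :=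
      (φ ^ (n * m + l : ℤ)).continuous.comp continuous_fst
    have h3 : Continuous fun z : X × (ℤ → Fin k) => φ^[l] (p (z.2 m)) :=
      (continuous_of_discreteTopology (f := fun i : Fin k => φ^[l] (p i))).comp
        ((continuous_apply m).comp continuous_snd)
    exact isClosed_le (h2.edist h3) continuous_const
  have h2 : shadowSet φ n p δ = Prod.fst '' {z : X × (ℤ → Fin k) | IsShadowed φ n p δ z.2 z.1} := by
    ext x
    simp [shadowSet]
  rw [h2]
  exact (isClosedMap_fst_of_compactSpace _ h1).isCompact

theorem isCompact_shadowHull [CompactSpace X] (φ : X ≃ₜ X) : IsCompact (shadowHull φ n p δ) :=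
  (Finset.range n).isCompact_biUnion fun l _ =>
    (isCompact_shadowSet φ).image (φ.continuous.iterate l)

/-- Shifting the word by one letter shows that the shadowing set is invariant under `φ ^ n`, so the
union of its first `n` images is invariant under `φ`. -/
theorem image_shadowHull (φ : X ≃ₜ X) : φ '' shadowHull φ n p δ = shadowHull φ n p δ := by
  ext x
  simp only [mem_image, mem_shadowHull]
  constructor
  · rintro ⟨_, ⟨l, hl, z, hz, rfl⟩, rfl⟩
    rw [← Function.iterate_succ_apply' φ l z]
    rcases Nat.lt_or_ge (l + 1) n with h | h
    · exact ⟨l + 1, h, z, hz, rfl⟩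
    · refine ⟨0, by omega, _, shadowSet_zpow hz 1, ?_⟩
      rw [show l.succ = n by omega, mul_one, homeomorph_zpow_natCast]
      rfl
  · rintro ⟨l, hl, z, hz, rfl⟩
    rcases l with _ | l
    · refine ⟨_, ⟨n - 1, by omega, _, shadowSet_zpow hz (-1), rfl⟩, ?_⟩
      rw [← Function.iterate_succ_apply' φ, ← homeomorph_zpow_natCast, ← homeomorph_zpow_add_apply,
        show ((n - 1).succ : ℤ) + n * (-1) = 0 by omega]
      rfl
    · exact ⟨_, ⟨l, by omega, z, hz, rfl⟩, (Function.iterate_succ_apply' φ l z).symm⟩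

theorem shadowSet_subset_shadowHull (hn : 0 < n) (φ : X ≃ₜ X) :
    shadowSet φ n p δ ⊆ shadowHull φ n p δ :=
  fun x hx => mem_shadowHull.2 ⟨0, hn, x, hx, rfl⟩

end Shadowing

/-! ### Bi-infinite paths in the network and their times -/

section Nodes

variable {k : ℕ}

/-- The bi-infinite path in the network that runs through the orbit segments given by `a`. -/
def orbitNode (q : ℕ) (a : ℤ → Fin k) (J : ℤ) : Fin k × ℕ := (a (J / q), (J % q).toNat)

theorem orbitNode_lt {q : ℕ} (hq : 0 < q) (a : ℤ → Fin k) (J : ℤ) : (orbitNode q a J).2 < q := by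
  have h1 := Int.emod_nonneg J (b := q) (by omega)
  have h2 := Int.emod_lt_of_pos J (b := q) (by omega)
  simp only [orbitNode]
  omega

theorem orbitNode_mul_add {q : ℕ} (a : ℤ → Fin k) (m : ℤ) {r : ℕ} (hr : r < q) :
    orbitNode q a (q * m + r) = (a m, r) := by
  have h1 : ((q : ℤ) * m + r) / q = m := by
    rw [add_comm, Int.add_mul_ediv_left _ _ (by omega), Int.ediv_eq_zero_of_lt (by omega) (by omega),
      zero_add]
  have h2 : ((q : ℤ) * m + r) % q = r := by
    rw [add_comm, Int.add_mul_emod_self_left, Int.emod_eq_of_lt (by omega) (by omega)]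
  simp [orbitNode, h1, h2]

theorem exists_eq_mul_add {q : ℕ} (hq : 0 < q) (J : ℤ) : ∃ m : ℤ, ∃ r < q, J = q * m + r :=
  ⟨J / q, (J % q).toNat, by
    have h1 := Int.emod_nonneg J (b := q) (by omega)
    have h2 := Int.emod_lt_of_pos J (b := q) (by omega)
    omega, by
    have h1 := Int.emod_nonneg J (b := q) (by omega)
    rw [Int.toNat_of_nonneg h1, Int.mul_ediv_add_emod]⟩

theorem nodeSucc_orbitNode {q : ℕ} (hq : 0 < q) (a : ℤ → Fin k) (J : ℤ) :
    NodeSucc q (orbitNode q a J) (orbitNode q a (J + 1)) := by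
  obtain ⟨m, r, hr, rfl⟩ := exists_eq_mul_add hq J
  rw [orbitNode_mul_add a m hr]
  refine ⟨hr, ?_⟩
  rcases Nat.lt_or_ge (r + 1) q with h | h
  · left
    refine ⟨h, ?_⟩
    rw [show (q : ℤ) * m + r + 1 = q * m + (r + 1 : ℕ) by push_cast; ring, orbitNode_mul_add a m h]
  · right
    refine ⟨show r + 1 = q by omega, ?_⟩
    rw [show (q : ℤ) * m + r + 1 = q * (m + 1) + (0 : ℕ) by
      rw [mul_add, mul_one, ← show r + 1 = q by omega]; push_cast; ring, orbitNode_mul_add a _ hq]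

/-- The times at which the path `orbitNode q a` visits its nodes. -/
def orbitTime (n q : ℕ) (σ : ℕ → ℕ) (J : ℤ) : ℤ := n * (J / q) + σ (J % q).toNat

theorem orbitTime_mul_add {n q : ℕ} (σ : ℕ → ℕ) (m : ℤ) {r : ℕ} (hr : r < q) :
    orbitTime n q σ (q * m + r) = n * m + σ r := by
  have h1 : ((q : ℤ) * m + r) / q = m := by
    rw [add_comm, Int.add_mul_ediv_left _ _ (by omega), Int.ediv_eq_zero_of_lt (by omega) (by omega),
      zero_add]
  have h2 : ((q : ℤ) * m + r) % q = r := by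
    rw [add_comm, Int.add_mul_emod_self_left, Int.emod_eq_of_lt (by omega) (by omega)]
  simp [orbitTime, h1, h2]

theorem orbitTime_succ {n q : ℕ} {σ : ℕ → ℕ} (hq : 0 < q) (h0 : σ 0 = 0) (hn : σ q = n)
    (hσ : ∀ j < q, σ j < σ (j + 1)) (J : ℤ) :
    orbitTime n q σ (J + 1) =
      ((σ ((J % q).toNat + 1) - σ (J % q).toNat : ℕ) : ℤ) + orbitTime n q σ J := by
  obtain ⟨m, r, hr, rfl⟩ := exists_eq_mul_add hq J
  have h2 : ((q : ℤ) * m + r) % q = r := by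
    rw [add_comm, Int.add_mul_emod_self_left, Int.emod_eq_of_lt (by omega) (by omega)]
  have h3 := hσ r hr
  rw [orbitTime_mul_add σ m hr, h2, Int.toNat_natCast]
  rcases Nat.lt_or_ge (r + 1) q with h | h
  · rw [show (q : ℤ) * m + r + 1 = q * m + (r + 1 : ℕ) by push_cast; ring, orbitTime_mul_add σ m h]
    omega
  · rw [show (q : ℤ) * m + r + 1 = q * (m + 1) + (0 : ℕ) by
      rw [mul_add, mul_one, ← show r + 1 = q by omega]; push_cast; ring, orbitTime_mul_add σ _ hq,
      h0, show r + 1 = q by omega, hn]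
    rw [show r + 1 = q by omega, hn] at h3
    push_cast [h3.le]
    ring

theorem exists_cut {n q : ℕ} {σ : ℕ → ℕ} (h0 : σ 0 = 0) (hn : σ q = n) {l : ℕ} (hl : l < n) :
    ∃ r < q, σ r ≤ l ∧ l < σ (r + 1) := by
  classical
  have h1 : ∃ r, l < σ r := ⟨q, hn ▸ hl⟩
  have h2 := Nat.find_spec h1
  have h3 : Nat.find h1 ≠ 0 := fun h => by rw [h, h0] at h2; omega
  obtain ⟨r, hr⟩ := Nat.exists_eq_succ_of_ne_zero h3
  have h4 : Nat.find h1 ≤ q := Nat.find_min' h1 (hn ▸ hl)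
  refine ⟨r, by omega, ?_, by rw [← Nat.succ_eq_add_one, ← hr]; exact h2⟩
  by_contra! h
  have := Nat.find_min' h1 h
  omega

end Nodes

theorem periodic_int_emod {α : Type*} {h : ℤ → α} {L : ℤ} (hh : ∀ J, h (J + L) = h J) (J : ℤ) :
    h (J % L) = h J := by
  rw [Int.emod_def, mul_comm]
  have := Function.Periodic.sub_zsmul_eq (show Function.Periodic h L from hh) (x := J) (J / L)
  rwa [smul_eq_mul] at this

theorem periodic_zmod_val {α : Type*} {h : ℤ → α} {L : ℕ} [NeZero L] (hh : ∀ J, h (J + L) = h J)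
    (J : ℤ) : h ((J : ZMod L).val : ℤ) = h J := by
  rw [ZMod.val_intCast, periodic_int_emod hh]

theorem periodic_zmod_val_succ {α : Type*} {h : ℤ → α} {L : ℕ} [NeZero L]
    (hh : ∀ J, h (J + L) = h J) (J : ZMod L) : h ((J + 1).val : ℤ) = h (J.val + 1) := by
  rw [← periodic_zmod_val hh (J.val + 1)]
  simp

theorem orbitNode_periodic {k q : ℕ} (hq : 0 < q) {a : ℤ → Fin k} {L : ℕ}
    (ha : ∀ m, a (m + L) = a m) (J : ℤ) :
    orbitNode q a (J + (q * L : ℕ)) = orbitNode q a J := by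
  obtain ⟨m, r, hr, rfl⟩ := exists_eq_mul_add hq J
  rw [show (q : ℤ) * m + r + (q * L : ℕ) = q * (m + L) + r by push_cast; ring,
    orbitNode_mul_add a _ hr, orbitNode_mul_add a _ hr, ha]

/-! ### Shadowing of periodic words and expansivity -/

namespace IsNetwork

variable {d : ℕ} {M : Type*} [EMetricSpace M] [ChartedSpace (EuclideanSpace ℝ (Fin d)) M]
  [IsManifold (𝓡 d) ∞ M]

local notation "𝔼" => EuclideanSpace ℝ (Fin d)

variable {f : M ≃ₘ^1⟮𝓡 d, 𝓡 d⟯ M} {s n k q : ℕ} {p : Fin k → M}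
    {ν : (x : M) → TangentSpace (𝓡 d) x → ℝ} {C : ℝ} {δ : ℝ≥0∞} {σ : ℕ → ℕ}
    {c y : Fin k × ℕ → M} {t : Fin k × ℕ → ℕ}
    {Q : Fin k × ℕ → EuclideanSpace ℝ (Fin d) →L[ℝ] EuclideanSpace ℝ (Fin d)}
    {B : Fin k × ℕ → Fin k × ℕ → EuclideanSpace ℝ (Fin d) →L[ℝ] EuclideanSpace ℝ (Fin d)}
    {g : Fin k × ℕ → ℝ} {ρ r : ℝ}
    (hN : IsNetwork f s n k q p ν C δ σ c y t Q B g ρ r)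

include hN

theorem cut_lt_last {j : ℕ} (hj : j < q) : σ j < n := by
  have h : ∀ i, j + 1 + i ≤ q → σ j < σ (j + 1 + i) := by
    intro i
    induction i with
    | zero => exact fun _ => hN.cut_lt j hj
    | succ i ih => exact fun hi => (ih (by omega)).trans (hN.cut_lt _ (by omega))
  have := h (q - (j + 1)) (by omega)
  rwa [show j + 1 + (q - (j + 1)) = q by omega, hN.cut_last] at this

theorem orbitTime_succ (a : ℤ → Fin k) (J : ℤ) :
    orbitTime n q σ (J + 1) = (t (orbitNode q a J) : ℤ) + orbitTime n q σ J := by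
  rw [hN.time_eq]
  exact DominatedHorseshoe.orbitTime_succ hN.pos_q hN.cut_zero hN.cut_last hN.cut_lt J

theorem iterate_orbit (a : ℤ → Fin k) (J : ℤ) (x : M) :
    f^[t (orbitNode q a J)] ((f.toHomeomorph ^ orbitTime n q σ J) x) =
      (f.toHomeomorph ^ orbitTime n q σ (J + 1)) x := by
  rw [hN.orbitTime_succ a, homeomorph_zpow_add_apply, homeomorph_zpow_natCast]
  rfl

theorem edist_orbit {δ' : ℝ≥0∞} {a : ℤ → Fin k} {x : M}
    (hx : IsShadowed f.toHomeomorph n p δ' a x) (J : ℤ) :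
    edist ((f.toHomeomorph ^ orbitTime n q σ J) x) (y (orbitNode q a J)) ≤ δ' := by
  obtain ⟨m, j, hj, rfl⟩ := exists_eq_mul_add hN.pos_q J
  rw [orbitTime_mul_add σ m hj, orbitNode_mul_add a m hj, hN.point_eq]
  exact hx m (σ j) (hN.cut_lt_last hj)

theorem near_orbit {δ' : ℝ≥0∞} (hδ : δ' ≤ 3 * δ) {a : ℤ → Fin k} {x : M}
    (hx : IsShadowed f.toHomeomorph n p δ' a x) (J : ℤ) :
    Near (d := d) (c (orbitNode q a J)) (y (orbitNode q a J)) ρ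
      ((f.toHomeomorph ^ orbitTime n q σ J) x) :=
  hN.near _ (orbitNode_lt hN.pos_q a J) _ ((hN.edist_orbit hx J).trans hδ)

theorem near_of_norm_le {a : Fin k × ℕ} (ha : a.2 < q) {v : 𝔼} (hv : ‖v‖ ≤ 2 * r) :
    Near (d := d) (c a) (y a) (2 * r)
      ((extChartAt (𝓡 d) (c a)).symm (extChartAt (𝓡 d) (c a) (y a) + v)) ∧
    extChartAt (𝓡 d) (c a) ((extChartAt (𝓡 d) (c a)).symm (extChartAt (𝓡 d) (c a) (y a) + v)) =
      extChartAt (𝓡 d) (c a) (y a) + v := by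
  have h1 := hN.target a ha (extChartAt (𝓡 d) (c a) (y a) + v) (by
    rw [add_sub_cancel_left]; exact hv.trans hN.rad_le)
  have h2 := (extChartAt (𝓡 d) (c a)).right_inv h1
  refine ⟨⟨?_, ?_⟩, h2⟩
  · rw [← extChartAt_source (𝓡 d)]
    exact (extChartAt (𝓡 d) (c a)).map_target h1
  · rw [h2, add_sub_cancel_left]
    exact hv

theorem norm_le_of_splitNorm_le {a : Fin k × ℕ} (ha : a.2 < q) {v : 𝔼}
    (hv : splitNorm (Q a) v / g a ≤ r) : ‖v‖ ≤ 2 * r := by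
  rw [div_le_iff₀ (hN.pos a ha)] at hv
  have h1 := norm_le_two_mul_splitNorm (Q a) v
  have h2 := mul_le_mul_of_nonneg_left (hN.le_one a ha) hN.pos_rad.le
  linarith

/-- Every periodic concatenation of the orbit segments of the network is shadowed by an orbit. -/
theorem exists_isShadowed {a : ℤ → Fin k} {L : ℕ} (hL : 0 < L) (ha : ∀ m, a (m + L) = a m) :
    ∃ x, IsShadowed f.toHomeomorph n p δ a x := by
  have : NeZero (q * L) := ⟨(Nat.mul_pos hN.pos_q hL).ne'⟩
  set b := orbitNode q a with hb
  have hbp : ∀ J, b (J + (q * L : ℕ)) = b J := orbitNode_periodic hN.pos_q ha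
  have hbq : ∀ J, (b J).2 < q := orbitNode_lt hN.pos_q a
  have hbs : ∀ J, NodeSucc q (b J) (b (J + 1)) := nodeSucc_orbitNode hN.pos_q a
  let z : Fin k × ℕ → 𝔼 → M := fun a v =>
    (extChartAt (𝓡 d) (c a)).symm (extChartAt (𝓡 d) (c a) (y a) + v)
  -- A word of period `L` visits `q * L` nodes cyclically. The unknowns are the displacements, in
  -- charts, of the shadowing orbit from the nodes.
  let bt : ZMod (q * L) → Fin k × ℕ := fun J => b J.val
  have hbt : ∀ J, bt (J + 1) = b (J.val + 1) := fun J => periodic_zmod_val_succ hbp J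
  have hbts : ∀ J, NodeSucc q (bt J) (bt (J + 1)) := fun J => by rw [hbt]; exact hbs _
  have hz : ∀ (J : ZMod (q * L)) v, splitNorm (Q (bt J)) v / g (bt J) ≤ r →
      Near (d := d) (c (bt J)) (y (bt J)) (2 * r) (z (bt J) v) ∧
      extChartAt (𝓡 d) (c (bt J)) (z (bt J) v) = extChartAt (𝓡 d) (c (bt J)) (y (bt J)) + v :=
    fun J v hv => hN.near_of_norm_le (hbq _) (hN.norm_le_of_splitNorm_le (hbq _) hv)
  obtain ⟨v, hv⟩ := exists_cyclic_orbit (Equiv.addRight (1 : ZMod (q * L))) (fun J => Q (bt J))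
    (fun J => B (bt J) (bt (J + 1))) (fun J => g (bt J)) (fun J => hN.pos _ (hbq _))
    (fun J => hN.proj _ (hbq _)) (fun J => hN.backward _ _ (hbts J))
    (fun J v => extChartAt (𝓡 d) (c (bt (J + 1))) (f^[t (bt J)] (z (bt J) v)) -
      extChartAt (𝓡 d) (c (bt (J + 1))) (y (bt (J + 1)))) hN.pos_rad.le
    (fun J => by
      refine ContinuousOn.sub ?_ continuousOn_const
      refine (continuousOn_extChartAt (c (bt (J + 1)))).comp
        ((f.continuous.iterate _).comp_continuousOn
          ((continuousOn_extChartAt_symm (c (bt J))).comp (by fun_prop) ?_)) ?_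
      · intro v hv
        refine hN.target _ (hbq _) _ ?_
        rw [add_sub_cancel_left]
        exact (hN.norm_le_of_splitNorm_le (hbq _) hv).trans hN.rad_le
      · intro v hv
        rw [extChartAt_source]
        exact hN.map_source _ _ (hbts J) _ ((hz J v hv).1.mono hN.rad_le))
    (fun J u v hu hv => by
      have h1 := hN.pair _ _ (hbts J) _ ((hz J u hu).1.mono hN.rad_le) _
        ((hz J v hv).1.mono hN.rad_le)
      rw [(hz J u hu).2, (hz J v hv).2, add_sub_add_left_eq_sub] at h1
      rw [sub_sub_sub_cancel_right]
      exact h1)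
    (fun J => by
      have h1 := hN.jump _ _ (hbts J)
      have h2 : z (bt J) 0 = y (bt J) := by
        simp only [z, add_zero]
        exact (extChartAt (𝓡 d) (c (bt J))).left_inv
          (by rw [extChartAt_source]; exact hN.mem_source _ (hbq _))
      rw [h2]
      exact h1)
  let Z : ℤ → M := fun J => z (b J) (v J)
  have hval : ∀ J : ℤ, bt (J : ZMod (q * L)) = b J := fun J => periodic_zmod_val hbp J
  have hZ : ∀ J, Near (d := d) (c (b J)) (y (b J)) (2 * r) (Z J) := fun J => by
    have := (hz J _ (hv J).1).1
    rwa [hval] at this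
  have hZs : ∀ J, f^[t (b J)] (Z J) = Z (J + 1) := by
    intro J
    have h1 := (hv J).2
    have h2 : ((J : ZMod (q * L)) + 1) = ((J + 1 : ℤ) : ZMod (q * L)) := by push_cast; rfl
    simp only [Equiv.coe_addRight] at h1
    rw [h2, hval, hval] at h1
    have h3 := hN.map_source _ _ (hbs J) _ ((hZ J).mono hN.rad_le)
    simp only [Z, z]
    rw [← h1, add_sub_cancel]
    exact ((extChartAt (𝓡 d) (c (b (J + 1)))).left_inv (by rwa [extChartAt_source])).symm
  set φ := f.toHomeomorph with hφ
  have h0 : orbitTime n q σ 0 = 0 := by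
    have := orbitTime_mul_add (n := n) (q := q) σ 0 (r := 0) hN.pos_q
    simpa [hN.cut_zero] using this
  -- The chart points form one orbit; for negative `J` the step is inverted by injectivity of the
  -- iterates.
  have hZ0 : ∀ J : ℤ, (φ ^ orbitTime n q σ J) (Z 0) = Z J := by
    intro J
    induction J using Int.induction_on with
    | zero => rw [h0]; rfl
    | succ J ih => rw [← hN.iterate_orbit a, ih, hZs]
    | pred J ih =>
      have h1 := hN.iterate_orbit a (-(J : ℤ) - 1) (Z 0)
      have h2 := hZs (-(J : ℤ) - 1)
      rw [sub_add_cancel] at h1 h2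
      rw [← hφ, ih, ← h2] at h1
      exact f.injective.iterate _ h1
  refine ⟨Z 0, fun m l hl => ?_⟩
  obtain ⟨j, hj, hj1, hj2⟩ := exists_cut hN.cut_zero hN.cut_last hl
  have hbj : b (q * m + j) = (a m, j) := orbitNode_mul_add a m hj
  have h1 := hZ0 (q * m + j)
  rw [orbitTime_mul_add σ m hj] at h1
  -- Closeness at the cut time `σ j` propagates to all the times inside the block.
  have h2 := hN.close _ (hbq (q * m + j)) _ (hZ (q * m + j)) (l - σ j)
    (by rw [hbj, hN.time_eq]; simp only; omega)
  rw [← h1, hbj, hN.point_eq] at h2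
  dsimp only at h2
  rw [← Function.iterate_add_apply, Nat.sub_add_cancel hj1] at h2
  rw [show (n * m + l : ℤ) = ((l - σ j : ℕ) : ℤ) + (n * m + σ j) by push_cast [hj1]; ring,
    homeomorph_zpow_add_apply, homeomorph_zpow_natCast]
  exact h2

/-- Different periodic orbits of the network are uniformly separated. -/
theorem eq_of_edist_le {i j : Fin k} (hi : f^[n] (p i) = p i) (hj : f^[n] (p j) = p j)
    (h : ∀ l < n, edist (f^[l] (p i)) (f^[l] (p j)) ≤ 3 * δ) : p i = p j := by
  have : NeZero q := ⟨hN.pos_q.ne'⟩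
  -- Both periodic orbits are read in the charts along the orbit of `p j`; their differences form a
  -- cyclic sequence of hyperbolic pairs, hence vanish.
  set b : ZMod q → Fin k × ℕ := fun J => (j, J.val) with hb
  have hbq : ∀ J, (b J).2 < q := fun J => ZMod.val_lt J
  have hJ : ∀ J : ZMod q, (J.val + 1 < q ∧ (J + 1).val = J.val + 1) ∨
      (J.val + 1 = q ∧ (J + 1).val = 0) := by
    intro J
    have h1 : (J + 1).val = (J.val + 1) % q := by
      rw [← ZMod.val_natCast]
      simp
    have h2 := ZMod.val_lt J
    rcases Nat.lt_or_ge (J.val + 1) q with h3 | h3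
    · exact Or.inl ⟨h3, by rw [h1, Nat.mod_eq_of_lt h3]⟩
    · have h4 : J.val + 1 = q := by omega
      exact Or.inr ⟨h4, by rw [h1, h4, Nat.mod_self]⟩
  have hbs : ∀ J, NodeSucc q (b J) (b (J + 1)) := by
    intro J
    refine ⟨hbq J, (hJ J).imp (fun h => ⟨h.1, ?_⟩) fun h => h⟩
    simp only [hb, h.2]
  have hit : ∀ i : Fin k, f^[n] (p i) = p i → ∀ J,
      f^[t (b J)] (f^[σ J.val] (p i)) = f^[σ (J + 1).val] (p i) := by
    intro i hi J
    rw [hN.time_eq, ← Function.iterate_add_apply, Nat.sub_add_cancel (hN.cut_lt _ (hbq J)).le]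
    rcases hJ J with h | h
    · rw [h.2]
    · show f^[σ (J.val + 1)] (p i) = _
      rw [h.2, h.1, hN.cut_last, hN.cut_zero, hi]
      rfl
  have hnear : ∀ i : Fin k, (∀ l < n, edist (f^[l] (p i)) (f^[l] (p j)) ≤ 3 * δ) → ∀ J,
      Near (d := d) (c (b J)) (y (b J)) ρ (f^[σ J.val] (p i)) := by
    intro i h J
    refine hN.near _ (hbq J) _ ?_
    rw [hN.point_eq]
    exact h _ (hN.cut_lt_last (hbq J))
  have hnj := hnear j (by simp)
  have h0 := cyclic_orbit_unique (Equiv.addRight (1 : ZMod q)) (fun J => Q (b J))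
    (fun J => B (b J) (b (J + 1))) (fun J => g (b J)) (fun J => hN.pos _ (hbq _))
    (fun J => hN.backward _ _ (hbs J))
    (fun J => extChartAt (𝓡 d) (c (b J)) (f^[σ J.val] (p i)) -
      extChartAt (𝓡 d) (c (b J)) (f^[σ J.val] (p j)))
    (fun J => by
      have h1 := hN.pair _ _ (hbs J) _ (hnear i h J) _ (hnj J)
      rw [hit i hi, hit j hj] at h1
      exact h1) 0
  have h1 : (0 : ZMod q).val = 0 := ZMod.val_zero
  simp only [h1, hN.cut_zero, sub_eq_zero] at h0
  have h2 := (hnear i h 0).1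
  have h3 := (hnj 0).1
  simp only [h1, hN.cut_zero] at h2 h3
  exact (extChartAt (𝓡 d) (c (b 0))).injOn (by rwa [extChartAt_source])
    (by rwa [extChartAt_source]) h0

end IsNetwork

/-! ### Derivatives of the integer powers -/

section TangentEstimates

variable {d : ℕ} {M : Type*} [EMetricSpace M] [ChartedSpace (EuclideanSpace ℝ (Fin d)) M]

theorem contMDiff_zpow (f : M ≃ₘ^1⟮𝓡 d, 𝓡 d⟯ M) (m : ℤ) :
    ContMDiff (𝓡 d) (𝓡 d) 1 (f.toHomeomorph ^ m) := by
  obtain ⟨l, rfl | rfl⟩ := m.eq_nat_or_neg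
  · have h : ⇑(f.toHomeomorph ^ (l : ℤ)) = f^[l] := funext (homeomorph_zpow_natCast _ l)
    rw [h]
    exact f.contMDiff.iterate l
  · have h : ⇑(f.toHomeomorph ^ (-(l : ℤ))) = f.symm^[l] := by
      funext x
      rw [zpow_neg, ← inv_zpow, homeomorph_zpow_natCast]
      rfl
    rw [h]
    exact f.symm.contMDiff.iterate l

/-- The integer powers of a diffeomorphism. -/
def zpowDiffeo (f : M ≃ₘ^1⟮𝓡 d, 𝓡 d⟯ M) (m : ℤ) : M ≃ₘ^1⟮𝓡 d, 𝓡 d⟯ M where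
  toEquiv := (f.toHomeomorph ^ m).toEquiv
  contMDiff_toFun := contMDiff_zpow f m
  contMDiff_invFun := by
    have h : ⇑(f.toHomeomorph ^ m).symm = ⇑(f.toHomeomorph ^ (-m)) := by
      rw [zpow_neg]; rfl
    show ContMDiff (𝓡 d) (𝓡 d) 1 (f.toHomeomorph ^ m).symm
    rw [h]
    exact contMDiff_zpow f (-m)

theorem mdifferentiableAt_zpow (f : M ≃ₘ^1⟮𝓡 d, 𝓡 d⟯ M) (m : ℤ) (x : M) :
    MDifferentiableAt (𝓡 d) (𝓡 d) (f.toHomeomorph ^ m) x :=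
  (zpowDiffeo f m).mdifferentiable one_ne_zero x

variable [RiemannianBundle (fun x : M => TangentSpace (𝓡 d) x)]

/-- The norm of the image of `v` under the derivative of `F` at `x`. -/
def derivNorm (F : M → M) (x : M) (v : TangentSpace (𝓡 d) x) : ℝ :=
  ‖mfderiv (𝓡 d) (𝓡 d) F x v‖

theorem derivNorm_zpow_add (f : M ≃ₘ^1⟮𝓡 d, 𝓡 d⟯ M) (i j : ℤ) (x : M)
    (v : TangentSpace (𝓡 d) x) :
    derivNorm (f.toHomeomorph ^ (i + j)) x v =
      derivNorm (f.toHomeomorph ^ i) ((f.toHomeomorph ^ j) x)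
        (mfderiv (𝓡 d) (𝓡 d) (f.toHomeomorph ^ j) x v) := by
  have h : ⇑(f.toHomeomorph ^ (i + j)) = (f.toHomeomorph ^ i) ∘ (f.toHomeomorph ^ j) :=
    funext (homeomorph_zpow_add_apply _ i j)
  rw [h, derivNorm, mfderiv_comp x (mdifferentiableAt_zpow f i _) (mdifferentiableAt_zpow f j x)]
  rfl

theorem derivNorm_zpow_zero (f : M ≃ₘ^1⟮𝓡 d, 𝓡 d⟯ M) (x : M) (v : TangentSpace (𝓡 d) x) :
    derivNorm (f.toHomeomorph ^ (0 : ℤ)) x v = ‖v‖ := by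
  have h : ⇑(f.toHomeomorph ^ (0 : ℤ)) = id := rfl
  rw [h, derivNorm, mfderiv_id]
  rfl

end TangentEstimates

namespace IsNetwork

variable {d : ℕ} {M : Type*} [EMetricSpace M] [ChartedSpace (EuclideanSpace ℝ (Fin d)) M]
  [IsManifold (𝓡 d) ∞ M] [RiemannianBundle (fun x : M => TangentSpace (𝓡 d) x)]

local notation "𝔼" => EuclideanSpace ℝ (Fin d)

variable {f : M ≃ₘ^1⟮𝓡 d, 𝓡 d⟯ M} {s n k q : ℕ} {p : Fin k → M} {C : ℝ} {δ : ℝ≥0∞} {σ : ℕ → ℕ}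
    {c y : Fin k × ℕ → M} {t : Fin k × ℕ → ℕ}
    {Q : Fin k × ℕ → EuclideanSpace ℝ (Fin d) →L[ℝ] EuclideanSpace ℝ (Fin d)}
    {B : Fin k × ℕ → Fin k × ℕ → EuclideanSpace ℝ (Fin d) →L[ℝ] EuclideanSpace ℝ (Fin d)}
    {g : Fin k × ℕ → ℝ} {ρ r : ℝ}
    (hN : IsNetwork f s n k q p (fun _ v => ‖v‖) C δ σ c y t Q B g ρ r)

include hN

theorem hypPair_orbit {a : ℤ → Fin k} {z : M} (hz : IsShadowed f.toHomeomorph n p δ a z) (J : ℤ)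
    (w : 𝔼) :
    HypPair (Q (orbitNode q a J)) (Q (orbitNode q a (J + 1)))
      (B (orbitNode q a J) (orbitNode q a (J + 1))) (g (orbitNode q a J))
      (g (orbitNode q a (J + 1)))
      (chartDerivEquiv (zpowDiffeo f (orbitTime n q σ J)) (c (orbitNode q a 0))
        (c (orbitNode q a J)) z w)
      (chartDerivEquiv (zpowDiffeo f (orbitTime n q σ (J + 1))) (c (orbitNode q a 0))
        (c (orbitNode q a (J + 1))) z w) := by
  have h1 := hN.deriv _ _ (nodeSucc_orbitNode hN.pos_q a J) _
    (hN.near_orbit (le_mul_of_one_le_left' (by norm_num)) hz J)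
    (chartDerivEquiv (zpowDiffeo f (orbitTime n q σ J)) (c (orbitNode q a 0))
        (c (orbitNode q a J)) z w)
  convert h1 using 1
  have h2 := chartDeriv_comp (d := d) (c (orbitNode q a 0)) (c (orbitNode q a J))
    (c (orbitNode q a (J + 1))) (mdifferentiableAt_zpow f (orbitTime n q σ J) z)
    (mdifferentiableAt_iterate f (t (orbitNode q a J)) _)
  have h3 : f^[t (orbitNode q a J)] ∘ ⇑(f.toHomeomorph ^ orbitTime n q σ J) =
      ⇑(f.toHomeomorph ^ orbitTime n q σ (J + 1)) := funext (hN.iterate_orbit a J)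
  rw [h3] at h2
  exact congrArg (fun L => L w) h2

/-- Only finitely many nodes occur, so the norms of the projections and the inverses of the scales
are bounded. The constant may depend on the network, which is harmless for hyperbolicity of a fixed
set. -/
theorem exists_derivNorm_compare :
    ∃ C₃ ≥ (1 : ℝ), ∀ a z, IsShadowed f.toHomeomorph n p δ a z → ∀ v : TangentSpace (𝓡 d) z,
      ∀ J : ℤ, derivNorm (f.toHomeomorph ^ orbitTime n q σ J) z v ≤ C₃ *
        (splitNorm (Q (orbitNode q a J)) (chartDerivEquiv (zpowDiffeo f (orbitTime n q σ J))
          (c (orbitNode q a 0)) (c (orbitNode q a J)) z (frame d (c (orbitNode q a 0)) z v)) /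
          g (orbitNode q a J)) ∧
        splitNorm (Q (orbitNode q a J)) (chartDerivEquiv (zpowDiffeo f (orbitTime n q σ J))
          (c (orbitNode q a 0)) (c (orbitNode q a J)) z (frame d (c (orbitNode q a 0)) z v)) /
          g (orbitNode q a J) ≤ C₃ * derivNorm (f.toHomeomorph ^ orbitTime n q σ J) z v := by
  have hC := hN.one_le
  obtain ⟨C₃, hC₃, h⟩ := exists_forall_mem_finset_of_mono
    ((Finset.univ : Finset (Fin k)) ×ˢ Finset.range q)
    (p := fun a R => 2 * C ≤ R ∧ (‖Q a‖ + 1) / g a * C ≤ R)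
    (fun a R R' hR h => ⟨h.1.trans hR, h.2.trans hR⟩)
    (fun a _ => ⟨max (2 * C) ((‖Q a‖ + 1) / g a * C), le_max_left _ _, le_max_right _ _⟩)
  refine ⟨C₃, hC₃, fun a z hz v J => ?_⟩
  set b := orbitNode q a J with hb
  have hbq : b.2 < q := orbitNode_lt hN.pos_q a J
  obtain ⟨h1, h2⟩ := h b (by simp [hbq])
  set w := chartDerivEquiv (zpowDiffeo f (orbitTime n q σ J))
          (c (orbitNode q a 0)) (c b) z (frame d (c (orbitNode q a 0)) z v) with hw
  have hw' : w = frame d (c b) ((f.toHomeomorph ^ orbitTime n q σ J) z)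
      (mfderiv (𝓡 d) (𝓡 d) (f.toHomeomorph ^ orbitTime n q σ J) z v) := by
    rw [hw, chartDerivEquiv_apply, chartDeriv_apply, ContinuousLinearEquiv.symm_apply_apply]
    rfl
  obtain ⟨h3, h4⟩ := hN.norm_frame_le b hbq ((f.toHomeomorph ^ orbitTime n q σ J) z)
    ((hN.edist_orbit hz J).trans (le_mul_of_one_le_left' (by norm_num)))
    (mfderiv (𝓡 d) (𝓡 d) (f.toHomeomorph ^ orbitTime n q σ J) z v)
  rw [← hw'] at h3 h4
  have hg := hN.pos b hbq
  have hg1 := hN.le_one b hbq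
  have h5 : ‖w‖ ≤ 2 * (splitNorm (Q b) w / g b) := by
    refine (norm_le_two_mul_splitNorm (Q b) w).trans ?_
    gcongr
    exact le_div_self (splitNorm_nonneg _ _) hg hg1
  have h6 : 0 ≤ splitNorm (Q b) w / g b := div_nonneg (splitNorm_nonneg _ _) hg.le
  constructor
  · calc _ ≤ C * ‖w‖ := h4
      _ ≤ C * (2 * (splitNorm (Q b) w / g b)) := by gcongr
      _ = 2 * C * (splitNorm (Q b) w / g b) := by ring
      _ ≤ _ := by gcongr
  · calc _ ≤ ((‖Q b‖ + 1) * ‖w‖) / g b := by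
          gcongr
          exact splitNorm_le (Q b).le_opNorm w
      _ = (‖Q b‖ + 1) / g b * ‖w‖ := by ring
      _ ≤ (‖Q b‖ + 1) / g b * (C * ‖mfderiv (𝓡 d) (𝓡 d) (f.toHomeomorph ^ orbitTime n q σ J) z v‖) := by
          gcongr
      _ = (‖Q b‖ + 1) / g b * C * derivNorm (f.toHomeomorph ^ orbitTime n q σ J) z v := by
          rw [mul_assoc]; rfl
      _ ≤ _ := mul_le_mul_of_nonneg_right h2 (norm_nonneg _)

theorem orbitTime_mul (m : ℤ) : orbitTime n q σ (q * m) = n * m := by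
  have := orbitTime_mul_add (n := n) σ m hN.pos_q
  simpa [hN.cut_zero] using this

end IsNetwork

/-! ### Bi-infinite hyperbolic cocycles -/

section BiInfinite

variable {V : Type*} [NormedAddCommGroup V] [InnerProductSpace ℝ V] [FiniteDimensional ℝ V]

/-- A bi-infinite sequence of hyperbolic linear maps, with composites `Φ J`, whose stable
directions have dimension `s`. -/
structure IsHypCocycle (P B : ℤ → V →L[ℝ] V) (g : ℤ → ℝ) (Φ : ℤ → V ≃L[ℝ] V) (s : ℕ) : Prop where
  pos : ∀ J, 0 < g J
  proj : ∀ J v, P J (P J v) = P J v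
  finrank : ∀ J, Module.finrank ℝ (LinearMap.range (P J : V →ₗ[ℝ] V)) = s
  backward : ∀ J, IsBackward (P J) (P (J + 1)) (B J) (g J) (g (J + 1))
  pair : ∀ J w, HypPair (P J) (P (J + 1)) (B J) (g J) (g (J + 1)) (Φ J w) (Φ (J + 1) w)

namespace IsHypCocycle

variable {P B : ℤ → V →L[ℝ] V} {g : ℤ → ℝ} {Φ : ℤ → V ≃L[ℝ] V} {s : ℕ}
  (h : IsHypCocycle P B g Φ s)

include h

omit [FiniteDimensional ℝ V] in
theorem forward (J₀ : ℤ) {w : V} {R : ℝ}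
    (hR : ∀ j : ℕ, splitNorm (P (J₀ + j)) (Φ (J₀ + j) w) / g (J₀ + j) ≤ R) (j : ℕ) :
    splitNorm (P (J₀ + j)) (Φ (J₀ + j) w) / g (J₀ + j) ≤
      (1 / 2) ^ j * (splitNorm (P J₀) (Φ J₀ w) / g J₀) := by
  have hs : ∀ j : ℕ, J₀ + (j + 1 : ℕ) = J₀ + j + 1 := fun j => by push_cast; ring
  have h1 := forward_bounded_contract (P := fun j : ℕ => P (J₀ + j))
    (B := fun j : ℕ => B (J₀ + j)) (g := fun j : ℕ => g (J₀ + j)) (fun j => h.pos _)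
    (fun j => by rw [hs]; exact h.backward _) (v := fun j : ℕ => Φ (J₀ + j) w)
    (fun j => by rw [hs]; exact h.pair _ w) hR j
  simpa using h1

omit [FiniteDimensional ℝ V] in
theorem backward_contract (J₀ : ℤ) {w : V} {R : ℝ}
    (hR : ∀ j : ℕ, splitNorm (P (J₀ - j)) (Φ (J₀ - j) w) / g (J₀ - j) ≤ R) (j : ℕ) :
    splitNorm (P (J₀ - j)) (Φ (J₀ - j) w) / g (J₀ - j) ≤
      (1 / 2) ^ j * (splitNorm (P J₀) (Φ J₀ w) / g J₀) := by
  have hs : ∀ j : ℕ, J₀ - j = J₀ - (j + 1 : ℕ) + 1 := fun j => by push_cast; ring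
  have h1 := backward_bounded_contract (P := fun j : ℕ => P (J₀ - j))
    (B := fun j : ℕ => B (J₀ - (j + 1 : ℕ))) (g := fun j : ℕ => g (J₀ - j)) (fun j => h.pos _)
    (fun j => by
      have := h.backward (J₀ - (j + 1 : ℕ))
      rwa [← hs j] at this) (v := fun j : ℕ => Φ (J₀ - j) w)
    (fun j => by
      have := h.pair (J₀ - (j + 1 : ℕ)) w
      rwa [← hs j] at this) hR j
  simpa using h1

theorem exists_stable :
    ∃ W : Submodule ℝ V, Module.finrank ℝ W = s ∧ ∀ w ∈ W, ∀ j : ℕ,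
      splitNorm (P j) (Φ j w) / g j ≤ splitNorm (P 0) (Φ 0 w) / g 0 := by
  obtain ⟨W, hW, hWc⟩ := exists_stable_subspace (P := fun j : ℕ => P j) (B := fun j : ℕ => B j)
    (g := fun j : ℕ => g j) (fun j => h.pos _) (fun j => h.backward _) (fun j => h.proj _)
    (s := s) (fun j => h.finrank _) (fun j : ℕ => Φ j) (fun j w => h.pair _ w)
  refine ⟨W, hW, fun w hw j => ?_⟩
  induction j with
  | zero => simp
  | succ j ih =>
    have h1 := ((h.pair j w).contract (h.pos _) (h.pos _) (h.backward _) (by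
      have := hWc w hw (j + 1)
      push_cast at this
      exact this)).2
    have h2 : 0 ≤ splitNorm (P (j + 1)) (Φ (j + 1) w) / g (j + 1) :=
      div_nonneg (splitNorm_nonneg _ _) (h.pos _).le
    push_cast
    linarith

theorem exists_unstable :
    ∃ W : Submodule ℝ V, Module.finrank ℝ W = Module.finrank ℝ V - s ∧ ∀ w ∈ W, ∀ j : ℕ,
      splitNorm (P (-j)) (Φ (-j) w) / g (-j) ≤ splitNorm (P 0) (Φ 0 w) / g 0 := by
  have hs : ∀ j : ℕ, (-j : ℤ) = -(j + 1 : ℕ) + 1 := fun j => by push_cast; ring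
  have hb : ∀ j : ℕ, IsBackward (P (-(j + 1 : ℕ))) (P (-j)) (B (-(j + 1 : ℕ)))
      (g (-(j + 1 : ℕ))) (g (-j)) := fun j => by
    have := h.backward (-(j + 1 : ℕ))
    rwa [← hs j] at this
  have hp : ∀ (j : ℕ) w, HypPair (P (-(j + 1 : ℕ))) (P (-j)) (B (-(j + 1 : ℕ)))
      (g (-(j + 1 : ℕ))) (g (-j)) (Φ (-(j + 1 : ℕ)) w) (Φ (-j) w) := fun j w => by
    have := h.pair (-(j + 1 : ℕ)) w
    rwa [← hs j] at this
  obtain ⟨W, hW, hWc⟩ := exists_unstable_subspace (P := fun j : ℕ => P (-j))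
    (B := fun j : ℕ => B (-(j + 1 : ℕ)))
    (g := fun j : ℕ => g (-j)) (fun j => h.pos _) hb
    (s := Module.finrank ℝ V - s) (fun j => by
      have := LinearMap.finrank_range_add_finrank_ker (P (-j) : V →ₗ[ℝ] V)
      have := h.finrank (-j)
      omega) (fun j : ℕ => Φ (-j)) hp
  refine ⟨W, hW, fun w hw j => ?_⟩
  induction j with
  | zero => simp
  | succ j ih =>
    have h1 := ((hp j w).expand (h.pos _) (h.pos _) (hb j) (hWc w hw (j + 1))).2
    have h2 : 0 ≤ splitNorm (P (-(j + 1 : ℕ))) (Φ (-(j + 1 : ℕ)) w) / g (-(j + 1 : ℕ)) :=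
      div_nonneg (splitNorm_nonneg _ _) (h.pos _).le
    linarith

omit [FiniteDimensional ℝ V] in
-- The forward contraction, started at time `-j`, bounds the size at time `0` by `(1 / 2) ^ j * R`
-- for every `j`.
theorem eq_zero_of_bounded {w : V} {R : ℝ}
    (hR : ∀ J : ℤ, splitNorm (P J) (Φ J w) / g J ≤ R) : w = 0 := by
  have h1 : splitNorm (P 0) (Φ 0 w) / g 0 ≤ 0 := by
    have h2 : Tendsto (fun j : ℕ => (1 / 2 : ℝ) ^ j * R) atTop (𝓝 0) := by
      simpa using (tendsto_pow_atTop_nhds_zero_of_lt_one (r := (1 / 2 : ℝ)) (by norm_num)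
        (by norm_num)).mul_const R
    refine ge_of_tendsto' h2 fun j => ?_
    have h3 := h.forward (-j) (w := w) (R := R) (fun i => hR _) j
    rw [neg_add_cancel] at h3
    exact h3.trans (by gcongr; exact hR _)
  have h4 : splitNorm (P 0) (Φ 0 w) ≤ 0 := by
    rwa [div_le_iff₀ (h.pos 0), zero_mul] at h1
  exact (map_eq_zero_iff _ (Φ 0).injective).1 (eq_zero_of_splitNorm_nonpos h4)

end IsHypCocycle

end BiInfinite

/-! ### Tangent dynamics along the shadowing orbits -/

namespace IsNetwork

variable {d : ℕ} {M : Type*} [EMetricSpace M] [ChartedSpace (EuclideanSpace ℝ (Fin d)) M]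
  [IsManifold (𝓡 d) ∞ M] [RiemannianBundle (fun x : M => TangentSpace (𝓡 d) x)]

local notation "𝔼" => EuclideanSpace ℝ (Fin d)

variable {f : M ≃ₘ^1⟮𝓡 d, 𝓡 d⟯ M} {s n k q : ℕ} {p : Fin k → M} {C : ℝ} {δ : ℝ≥0∞} {σ : ℕ → ℕ}
    {c y : Fin k × ℕ → M} {t : Fin k × ℕ → ℕ}
    {Q : Fin k × ℕ → EuclideanSpace ℝ (Fin d) →L[ℝ] EuclideanSpace ℝ (Fin d)}
    {B : Fin k × ℕ → Fin k × ℕ → EuclideanSpace ℝ (Fin d) →L[ℝ] EuclideanSpace ℝ (Fin d)}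
    {g : Fin k × ℕ → ℝ} {ρ r : ℝ}
    (hN : IsNetwork f s n k q p (fun _ v => ‖v‖) C δ σ c y t Q B g ρ r)

include hN

theorem isHypCocycle {a : ℤ → Fin k} {z : M} (hz : IsShadowed f.toHomeomorph n p δ a z) :
    IsHypCocycle (fun J => Q (orbitNode q a J))
      (fun J => B (orbitNode q a J) (orbitNode q a (J + 1))) (fun J => g (orbitNode q a J))
      (fun J => chartDerivEquiv (zpowDiffeo f (orbitTime n q σ J)) (c (orbitNode q a 0))
        (c (orbitNode q a J)) z) s where
  pos := fun J => hN.pos _ (orbitNode_lt hN.pos_q a J)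
  proj := fun J => hN.proj _ (orbitNode_lt hN.pos_q a J)
  finrank := fun J => hN.finrank _ (orbitNode_lt hN.pos_q a J)
  backward := fun J => hN.backward _ _ (nodeSucc_orbitNode hN.pos_q a J)
  pair := fun J w => hN.hypPair_orbit hz J w

/-- Hyperbolicity of the tangent dynamics along the orbits that follow the network, in the future
for `e = 1` and in the past for `e = -1`. -/
theorem exists_tangent_estimates :
    ∃ C₂ : ℝ, 0 ≤ C₂ ∧ ∀ z ∈ shadowSet f.toHomeomorph n p δ,
      (∀ e : ℤ, e = 1 ∨ e = -1 →
        (∃ W : Submodule ℝ (TangentSpace (𝓡 d) z),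
          Module.finrank ℝ W = (if e = 1 then s else d - s) ∧ ∀ v ∈ W, ∀ m : ℕ,
            derivNorm (f.toHomeomorph ^ (e * (n * m) : ℤ)) z v ≤ C₂ * (1 / 2) ^ m * ‖v‖) ∧
        ∀ v : TangentSpace (𝓡 d) z,
          (∃ R, ∀ m : ℕ, derivNorm (f.toHomeomorph ^ (e * m : ℤ)) z v ≤ R) →
          ∀ m : ℕ, derivNorm (f.toHomeomorph ^ (e * (n * m) : ℤ)) z v ≤
            C₂ * (1 / 2) ^ m * ‖v‖) ∧
      ∀ v : TangentSpace (𝓡 d) z,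
        (∃ R, ∀ m : ℤ, derivNorm (f.toHomeomorph ^ m) z v ≤ R) → v = 0 := by
  obtain ⟨C₃, hC₃, hcomp⟩ := hN.exists_derivNorm_compare
  have hC0 : 0 ≤ C₃ := by linarith
  refine ⟨C₃ * C₃, mul_nonneg hC0 hC0, ?_⟩
  rintro z ⟨a, hz⟩
  have H := hN.isHypCocycle hz
  set U : TangentSpace (𝓡 d) z → ℤ → ℝ := fun v J =>
    splitNorm (Q (orbitNode q a J)) (chartDerivEquiv (zpowDiffeo f (orbitTime n q σ J))
          (c (orbitNode q a 0)) (c (orbitNode q a J)) z (frame d (c (orbitNode q a 0)) z v)) /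
          g (orbitNode q a J) with hU
  have hle : ∀ v J, derivNorm (f.toHomeomorph ^ orbitTime n q σ J) z v ≤ C₃ * U v J :=
    fun v J => (hcomp a z hz v J).1
  have hge : ∀ v J, U v J ≤ C₃ * derivNorm (f.toHomeomorph ^ orbitTime n q σ J) z v :=
    fun v J => (hcomp a z hz v J).2
  have hT0 : orbitTime n q σ 0 = 0 := by simpa using hN.orbitTime_mul 0
  have h0 : ∀ v, U v 0 ≤ C₃ * ‖v‖ := fun v => by
    have := hge v 0
    rwa [hT0, derivNorm_zpow_zero] at this
  have hU0 : ∀ v J, 0 ≤ U v J := fun v J =>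
    div_nonneg (splitNorm_nonneg _ _) (hN.pos _ (orbitNode_lt hN.pos_q a J)).le
  have hTq : ∀ (e : ℤ) (m : ℕ), orbitTime n q σ (e * (q * m : ℕ)) = e * (n * m) := fun e m => by
    rw [show e * ((q * m : ℕ) : ℤ) = q * (e * m) by push_cast; ring, hN.orbitTime_mul]
    ring
  -- Passing through `q` nodes takes `n` iterates, so halving at every node halves at least once per
  -- `n` iterates.
  have hcontr : ∀ e : ℤ, ∀ v, (∀ j : ℕ, U v (e * j) ≤ (1 / 2) ^ j * U v 0) → ∀ m : ℕ,
      derivNorm (f.toHomeomorph ^ (e * (n * m) : ℤ)) z v ≤ C₃ * C₃ * (1 / 2) ^ m * ‖v‖ := by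
    intro e v h m
    have h1 := hle v (e * (q * m : ℕ))
    rw [hTq] at h1
    have h2 : ((1 : ℝ) / 2) ^ (q * m) ≤ (1 / 2) ^ m :=
      pow_le_pow_of_le_one (by norm_num) (by norm_num) (Nat.le_mul_of_pos_left m hN.pos_q)
    calc _ ≤ C₃ * U v (e * (q * m : ℕ)) := h1
      _ ≤ C₃ * ((1 / 2) ^ (q * m) * U v 0) := by gcongr; exact h _
      _ ≤ C₃ * ((1 / 2) ^ m * (C₃ * ‖v‖)) := by
          gcongr
          · exact hU0 v 0
          · exact h0 v
      _ = _ := by ring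
  have hdir : ∀ e : ℤ, e = 1 ∨ e = -1 → ∀ v R, (∀ j : ℕ, U v (e * j) ≤ R) →
      ∀ j : ℕ, U v (e * j) ≤ (1 / 2) ^ j * U v 0 := by
    rintro e (rfl | rfl) v R hR j
    · have := H.forward 0 (w := frame d (c (orbitNode q a 0)) z v) (R := R) (fun j => by
        have := hR j
        rwa [one_mul, ← zero_add (j : ℤ)] at this) j
      rw [zero_add] at this
      rw [one_mul]
      exact this
    · have := H.backward_contract 0 (w := frame d (c (orbitNode q a 0)) z v) (R := R) (fun j => by
        have := hR j
        rwa [neg_one_mul, ← zero_sub (j : ℤ)] at this) j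
      rw [zero_sub] at this
      rw [neg_one_mul]
      exact this
  have hcomap : ∀ (l : ℕ) (W : Submodule ℝ 𝔼), Module.finrank ℝ W = l →
      Module.finrank ℝ (W.comap ((frame d (c (orbitNode q a 0)) z).toLinearEquiv :
        TangentSpace (𝓡 d) z →ₗ[ℝ] 𝔼)) = l := by
    rintro l W rfl
    rw [Submodule.comap_equiv_eq_map_symm]
    exact LinearEquiv.finrank_map_eq (frame d (c (orbitNode q a 0)) z).toLinearEquiv.symm W
  -- Visits to nodes in the direction `e` happen at times of the sign of `e`, so a bound along the
  -- half orbit gives a bound at the nodes.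
  have htime : ∀ e : ℤ, e = 1 ∨ e = -1 → ∀ j : ℕ, ∃ m : ℕ, orbitTime n q σ (e * j) = e * m := by
    have h1 : ∀ j : ℕ, 0 ≤ orbitTime n q σ j ∧ orbitTime n q σ (-j) ≤ 0 := by
      intro j
      induction j with
      | zero => simp [hT0]
      | succ j ih =>
        have h2 := hN.orbitTime_succ a j
        have h3 := hN.orbitTime_succ a (-(j + 1 : ℕ))
        rw [show (-(j + 1 : ℕ) + 1 : ℤ) = -j by push_cast; ring] at h3
        push_cast at h3 ⊢
        omega
    rintro e (rfl | rfl) j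
    · exact ⟨(orbitTime n q σ j).toNat, by rw [one_mul, one_mul, Int.toNat_of_nonneg (h1 j).1]⟩
    · refine ⟨(-orbitTime n q σ (-j)).toNat, ?_⟩
      rw [neg_one_mul, neg_one_mul, Int.toNat_of_nonneg (by linarith [(h1 j).2]), neg_neg]
  refine ⟨fun e he => ⟨?_, fun v ⟨R, hR⟩ => ?_⟩, fun v ⟨R, hR⟩ => ?_⟩
  · obtain ⟨W, hW, hWb⟩ : ∃ W : Submodule ℝ 𝔼, Module.finrank ℝ W = (if e = 1 then s else d - s) ∧
        ∀ w ∈ W, ∀ j : ℕ,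
          splitNorm (Q (orbitNode q a (e * j))) (chartDerivEquiv
            (zpowDiffeo f (orbitTime n q σ (e * j))) (c (orbitNode q a 0))
            (c (orbitNode q a (e * j))) z w) / g (orbitNode q a (e * j)) ≤
          splitNorm (Q (orbitNode q a 0)) (chartDerivEquiv
            (zpowDiffeo f (orbitTime n q σ 0)) (c (orbitNode q a 0))
            (c (orbitNode q a 0)) z w) / g (orbitNode q a 0) := by
      rcases he with rfl | rfl
      · simpa only [one_mul, if_true] using H.exists_stable
      · have := H.exists_unstable
        simpa only [neg_one_mul, finrank_euclideanSpace_fin,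
          if_neg (show ¬(-1 : ℤ) = 1 by norm_num)] using this
    exact ⟨_, hcomap _ W hW, fun v hv => hcontr e v (hdir e he v _ fun j => hWb _ hv j)⟩
  · refine hcontr e v (hdir e he v (C₃ * R) fun j => ?_)
    obtain ⟨m, hm⟩ := htime e he j
    refine (hge v _).trans ?_
    rw [hm]
    gcongr
    exact hR m
  · have := H.eq_zero_of_bounded (w := frame d (c (orbitNode q a 0)) z v) (R := C₃ * R)
      fun J => (hge v J).trans (by gcongr; exact hR _)
    exact (map_eq_zero_iff _ (frame d (c (orbitNode q a 0)) z).injective).1 this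

end IsNetwork

theorem exists_bound_shift {u : ℤ → ℝ} {e : ℤ} (he : e = 1 ∨ e = -1) (j : ℤ)
    (h : ∃ R, ∀ m : ℕ, u (e * m) ≤ R) : ∃ R, ∀ m : ℕ, u (e * m + j) ≤ R := by
  obtain ⟨R, hR⟩ := h
  obtain ⟨R', -, hR'⟩ := exists_forall_mem_finset_of_mono (Finset.range (j.natAbs + 1))
    (p := fun m R => u (e * m + j) ≤ R) (fun _ _ _ hab h => h.trans hab) fun m _ => ⟨_, le_rfl⟩
  refine ⟨max R R', fun m => ?_⟩
  rcases Nat.lt_or_ge m (j.natAbs + 1) with h | h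
  · exact (hR' m (Finset.mem_range.2 h)).trans (le_max_right _ _)
  · have h1 : e * m + j = e * (m + e * j).toNat := by
      rcases he with rfl | rfl <;> omega
    rw [h1]
    exact (hR _).trans (le_max_left _ _)

/-- In either direction of time, a time is a multiple of the period followed by a remainder in `[0,
n)`; this reduces all estimates to those at multiples of `n`. -/
theorem exists_mul_add_lt {n : ℕ} (hn : 0 < n) {e : ℤ} (he : e = 1 ∨ e = -1) {l : ℕ} (hl : l < n)
    (T : ℕ) : ∃ m : ℕ, ∃ l' < n, e * T + l = l' + e * (n * m) ∧ T ≤ n * (m + 1) := by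
  have hn' : (0 : ℤ) < n := by exact_mod_cast hn
  have h1 := Int.mul_ediv_add_emod (e * T + l) n
  have h2 := Int.emod_nonneg (e * T + l) hn'.ne'
  have h3 := Int.emod_lt_of_pos (e * T + l) hn'
  set Z := (e * T + l) / n with hZ
  have h4 : 0 ≤ e * Z := by
    rcases he with rfl | rfl
    · rw [one_mul]
      exact Int.ediv_nonneg (by omega) hn'.le
    · have : Z < 1 := by
        by_contra! h
        have : (n : ℤ) * 1 ≤ n * Z := mul_le_mul_of_nonneg_left h hn'.le
        omega
      omega
  have hee : e * e = 1 := by rcases he with rfl | rfl <;> rfl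
  refine ⟨(e * Z).toNat, ((e * T + l) % n).toNat, by omega, ?_, ?_⟩
  · rw [Int.toNat_of_nonneg h2, Int.toNat_of_nonneg h4]
    linear_combination -h1 - n * Z * hee
  · zify
    rw [Int.toNat_of_nonneg h4]
    have h5 : (n : ℤ) * (e * Z + 1) = e * (n * Z) + n := by ring
    rw [h5]
    rcases he with rfl | rfl <;> omega

/-! ### Invariant subspaces of tangent vectors with bounded half orbits -/

section HyperbolicSet

variable {d : ℕ} {M : Type*} [EMetricSpace M] [ChartedSpace (EuclideanSpace ℝ (Fin d)) M]
  [RiemannianBundle (fun x : M => TangentSpace (𝓡 d) x)]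

theorem derivNorm_add_le (F : M → M) (x : M) (v w : TangentSpace (𝓡 d) x) :
    derivNorm F x (v + w) ≤ derivNorm F x v + derivNorm F x w := by
  unfold derivNorm
  rw [map_add]
  exact norm_add_le _ _

theorem derivNorm_smul (F : M → M) (x : M) (a : ℝ) (v : TangentSpace (𝓡 d) x) :
    derivNorm F x (a • v) = |a| * derivNorm F x v := by
  unfold derivNorm
  rw [map_smul, norm_smul, Real.norm_eq_abs]

/-- The tangent vectors with bounded orbit, in the future for `e = 1`, and in the past for
`e = -1`. -/
def boundedSubspace (f : M ≃ₘ^1⟮𝓡 d, 𝓡 d⟯ M) (e : ℤ) (x : M) :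
    Submodule ℝ (TangentSpace (𝓡 d) x) where
  carrier := {v | ∃ R, ∀ m : ℕ, derivNorm (f.toHomeomorph ^ (e * m : ℤ)) x v ≤ R}
  add_mem' := by
    rintro v w ⟨R, hR⟩ ⟨R', hR'⟩
    exact ⟨R + R', fun m => (derivNorm_add_le _ _ _ _).trans (add_le_add (hR m) (hR' m))⟩
  zero_mem' := ⟨0, fun m => by
    have := derivNorm_smul (⇑(f.toHomeomorph ^ (e * m : ℤ))) x 0 (0 : TangentSpace (𝓡 d) x)
    rw [zero_smul, abs_zero, zero_mul] at this
    exact this.le⟩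
  smul_mem' := by
    rintro a v ⟨R, hR⟩
    refine ⟨|a| * R, fun m => ?_⟩
    rw [derivNorm_smul]
    exact mul_le_mul_of_nonneg_left (hR m) (abs_nonneg a)

theorem mem_boundedSubspace {f : M ≃ₘ^1⟮𝓡 d, 𝓡 d⟯ M} {e : ℤ} {x : M}
    {v : TangentSpace (𝓡 d) x} : v ∈ boundedSubspace f e x ↔
      ∃ R, ∀ m : ℕ, derivNorm (f.toHomeomorph ^ (e * m : ℤ)) x v ≤ R := Iff.rfl

/-- Moving the base point along its orbit shifts the times, and a shift changes only finitely many
terms of a half orbit. -/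
theorem mfderiv_mem_boundedSubspace_iff (f : M ≃ₘ^1⟮𝓡 d, 𝓡 d⟯ M) {e : ℤ} (he : e = 1 ∨ e = -1)
    (j : ℤ) (x : M) (v : TangentSpace (𝓡 d) x) :
    mfderiv (𝓡 d) (𝓡 d) (f.toHomeomorph ^ j) x v ∈
      boundedSubspace f e ((f.toHomeomorph ^ j) x) ↔ v ∈ boundedSubspace f e x := by
  simp only [mem_boundedSubspace, ← derivNorm_zpow_add]
  constructor
  · intro h
    have := exists_bound_shift (u := fun i => derivNorm (f.toHomeomorph ^ (i + j)) x v) he (-j) h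
    simpa using this
  · exact exists_bound_shift (u := fun i => derivNorm (f.toHomeomorph ^ i) x v) he j

/-- The derivative of a power of `f`. -/
def tangentEquiv [IsManifold (𝓡 d) ∞ M] (f : M ≃ₘ^1⟮𝓡 d, 𝓡 d⟯ M) (j : ℤ) (x : M) :
    TangentSpace (𝓡 d) x ≃ₗ[ℝ] TangentSpace (𝓡 d) ((f.toHomeomorph ^ j) x) :=
  ((zpowDiffeo f j).mfderivToContinuousLinearEquiv one_ne_zero x).toLinearEquiv

omit [RiemannianBundle (fun x : M => TangentSpace (𝓡 d) x)] in
theorem tangentEquiv_apply [IsManifold (𝓡 d) ∞ M] (f : M ≃ₘ^1⟮𝓡 d, 𝓡 d⟯ M) (j : ℤ) (x : M)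
    (v : TangentSpace (𝓡 d) x) :
    tangentEquiv f j x v = mfderiv (𝓡 d) (𝓡 d) (f.toHomeomorph ^ j) x v := rfl

theorem map_boundedSubspace (f : M ≃ₘ^1⟮𝓡 d, 𝓡 d⟯ M) [IsManifold (𝓡 d) ∞ M] {e : ℤ}
    (he : e = 1 ∨ e = -1) (j : ℤ) (x : M) :
    (boundedSubspace f e x).map (tangentEquiv f j x : TangentSpace (𝓡 d) x →ₗ[ℝ] _) =
      boundedSubspace f e ((f.toHomeomorph ^ j) x) := by
  ext w
  obtain ⟨v, rfl⟩ := (tangentEquiv f j x).surjective w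
  rw [Submodule.mem_map_equiv, LinearEquiv.symm_apply_apply, tangentEquiv_apply]
  exact (mfderiv_mem_boundedSubspace_iff f he j x v).symm

theorem map_mfderiv_boundedSubspace (f : M ≃ₘ^1⟮𝓡 d, 𝓡 d⟯ M) [IsManifold (𝓡 d) ∞ M] {e : ℤ}
    (he : e = 1 ∨ e = -1) (x : M) :
    (boundedSubspace f e x).map (mfderiv (𝓡 d) (𝓡 d) f x :
      TangentSpace (𝓡 d) x →ₗ[ℝ] TangentSpace (𝓡 d) (f x)) = boundedSubspace f e (f x) := by
  -- The target tangent space depends on the map, so the equality of `f` with its first power is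
  -- substituted for a variable map.
  have h : ∀ F : M → M, F = ⇑(f.toHomeomorph ^ (1 : ℤ)) →
      (boundedSubspace f e x).map (mfderiv (𝓡 d) (𝓡 d) F x :
        TangentSpace (𝓡 d) x →ₗ[ℝ] TangentSpace (𝓡 d) (F x)) = boundedSubspace f e (F x) := by
    rintro _ rfl
    exact map_boundedSubspace f he 1 x
  exact h f (by rw [zpow_one]; rfl)

variable [IsManifold (𝓡 d) ∞ M]

theorem IsGoodAtlas.exists_derivNorm_le {ν' : (x : M) → TangentSpace (𝓡 d) x → ℝ}
    {P : (x : M) → TangentSpace (𝓡 d) x →L[ℝ] TangentSpace (𝓡 d) x} {Λ : Set M}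
    {T : Finset M} {A : M → Set M} {C : ℝ} {r₀ : ℝ≥0∞}
    (hA : IsGoodAtlas (fun _ v => ‖v‖) ν' P Λ T A C r₀) (h : M ≃ₘ^1⟮𝓡 d, 𝓡 d⟯ M) :
    ∃ D, ∀ x, ∀ v : TangentSpace (𝓡 d) x, derivNorm h x v ≤ D * ‖v‖ := by
  obtain ⟨D, hD, H⟩ := exists_forall_mem_finset_of_mono (T ×ˢ T)
    (p := fun a D => ∀ x ∈ A a.1, h x ∈ A a.2 → ∀ v, ‖chartDeriv (d := d) h a.1 a.2 x v‖ ≤ D * ‖v‖)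
    (fun a D D' hDD h x hx hx' v => (h x hx hx' v).trans (by gcongr))
    (by
      rintro ⟨c, c'⟩ hc
      rw [Finset.mem_product] at hc
      exact exists_norm_chartDeriv_le h (hA.isCompact c hc.1) (hA.isCompact c' hc.2)
        (hA.subset c hc.1) (hA.subset c' hc.2))
  have hC := hA.one_le
  refine ⟨C * (D * C), fun x v => ?_⟩
  obtain ⟨c, hc, hxc⟩ := hA.cover x
  obtain ⟨c', hc', hxc'⟩ := hA.cover (h x)
  have hx := hxc x (by simpa using hA.pos)
  have hx' := hxc' (h x) (by simpa using hA.pos)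
  have h1 := H (c, c') (by simp [hc, hc']) x hx hx' (frame d c x v)
  rw [chartDeriv_apply, ContinuousLinearEquiv.symm_apply_apply] at h1
  calc derivNorm h x v ≤ C * ‖frame d c' (h x) (mfderiv (𝓡 d) (𝓡 d) h x v)‖ :=
        (hA.norm_frame_le c' hc' _ hx' _).2
    _ ≤ C * (D * (C * ‖v‖)) := by
        gcongr
        refine h1.trans ?_
        gcongr
        exact (hA.norm_frame_le c hc _ hx v).1
    _ = _ := by ring

end HyperbolicSet

namespace IsNetwork

variable {d : ℕ} {M : Type*} [EMetricSpace M] [ChartedSpace (EuclideanSpace ℝ (Fin d)) M]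
  [IsManifold (𝓡 d) ∞ M] [RiemannianBundle (fun x : M => TangentSpace (𝓡 d) x)]

variable {f : M ≃ₘ^1⟮𝓡 d, 𝓡 d⟯ M} {s n k q : ℕ} {p : Fin k → M} {C : ℝ} {δ : ℝ≥0∞} {σ : ℕ → ℕ}
    {c y : Fin k × ℕ → M} {t : Fin k × ℕ → ℕ}
    {Q : Fin k × ℕ → EuclideanSpace ℝ (Fin d) →L[ℝ] EuclideanSpace ℝ (Fin d)}
    {B : Fin k × ℕ → Fin k × ℕ → EuclideanSpace ℝ (Fin d) →L[ℝ] EuclideanSpace ℝ (Fin d)}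
    {g : Fin k × ℕ → ℝ} {ρ r : ℝ}
    (hN : IsNetwork f s n k q p (fun _ v => ‖v‖) C δ σ c y t Q B g ρ r)

include hN

/-- With the splitting defined by boundedness, invariance is automatic. Over the shadowing set the
spaces have dimension at least `s` and `d - s` and meet only in zero, so they are complementary;
invariance carries this, and the rates, to the whole hull. -/
theorem isHyperbolicSet [CompactSpace M]
    (hD : ∀ h : M ≃ₘ^1⟮𝓡 d, 𝓡 d⟯ M, ∃ D, ∀ x, ∀ v : TangentSpace (𝓡 d) x,
      derivNorm h x v ≤ D * ‖v‖) :
    IsHyperbolicSet f (shadowHull f.toHomeomorph n p δ) s := by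
  have hn : 0 < n := by
    have := hN.cut_lt_last hN.pos_q
    omega
  set φ := f.toHomeomorph with hφ
  set K := shadowHull φ n p δ with hK
  obtain ⟨C₂, hC₂, hest⟩ := hN.exists_tangent_estimates
  obtain ⟨R, hR1, hR⟩ := exists_forall_mem_finset_of_mono (Finset.Icc (-n : ℤ) n)
    (p := fun j D => ∀ x, ∀ v : TangentSpace (𝓡 d) x, derivNorm (φ ^ j) x v ≤ D * ‖v‖)
    (fun j D D' hDD h x v => (h x v).trans (by gcongr)) fun j _ => hD (zpowDiffeo f j)
  have hR0 : 0 ≤ R := by linarith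
  have hest1 : ∀ e : ℤ, e = 1 ∨ e = -1 → ∀ z, ∀ v : TangentSpace (𝓡 d) z,
      (∀ m : ℕ, derivNorm (φ ^ (e * (n * m) : ℤ)) z v ≤ C₂ * (1 / 2) ^ m * ‖v‖) →
      ∀ l < n, ∀ T : ℕ, ∃ m : ℕ, T ≤ n * (m + 1) ∧
        derivNorm (φ ^ (e * T + l : ℤ)) z v ≤ R * C₂ * (1 / 2) ^ m * ‖v‖ := by
    intro e he z v h l hl T
    obtain ⟨m, l', hl', h1, h2⟩ := exists_mul_add_lt hn he hl T
    refine ⟨m, h2, ?_⟩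
    rw [h1, derivNorm_zpow_add]
    calc _ ≤ R * derivNorm (φ ^ (e * (n * m) : ℤ)) z v :=
          hR l' (Finset.mem_Icc.2 (by omega)) _ _
      _ ≤ R * (C₂ * (1 / 2) ^ m * ‖v‖) := by gcongr; exact h m
      _ = _ := by ring
  have hsplit0 : ∀ z ∈ shadowSet φ n p δ,
      IsCompl (boundedSubspace f 1 z) (boundedSubspace f (-1) z) ∧
        Module.finrank ℝ (boundedSubspace f 1 z) = s := by
    intro z hz
    obtain ⟨h1, h2⟩ := hest z hz
    have hfd : FiniteDimensional ℝ (TangentSpace (𝓡 d) z) :=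
      inferInstanceAs (FiniteDimensional ℝ (EuclideanSpace ℝ (Fin d)))
    have hfin : Module.finrank ℝ (TangentSpace (𝓡 d) z) = d :=
      (finrank_euclideanSpace_fin (𝕜 := ℝ) (n := d))
    have hdim : ∀ e : ℤ, e = 1 ∨ e = -1 →
        (if e = 1 then s else d - s) ≤ Module.finrank ℝ (boundedSubspace f e z) := by
      intro e he
      obtain ⟨W, hW, hWb⟩ := (h1 e he).1
      rw [← hW]
      refine Submodule.finrank_mono fun v hv => ⟨R * C₂ * ‖v‖, fun T => ?_⟩
      obtain ⟨m, -, h3⟩ := hest1 e he z v (hWb v hv) 0 hn T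
      rw [Nat.cast_zero, add_zero] at h3
      refine h3.trans (mul_le_mul_of_nonneg_right (mul_le_of_le_one_right (by positivity) ?_)
        (norm_nonneg _))
      exact pow_le_one₀ (by norm_num) (by norm_num)
    have hdisj : Disjoint (boundedSubspace f 1 z) (boundedSubspace f (-1) z) := by
      rw [Submodule.disjoint_def]
      rintro v ⟨R₁, hR₁⟩ ⟨R₂, hR₂⟩
      refine h2 v ⟨max R₁ R₂, fun m => ?_⟩
      obtain ⟨l, rfl | rfl⟩ := m.eq_nat_or_neg
      · have := hR₁ l
        rw [one_mul] at this
        exact this.trans (le_max_left _ _)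
      · have := hR₂ l
        rw [neg_one_mul] at this
        exact this.trans (le_max_right _ _)
    have h3 := hdim 1 (Or.inl rfl)
    have h4 := hdim (-1) (Or.inr rfl)
    rw [if_pos rfl] at h3
    rw [if_neg (by norm_num)] at h4
    have h5 := Submodule.finrank_add_finrank_le_of_disjoint hdisj
    have h6 := Submodule.finrank_le (boundedSubspace f 1 z)
    rw [hfin] at h5 h6
    refine ⟨(Submodule.isCompl_iff_disjoint _ _ (by rw [hfin]; omega)).2 hdisj, by omega⟩
  have hlift : ∀ x ∈ K, ∃ l < n, ∃ z ∈ shadowSet φ n p δ, (φ ^ (l : ℤ)) z = x := by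
    intro x hx
    obtain ⟨l, hl, z, hz, rfl⟩ := mem_shadowHull.1 hx
    exact ⟨l, hl, z, hz, homeomorph_zpow_natCast φ l z⟩
  have hsplit : ∀ x ∈ K, IsCompl (boundedSubspace f 1 x) (boundedSubspace f (-1) x) ∧
      Module.finrank ℝ (boundedSubspace f 1 x) = s := by
    intro x hx
    obtain ⟨l, hl, z, hz, rfl⟩ := hlift x hx
    obtain ⟨h1, h2⟩ := hsplit0 z hz
    rw [← map_boundedSubspace f (Or.inl rfl), ← map_boundedSubspace f (Or.inr rfl)]
    refine ⟨(Submodule.orderIsoMapComap (tangentEquiv f l z)).isCompl h1, ?_⟩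
    rw [← h2]
    exact LinearEquiv.finrank_map_eq (tangentEquiv f l z) _
  -- The `n`-th root turns halving in `n` iterates into a rate per iterate; an incomplete period
  -- costs the factor `2` in `hmain`.
  set κ : ℝ := (1 / 2 : ℝ) ^ ((n : ℝ)⁻¹) with hκ
  have hκn : κ ^ n = 1 / 2 := Real.rpow_inv_natCast_pow (by norm_num) hn.ne'
  have hκ0 : 0 < κ := Real.rpow_pos_of_pos (by norm_num) _
  have hκ1 : κ < 1 := Real.rpow_lt_one (by norm_num) (by norm_num) (by positivity)
  have hmain : ∀ e : ℤ, e = 1 ∨ e = -1 → ∀ x ∈ K, ∀ v ∈ boundedSubspace f e x, ∀ T : ℕ,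
      derivNorm (φ ^ (e * T : ℤ)) x v ≤ 2 * R ^ 2 * C₂ * κ ^ T * ‖v‖ := by
    intro e he x hx v hv T
    obtain ⟨l, hl, z, hz, rfl⟩ := hlift x hx
    obtain ⟨u, rfl⟩ := (tangentEquiv f l z).surjective v
    set w : TangentSpace (𝓡 d) ((φ ^ (l : ℤ)) z) := tangentEquiv f l z u with hw
    have hw' : w = mfderiv (𝓡 d) (𝓡 d) (φ ^ (l : ℤ)) z u := rfl
    have hu : u ∈ boundedSubspace f e z := (mfderiv_mem_boundedSubspace_iff f he l z u).1 hv
    obtain ⟨m, hm, h1⟩ := hest1 e he z u (((hest z hz).1 e he).2 u hu) l hl T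
    have h2 : ‖u‖ ≤ R * ‖w‖ := by
      have h3 := hR (-l) (Finset.mem_Icc.2 (by omega)) _ w
      rw [hw', ← derivNorm_zpow_add, neg_add_cancel, derivNorm_zpow_zero] at h3
      exact h3
    have h4 : ((1 : ℝ) / 2) ^ m ≤ 2 * κ ^ T := by
      have h5 : κ ^ (n * (m + 1)) ≤ κ ^ T := pow_le_pow_of_le_one hκ0.le hκ1.le hm
      rw [pow_mul, hκn, pow_succ] at h5
      linarith
    have h6 : derivNorm (φ ^ (e * T : ℤ)) ((φ ^ (l : ℤ)) z) w =
        derivNorm (φ ^ (e * T + l : ℤ)) z u := by rw [derivNorm_zpow_add, hw']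
    rw [h6]
    calc _ ≤ R * C₂ * (1 / 2) ^ m * ‖u‖ := h1
      _ ≤ R * C₂ * (2 * κ ^ T) * (R * ‖w‖) := by gcongr
      _ = _ := by ring
  have hcoe : ∀ m : ℕ, f^[m] = ⇑(φ ^ (m : ℤ)) := fun m =>
    funext fun x => (homeomorph_zpow_natCast φ m x).symm
  have hKf : f '' K = K := image_shadowHull φ
  refine ⟨isCompact_shadowHull φ, hKf, boundedSubspace f 1, boundedSubspace f (-1), ?_,
    2 * R ^ 2 * C₂ + 1, by positivity, κ, hκ0, hκ1, fun x hx m => ⟨fun v hv => ?_, fun v hv => ?_⟩⟩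
  · exact ⟨fun x hx => (hsplit x hx).1, fun x hx => (hsplit x hx).2,
      fun x hx => map_mfderiv_boundedSubspace f (Or.inl rfl) x,
      fun x hx => map_mfderiv_boundedSubspace f (Or.inr rfl) x⟩
  · have h1 := hmain 1 (Or.inl rfl) x hx v hv m
    rw [one_mul, ← hcoe] at h1
    refine h1.trans ?_
    gcongr
    linarith
  · have hx' : (φ ^ (m : ℤ)) x ∈ K := by
      rw [homeomorph_zpow_natCast]
      exact MapsTo.iterate (s := K) (fun y hy => hKf ▸ mem_image_of_mem f hy) m hx
    have h1 := hmain (-1) (Or.inr rfl) _ hx' _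
      ((mfderiv_mem_boundedSubspace_iff f (Or.inr rfl) m x v).2 hv) m
    rw [← derivNorm_zpow_add, neg_one_mul, neg_add_cancel, derivNorm_zpow_zero] at h1
    show ‖v‖ ≤ _ * _ * derivNorm f^[m] x v
    rw [hcoe]
    refine h1.trans (mul_le_mul_of_nonneg_right ?_ (norm_nonneg _))
    gcongr
    linarith

end IsNetwork

/-- The periodic bi-infinite word with period `w`. -/
def periodicWord {k L : ℕ} (hL : 0 < L) (w : Fin L → Fin k) (m : ℤ) : Fin k :=
  w ⟨(m % L).toNat, by
    have h1 := Int.emod_nonneg m (b := L) (by omega)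
    have h2 := Int.emod_lt_of_pos m (b := L) (by omega)
    omega⟩

theorem periodicWord_add {k L : ℕ} (hL : 0 < L) (w : Fin L → Fin k) (m : ℤ) :
    periodicWord hL w (m + L) = periodicWord hL w m := by
  simp [periodicWord]

theorem periodicWord_natCast {k L : ℕ} (hL : 0 < L) (w : Fin L → Fin k) (j : Fin L) :
    periodicWord hL w (j : ℕ) = w j := by
  unfold periodicWord
  congr 1
  ext
  have : ((j : ℕ) : ℤ) % (L : ℕ) = (j : ℕ) :=
    Int.emod_eq_of_lt (by omega) (by exact_mod_cast j.2)
  simp only [this, Int.toNat_natCast]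

/-! ### Entropy from the periodic words -/

section Entropy

variable {X : Type*} [EMetricSpace X] {n k : ℕ} {p : Fin k → X} {δ : ℝ≥0∞}

/-- Words with different letters at `j` follow segments that are more than `3 * δ` apart at some
time `l`; subtracting the two shadowing errors leaves more than `δ`. Nets require disjoint dynamical
balls, hence the radius `δ / 2`. -/
theorem card_pow_le_netMaxcard {φ : X ≃ₜ X} (hn : 0 < n)
    (hsh : ∀ (a : ℤ → Fin k) (L : ℕ), 0 < L → (∀ m, a (m + L) = a m) →
      ∃ x, IsShadowed φ n p δ a x)
    (hsep : ∀ i j, i ≠ j → ∃ l < n, 3 * δ < edist (φ^[l] (p i)) (φ^[l] (p j)))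
    {L : ℕ} (hL : 0 < L) :
    ((k ^ L : ℕ) : ℕ∞) ≤ Dynamics.netMaxcard φ (shadowHull φ n p δ)
      {z : X × X | edist z.1 z.2 < δ / 2} (n * L) := by
  classical
  choose x hx using fun w : Fin L → Fin k =>
    hsh (periodicWord hL w) L hL (periodicWord_add hL w)
  have hdist : ∀ w w', w ≠ w' → ∃ T < n * L, δ < edist (φ^[T] (x w)) (φ^[T] (x w')) := by
    intro w w' hw
    obtain ⟨j, hj⟩ := Function.ne_iff.1 hw
    obtain ⟨l, hl, hl'⟩ := hsep _ _ hj
    refine ⟨n * j + l, ?_, ?_⟩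
    · have : n * ((j : ℕ) + 1) ≤ n * L := Nat.mul_le_mul_left n j.2
      rw [mul_add, mul_one] at this
      omega
    · have h1 := hx w (j : ℕ) l hl
      have h2 := hx w' (j : ℕ) l hl
      rw [periodicWord_natCast, show (n * ((j : ℕ) : ℤ) + l : ℤ) = (n * j + l : ℕ) by push_cast; ring,
        homeomorph_zpow_natCast] at h1 h2
      by_contra! h
      refine absurd hl' (not_lt.2 ?_)
      calc _ ≤ edist (φ^[l] (p (w j))) (φ^[n * j + l] (x w)) +
            edist (φ^[n * j + l] (x w)) (φ^[n * j + l] (x w')) +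
            edist (φ^[n * j + l] (x w')) (φ^[l] (p (w' j))) := edist_triangle4 _ _ _ _
        _ ≤ δ + δ + δ := by
            rw [edist_comm] at h1
            gcongr
        _ = 3 * δ := by ring
  have hinj : Function.Injective x := by
    intro w w' hw
    by_contra hne
    obtain ⟨T, -, hT⟩ := hdist w w' hne
    rw [hw, edist_self] at hT
    exact not_lt_bot hT
  have hnet : Dynamics.IsDynNetIn φ (shadowHull φ n p δ) {z : X × X | edist z.1 z.2 < δ / 2}
      (n * L) (Finset.univ.image x : Finset X) := by
    constructor
    · intro z hz
      simp only [Finset.coe_image, Finset.coe_univ, image_univ, mem_range] at hz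
      obtain ⟨w, rfl⟩ := hz
      exact shadowSet_subset_shadowHull hn φ ⟨_, hx w⟩
    · intro z hz z' hz' hne
      simp only [Finset.coe_image, Finset.coe_univ, image_univ, mem_range] at hz hz'
      obtain ⟨w, rfl⟩ := hz
      obtain ⟨w', rfl⟩ := hz'
      obtain ⟨T, hT, hT'⟩ := hdist w w' fun h => hne (by rw [h])
      rw [Function.onFun, Set.disjoint_left]
      intro u hu hu'
      rw [Dynamics.mem_ball_dynEntourage] at hu hu'
      have h1 : edist (φ^[T] (x w)) (φ^[T] u) < δ / 2 := hu T hT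
      have h2 : edist (φ^[T] (x w')) (φ^[T] u) < δ / 2 := hu' T hT
      refine absurd hT' (not_lt.2 ?_)
      rw [edist_comm] at h2
      calc _ ≤ _ := edist_triangle _ (φ^[T] u) _
        _ ≤ δ / 2 + δ / 2 := add_le_add h1.le h2.le
        _ = δ := ENNReal.add_halves δ
  have hcard : (Finset.univ.image x).card = k ^ L := by
    rw [Finset.card_image_of_injective _ hinj]
    simp
  rw [← hcard]
  exact hnet.card_le_netMaxcard

/-- The entropy is an upper growth rate, so it is enough to count at the times `n * (N + 1)`, where
there are at least `k ^ (N + 1)` orbits. -/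
theorem log_div_le_coverEntropy {φ : X ≃ₜ X} (hn : 0 < n) (hk : 0 < k)
    (hsh : ∀ (a : ℤ → Fin k) (L : ℕ), 0 < L → (∀ m, a (m + L) = a m) →
      ∃ x, IsShadowed φ n p δ a x)
    (hsep : ∀ i j, i ≠ j → ∃ l < n, 3 * δ < edist (φ^[l] (p i)) (φ^[l] (p j)))
    (hδ0 : 0 < δ) :
    ((Real.log k / n : ℝ) : EReal) ≤ Dynamics.coverEntropy φ (shadowHull φ n p δ) := by
  have hU : {z : X × X | edist z.1 z.2 < δ / 2} ∈ uniformity X :=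
    edist_mem_uniformity (ENNReal.half_pos hδ0.ne')
  rw [Dynamics.coverEntropy_eq_iSup_netEntropyEntourage]
  refine le_trans ?_ (le_iSup₂ {z : X × X | edist z.1 z.2 < δ / 2} hU)
  refine Frequently.le_expGrowthSup ?_
  rw [Filter.frequently_atTop]
  intro N
  refine ⟨n * (N + 1), ?_, ?_⟩
  · have := Nat.le_mul_of_pos_left (N + 1) hn
    show N ≤ n * (N + 1)
    omega
  · have h1 := card_pow_le_netMaxcard hn hsh hsep (L := N + 1) N.succ_pos
    have h2 := ENat.toENNReal_mono h1
    refine le_trans (le_of_eq ?_) h2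
    have h3 : ((Real.log k / n : ℝ) : EReal) * ((n * (N + 1) : ℕ) : EReal) =
        ((Real.log (k ^ (N + 1)) : ℝ) : EReal) := by
      rw [← EReal.coe_natCast, ← EReal.coe_mul]
      congr 1
      rw [Real.log_pow]
      push_cast
      field_simp
    rw [h3, EReal.exp_coe, Real.exp_log (by positivity)]
    rw [ENNReal.ofReal_pow (by positivity), ENNReal.ofReal_natCast]
    simp

end Entropy

open MeasureTheory

/-! ### Periodic measures as averages over any period -/

section PeriodicMeasures

variable {X : Type*} [MeasurableSpace X]

theorem sum_range_mul_of_periodic {u : ℕ → ℝ} {N : ℕ} (hu : ∀ j, u (j + N) = u j) (m : ℕ) :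
    ∑ j ∈ Finset.range (N * m), u j = m * ∑ j ∈ Finset.range N, u j := by
  have h : ∀ m j, u (N * m + j) = u j := by
    intro m j
    induction m with
    | zero => simp
    | succ m ih => rw [show N * (m + 1) + j = (N * m + j) + N by ring, hu, ih]
  induction m with
  | zero => simp
  | succ m ih =>
    rw [mul_add, mul_one, Finset.sum_range_add, ih, Finset.sum_congr rfl fun j _ => h m j]
    push_cast
    ring

/-- Since `n` is a multiple of the minimal period, all the `p i` can be averaged over the same time.
-/
theorem integral_periodicMeasure {f : X → X} {n : ℕ} (hn : 0 < n) {p : X}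
    (hp : Function.IsPeriodicPt f n p) {ψ : X → ℝ} (hψ : StronglyMeasurable ψ) :
    ∫ x, ψ x ∂periodicMeasure f p = (∑ l ∈ Finset.range n, ψ (f^[l] p)) / n := by
  set N := Function.minimalPeriod f p with hN
  have hN0 : 0 < N := hp.minimalPeriod_pos hn
  obtain ⟨m, rfl⟩ := hp.minimalPeriod_dvd
  rw [← hN] at hn ⊢
  have hm : 0 < m := Nat.pos_of_mul_pos_left hn
  rw [sum_range_mul_of_periodic (u := fun l => ψ (f^[l] p)) (N := N) (fun j => by
    simp only [Function.iterate_add_apply, hN, Function.iterate_minimalPeriod]) m]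
  rw [periodicMeasure, ← hN, integral_smul_measure, integral_finsetSum_measure fun i _ =>
    integrable_dirac' hψ (by simp)]
  rw [Finset.sum_congr rfl fun i _ => integral_dirac' ψ _ hψ]
  push_cast
  simp only [ENNReal.toReal_inv, ENNReal.toReal_natCast, smul_eq_mul]
  have : (N : ℝ) ≠ 0 := by positivity
  have : (m : ℝ) ≠ 0 := by positivity
  field_simp

instance isProbabilityMeasure_periodicMeasure {f : X → X} {p : X}
    [h : Fact (p ∈ Function.periodicPts f)] : IsProbabilityMeasure (periodicMeasure f p) := by
  have h1 := Function.minimalPeriod_pos_of_mem_periodicPts h.out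
  refine ⟨?_⟩
  simp only [periodicMeasure, Measure.smul_apply, Measure.finsetSum_apply, measure_univ,
    Finset.sum_const, Finset.card_range, smul_eq_mul, nsmul_eq_mul, mul_one]
  exact ENNReal.inv_mul_cancel (by simpa using h1.ne') (by simp)

end PeriodicMeasures

/-! ### Decomposition of the invariant measures on the hull -/

section ShadowMeasures

variable {X : Type*} [EMetricSpace X] [CompactSpace X] [MeasurableSpace X] [BorelSpace X]
  {n k : ℕ} {p : Fin k → X} {δ : ℝ≥0∞}

/-- The number of the phases `l < n` for which `x` belongs to the image of the shadowing set
under the `l`-th iterate. -/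
def phaseCount (φ : X ≃ₜ X) (n : ℕ) (p : Fin k → X) (δ : ℝ≥0∞) (x : X) : ℝ :=
  ∑ l ∈ Finset.range n, (φ^[l] '' shadowSet φ n p δ).indicator 1 x

omit [CompactSpace X] [MeasurableSpace X] [BorelSpace X] in
theorem image_iterate_shadowSet_self (φ : X ≃ₜ X) :
    φ^[n] '' shadowSet φ n p δ = shadowSet φ n p δ := by
  ext x
  constructor
  · rintro ⟨z, hz, rfl⟩
    have := shadowSet_zpow hz 1
    rwa [mul_one, homeomorph_zpow_natCast] at this
  · intro hx
    refine ⟨_, shadowSet_zpow hx (-1), ?_⟩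
    rw [← homeomorph_zpow_natCast, ← homeomorph_zpow_add_apply,
      show (n : ℤ) + n * (-1) = 0 by ring]
    rfl

omit [CompactSpace X] [MeasurableSpace X] [BorelSpace X] in
theorem indicator_image_iterate (φ : X ≃ₜ X) (S : Set X) (l j : ℕ) (x : X) :
    (φ^[l + j] '' S).indicator (1 : X → ℝ) (φ^[j] x) = (φ^[l] '' S).indicator 1 x := by
  have h : φ^[j] x ∈ φ^[l + j] '' S ↔ x ∈ φ^[l] '' S := by
    rw [add_comm, Function.iterate_add, image_comp]
    exact (φ.injective.iterate j).mem_set_image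
  by_cases hx : x ∈ φ^[l] '' S
  · rw [indicator_of_mem hx, indicator_of_mem (h.2 hx)]
    rfl
  · rw [indicator_of_notMem hx, indicator_of_notMem (mt h.1 hx)]

omit [CompactSpace X] [MeasurableSpace X] [BorelSpace X] in
-- The map permutes the `n` phases cyclically, because its `n`-th power preserves the shadowing set.
-- The sets of different phases may overlap; dividing by this invariant count corrects the
-- overcounting.
theorem phaseCount_apply (φ : X ≃ₜ X) (x : X) :
    phaseCount φ n p δ (φ x) = phaseCount φ n p δ x := by
  set F : ℕ → ℝ := fun l => (φ^[l] '' shadowSet φ n p δ).indicator 1 (φ x) with hF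
  have h0 : F 0 = F n := by
    simp only [hF, image_iterate_shadowSet_self]
    simp
  have h1 := Finset.sum_range_succ F n
  have h2 := Finset.sum_range_succ' F n
  have h3 : ∀ l, F (l + 1) = (φ^[l] '' shadowSet φ n p δ).indicator 1 x :=
    fun l => indicator_image_iterate φ _ l 1 x
  simp only [h3] at h2
  show ∑ l ∈ Finset.range n, F l = _
  unfold phaseCount
  linarith

omit [CompactSpace X] [MeasurableSpace X] [BorelSpace X] in
theorem phaseCount_iterate (φ : X ≃ₜ X) (l : ℕ) (x : X) :
    phaseCount φ n p δ (φ^[l] x) = phaseCount φ n p δ x := by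
  induction l with
  | zero => rfl
  | succ l ih => rw [Function.iterate_succ_apply', phaseCount_apply, ih]

omit [CompactSpace X] [MeasurableSpace X] [BorelSpace X] in
theorem one_le_phaseCount {φ : X ≃ₜ X} {x : X} (hx : x ∈ shadowHull φ n p δ) :
    1 ≤ phaseCount φ n p δ x := by
  obtain ⟨l, hl, z, hz, rfl⟩ := mem_shadowHull.1 hx
  have h1 := Finset.single_le_sum
    (f := fun j => (φ^[j] '' shadowSet φ n p δ).indicator (1 : X → ℝ) (φ^[l] z))
    (fun j _ => indicator_nonneg (fun _ _ => zero_le_one) _) (Finset.mem_range.2 hl)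
  rw [indicator_of_mem (mem_image_of_mem _ hz)] at h1
  exact h1

theorem measurable_phaseCount (φ : X ≃ₜ X) : Measurable (phaseCount φ n p δ) :=
  Finset.measurable_sum _ fun l _ => measurable_one.indicator
    ((isCompact_shadowSet φ).image (φ.continuous.iterate l)).measurableSet

/-- The points of the shadowing set whose orbit follows the orbit of `p i` for the time `n`. -/
def shadowCylinder (φ : X ≃ₜ X) (n : ℕ) (p : Fin k → X) (δ : ℝ≥0∞) (i : Fin k) : Set X :=
  shadowSet φ n p δ ∩ {x | ∀ l < n, edist (φ^[l] x) (φ^[l] (p i)) ≤ δ}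

theorem measurableSet_shadowCylinder (φ : X ≃ₜ X) (i : Fin k) :
    MeasurableSet (shadowCylinder φ n p δ i) := by
  refine (isCompact_shadowSet φ).measurableSet.inter (IsClosed.measurableSet ?_)
  simp only [ofPred_forall]
  exact isClosed_iInter fun l => isClosed_iInter fun _ =>
    isClosed_le ((φ.continuous.iterate l).edist continuous_const) continuous_const

omit [CompactSpace X] [MeasurableSpace X] [BorelSpace X] in
-- A point in two cylinders would bring two segments within `2 * δ` of each other, against their
-- separation, so the cylinders partition the shadowing set.
theorem indicator_shadowSet (φ : X ≃ₜ X)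
    (hsep : ∀ i j, i ≠ j → ∃ l < n, 3 * δ < edist (φ^[l] (p i)) (φ^[l] (p j))) (x : X) :
    (shadowSet φ n p δ).indicator (1 : X → ℝ) x =
      ∑ i, (shadowCylinder φ n p δ i).indicator 1 x := by
  by_cases hx : x ∈ shadowSet φ n p δ
  · obtain ⟨a, ha⟩ := hx
    have h1 : ∀ l < n, edist (φ^[l] x) (φ^[l] (p (a 0))) ≤ δ := fun l hl => by
      have := ha 0 l hl
      rwa [mul_zero, zero_add, homeomorph_zpow_natCast] at this
    have hx : x ∈ shadowSet φ n p δ := ⟨a, ha⟩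
    have hmem : x ∈ shadowCylinder φ n p δ (a 0) := ⟨hx, h1⟩
    rw [indicator_of_mem hx, Finset.sum_eq_single (a 0), indicator_of_mem hmem]
    · intro i _ hi
      refine indicator_of_notMem (fun hxi => ?_) _
      obtain ⟨l, hl, h⟩ := hsep i (a 0) hi
      refine absurd h (not_lt.2 ?_)
      have h2 := hxi.2 l hl
      rw [edist_comm] at h2
      calc _ ≤ _ := edist_triangle _ (φ^[l] x) _
        _ ≤ δ + δ := add_le_add h2 (h1 l hl)
        _ ≤ 3 * δ := by
            rw [← two_mul]
            gcongr
            norm_num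
    · simp
  · rw [indicator_of_notMem hx]
    exact (Finset.sum_eq_zero fun i _ => indicator_of_notMem (fun h => hx h.1) _).symm

/-- The weight of the orbit segment of `p i` at `x`. -/
def cylinderWeight (φ : X ≃ₜ X) (n : ℕ) (p : Fin k → X) (δ : ℝ≥0∞) (i : Fin k) (x : X) : ℝ :=
  (shadowCylinder φ n p δ i).indicator 1 x / phaseCount φ n p δ x

omit [CompactSpace X] [MeasurableSpace X] [BorelSpace X] in
theorem cylinderWeight_nonneg (φ : X ≃ₜ X) (i : Fin k) (x : X) :
    0 ≤ cylinderWeight φ n p δ i x :=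
  div_nonneg (indicator_nonneg (fun _ _ => zero_le_one) _)
    (Finset.sum_nonneg fun _ _ => indicator_nonneg (fun _ _ => zero_le_one) _)

omit [CompactSpace X] [MeasurableSpace X] [BorelSpace X] in
theorem cylinderWeight_le_one (hn : 0 < n) (φ : X ≃ₜ X) (i : Fin k) (x : X) :
    cylinderWeight φ n p δ i x ≤ 1 := by
  unfold cylinderWeight
  by_cases hx : x ∈ shadowCylinder φ n p δ i
  · rw [indicator_of_mem hx]
    exact div_le_one_of_le₀ (one_le_phaseCount (shadowSet_subset_shadowHull hn φ hx.1))
      (Finset.sum_nonneg fun _ _ => indicator_nonneg (fun _ _ => zero_le_one) _)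
  · rw [indicator_of_notMem hx, zero_div]
    exact zero_le_one

theorem measurable_cylinderWeight (φ : X ≃ₜ X) (i : Fin k) :
    Measurable (cylinderWeight φ n p δ i) :=
  (measurable_one.indicator (measurableSet_shadowCylinder φ i)).div (measurable_phaseCount φ)

theorem integrable_cylinderWeight_mul (hn : 0 < n) (φ : X ≃ₜ X) (i : Fin k) (ν : Measure X)
    [IsProbabilityMeasure ν] {ψ : X → ℝ} (hψ : Continuous ψ) :
    Integrable (fun x => cylinderWeight φ n p δ i x * ψ x) ν := by
  obtain ⟨C, hC⟩ := isCompact_univ.exists_bound_of_continuousOn hψ.continuousOn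
  refine Integrable.of_bound
    ((measurable_cylinderWeight φ i).mul hψ.measurable).aestronglyMeasurable C
    (Eventually.of_forall fun x => ?_)
  rw [norm_mul, Real.norm_of_nonneg (cylinderWeight_nonneg φ i x)]
  exact (mul_le_of_le_one_left (norm_nonneg _) (cylinderWeight_le_one hn φ i x)).trans
    (hC x (mem_univ x))

/-- On the hull the normalised phase indicators sum to `1`. Invariance of `ν` and of the count pulls
the phase `l` back to the shadowing set, where the cylinders separate the segments. -/
theorem integral_eq_sum_cylinderWeight (hn : 0 < n) {φ : X ≃ₜ X}
    (hsep : ∀ i j, i ≠ j → ∃ l < n, 3 * δ < edist (φ^[l] (p i)) (φ^[l] (p j)))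
    {ν : Measure X} [IsProbabilityMeasure ν] (hν : MeasurePreserving φ ν ν)
    (hνK : ν (shadowHull φ n p δ) = 1) {ψ : X → ℝ} (hψ : Continuous ψ) :
    ∫ x, ψ x ∂ν = ∑ l ∈ Finset.range n, ∑ i, ∫ x, cylinderWeight φ n p δ i x * ψ (φ^[l] x) ∂ν := by
  have hK : ∀ᵐ x ∂ν, x ∈ shadowHull φ n p δ :=
    (mem_ae_iff_prob_eq_one (isCompact_shadowHull φ).measurableSet).2 hνK
  have hψl : ∀ l, Continuous fun x => ψ (φ^[l] x) := fun l => hψ.comp (φ.continuous.iterate l)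
  let G : ℕ → X → ℝ := fun l x =>
    (φ^[l] '' shadowSet φ n p δ).indicator 1 x / phaseCount φ n p δ x * ψ x
  have hG : ∀ l x, G l (φ^[l] x) = ∑ i, cylinderWeight φ n p δ i x * ψ (φ^[l] x) := by
    intro l x
    have h1 := indicator_image_iterate φ (shadowSet φ n p δ) 0 l x
    rw [zero_add, Function.iterate_zero, image_id] at h1
    simp only [G, cylinderWeight]
    rw [phaseCount_iterate, h1, indicator_shadowSet φ hsep, ← Finset.sum_mul, Finset.sum_div]
  have hGs : ∀ l, ∫ x, G l x ∂ν = ∑ i, ∫ x, cylinderWeight φ n p δ i x * ψ (φ^[l] x) ∂ν := by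
    intro l
    have h1 := (hν.iterate l).integral_comp
      (by
        have := (φ ^ l).measurableEmbedding
        rwa [show ⇑(φ ^ l) = φ^[l] from funext (homeomorph_pow_apply φ l)] at this) (G l)
    rw [← h1]
    simp only [hG]
    exact integral_finsetSum _ fun i _ => integrable_cylinderWeight_mul hn φ i ν (hψl l)
  rw [← Finset.sum_congr rfl fun l _ => hGs l, ← integral_finsetSum]
  · refine integral_congr_ae ?_
    filter_upwards [hK] with x hx
    have h1 := one_le_phaseCount hx
    simp only [G]
    rw [← Finset.sum_mul, ← Finset.sum_div]
    show _ = phaseCount φ n p δ x / phaseCount φ n p δ x * ψ x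
    rw [div_self (by linarith), one_mul]
  · intro l _
    have h1 : Integrable (fun x => G l (φ^[l] x)) ν := by
      simp only [hG]
      exact integrable_finsetSum _ fun i _ => integrable_cylinderWeight_mul hn φ i ν (hψl l)
    refine ((hν.iterate l).integrable_comp ?_).1 h1
    exact ((measurable_one.indicator ((isCompact_shadowSet φ).image
      (φ.continuous.iterate l)).measurableSet).div (measurable_phaseCount φ)).mul
        hψ.measurable |>.aestronglyMeasurable

/-- Invariant measures on the shadowing hull are close to convex combinations of the uniform
measures on the orbit segments of the `p i`. -/
theorem exists_convex_combination (hn : 0 < n) {φ : X ≃ₜ X}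
    (hsep : ∀ i j, i ≠ j → ∃ l < n, 3 * δ < edist (φ^[l] (p i)) (φ^[l] (p j)))
    {ν : Measure X} [IsProbabilityMeasure ν] (hν : MeasurePreserving φ ν ν)
    (hνK : ν (shadowHull φ n p δ) = 1) :
    ∃ α : Fin k → ℝ≥0, ∑ i, α i = 1 ∧ ∀ ψ : X → ℝ, Continuous ψ → ∀ ε : ℝ,
      (∀ x y, edist x y ≤ δ → |ψ x - ψ y| ≤ ε) →
      |∫ x, ψ x ∂ν - ∑ i, α i * ((∑ l ∈ Finset.range n, ψ (φ^[l] (p i))) / n)| ≤ ε := by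
  set β : Fin k → ℝ := fun i => ∫ x, cylinderWeight φ n p δ i x ∂ν with hβ
  have hβ0 : ∀ i, 0 ≤ β i := fun i => integral_nonneg fun x => cylinderWeight_nonneg φ i x
  have hn' : (0 : ℝ) < n := by exact_mod_cast hn
  have hsum : n * ∑ i, β i = 1 := by
    have h1 := integral_eq_sum_cylinderWeight hn hsep hν hνK (ψ := fun _ => 1) continuous_const
    simpa [hβ] using h1.symm
  have hcoe : ∀ i, ((n * β i).toNNReal : ℝ) = n * β i := fun i =>
    Real.coe_toNNReal _ (mul_nonneg hn'.le (hβ0 i))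
  -- Each segment is traversed in `n` phases of the same mass `β i`, so `n * β i` is the mass of its
  -- orbit pieces; the case `ψ = 1` shows that these masses sum to `1`.
  refine ⟨fun i => (n * β i).toNNReal, ?_, fun ψ hψ ε hε => ?_⟩
  · rw [← NNReal.coe_inj, NNReal.coe_sum, NNReal.coe_one, ← hsum, Finset.mul_sum]
    exact Finset.sum_congr rfl fun i _ => hcoe i
  · have hψl : ∀ l, Continuous fun x => ψ (φ^[l] x) := fun l => hψ.comp (φ.continuous.iterate l)
    have h1 : ∑ i, n * β i * ((∑ l ∈ Finset.range n, ψ (φ^[l] (p i))) / n) =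
        ∑ l ∈ Finset.range n, ∑ i, ∫ x, cylinderWeight φ n p δ i x * ψ (φ^[l] (p i)) ∂ν := by
      rw [Finset.sum_comm]
      refine Finset.sum_congr rfl fun i _ => ?_
      simp only [integral_mul_const]
      rw [← Finset.mul_sum]
      simp only [hβ]
      field_simp
    simp only [hcoe]
    rw [h1, integral_eq_sum_cylinderWeight hn hsep hν hνK hψ, ← Finset.sum_sub_distrib]
    simp only [← Finset.sum_sub_distrib]
    calc _ ≤ ∑ l ∈ Finset.range n, ∑ i, ε * β i := by
          refine (Finset.abs_sum_le_sum_abs _ _).trans (Finset.sum_le_sum fun l hl => ?_)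
          refine (Finset.abs_sum_le_sum_abs _ _).trans (Finset.sum_le_sum fun i _ => ?_)
          rw [← integral_sub (integrable_cylinderWeight_mul hn φ i ν (hψl l))
            (integrable_cylinderWeight_mul hn φ i ν continuous_const)]
          rw [← Real.norm_eq_abs, hβ, ← integral_const_mul]
          refine norm_integral_le_of_norm_le ?_ (Eventually.of_forall fun x => ?_)
          · simpa [mul_comm] using
              integrable_cylinderWeight_mul hn φ i ν (ψ := fun _ => ε) continuous_const
          · rw [← mul_sub, norm_mul, Real.norm_of_nonneg (cylinderWeight_nonneg φ i x), mul_comm]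
            by_cases hx : x ∈ shadowCylinder φ n p δ i
            · refine mul_le_mul_of_nonneg_right ?_ (cylinderWeight_nonneg φ i x)
              exact hε _ _ (hx.2 l (Finset.mem_range.1 hl))
            · simp [cylinderWeight, hx]
      _ = ε * (n * ∑ i, β i) := by
          rw [Finset.sum_const, Finset.card_range, nsmul_eq_mul, ← Finset.mul_sum]
          ring
      _ = ε := by rw [hsum, mul_one]

end ShadowMeasures

/-! ### Closeness in the weak distance -/

section WeakDist

variable {X : Type*} [EMetricSpace X] [CompactSpace X] [MeasurableSpace X] [BorelSpace X]

omit [BorelSpace X] in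
-- The first `N` terms add up to at most `ε / 4`. In the tail the integrals differ by at most `2 *
-- ‖φ m‖`, so it is at most `2 * (1 / 2) ^ N < ε / 2`.
theorem exists_weakDist_lt (φ : ℕ → C(X, ℝ)) {ε : ℝ} (hε : 0 < ε) :
    ∃ N : ℕ, ∀ μ ν : Measure X, IsProbabilityMeasure μ → IsProbabilityMeasure ν →
      (∀ m < N, |∫ x, φ m x ∂μ - ∫ x, φ m x ∂ν| ≤ ε / 4 * ‖φ m‖) → weakDist φ μ ν < ε := by
  obtain ⟨N, hN⟩ := exists_pow_lt_of_lt_one (show (0 : ℝ) < ε / 4 by positivity)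
    (show (1 / 2 : ℝ) < 1 by norm_num)
  refine ⟨N, fun μ ν _ _ h => ?_⟩
  set u : ℕ → ℝ := fun m => |∫ x, φ m x ∂μ - ∫ x, φ m x ∂ν| / (2 ^ (m + 1) * ‖φ m‖) with hu
  have hu0 : ∀ m, 0 ≤ u m := fun m => by positivity
  have hle : ∀ m c, |∫ x, φ m x ∂μ - ∫ x, φ m x ∂ν| ≤ c * ‖φ m‖ → 0 ≤ c →
      u m ≤ c / 2 * (1 / 2) ^ m := by
    intro m c hc hc0
    have h2 : (c / 2 * (1 / 2) ^ m : ℝ) = c / 2 ^ (m + 1) := by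
      rw [pow_succ, one_div, inv_pow]
      field_simp
    rw [h2]
    rcases (norm_nonneg (φ m)).eq_or_lt with h0 | h0
    · simp only [hu, ← h0, mul_zero, div_zero]
      positivity
    · simp only [hu]
      rw [div_le_div_iff₀ (by positivity) (by positivity)]
      calc _ ≤ c * ‖φ m‖ * 2 ^ (m + 1) := by gcongr
        _ = _ := by ring
  have hnorm : ∀ (m : ℕ) (η : Measure X), IsProbabilityMeasure η → |∫ x, φ m x ∂η| ≤ ‖φ m‖ := by
    intro m η _
    have := norm_integral_le_of_norm_le_const (μ := η) (f := φ m) (C := ‖φ m‖)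
      (Eventually.of_forall fun x => (φ m).norm_coe_le_norm x)
    simpa using this
  have h2 : ∀ m, u m ≤ (1 / 2) ^ m := fun m => by
    have := hle m 2 ((abs_sub _ _).trans (by
      linarith [hnorm m μ inferInstance, hnorm m ν inferInstance])) zero_le_two
    simpa using this
  have hgeo : Summable fun m : ℕ => (1 / 2 : ℝ) ^ m := summable_geometric_two
  have hsum : Summable u := Summable.of_nonneg_of_le hu0 h2 hgeo
  have h3 : ∑ m ∈ Finset.range N, u m ≤ ε / 4 := by
    calc ∑ m ∈ Finset.range N, u m ≤ ∑ m ∈ Finset.range N, ε / 4 / 2 * (1 / 2) ^ m :=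
          Finset.sum_le_sum fun m hm => hle m (ε / 4) (h m (Finset.mem_range.1 hm)) (by positivity)
      _ = ε / 4 / 2 * ∑ m ∈ Finset.range N, (1 / 2) ^ m := by rw [Finset.mul_sum]
      _ ≤ ε / 4 / 2 * 2 := by
          gcongr
          exact (hgeo.sum_le_tsum _ fun m _ => by positivity).trans tsum_geometric_two.le
      _ = ε / 4 := by ring
  have h4 : ∑' m, u (m + N) ≤ 2 * (1 / 2) ^ N := by
    calc ∑' m, u (m + N) ≤ ∑' m : ℕ, (1 / 2 : ℝ) ^ m * (1 / 2) ^ N :=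
          Summable.tsum_le_tsum (fun m => by rw [← pow_add]; exact h2 _)
            ((summable_nat_add_iff N).2 hsum) (hgeo.mul_right _)
      _ = _ := by rw [tsum_mul_right, tsum_geometric_two]
  have h5 := hsum.sum_add_tsum_nat_add N
  show ∑' m, u m < ε
  rw [← h5]
  linarith

omit [MeasurableSpace X] [BorelSpace X] in
theorem exists_modulus (φ : ℕ → C(X, ℝ)) {ε : ℝ} (hε : 0 < ε) (N : ℕ) :
    ∃ δ > (0 : ℝ≥0∞), ∀ m < N, ∀ x y, edist x y ≤ δ → |φ m x - φ m y| ≤ ε * ‖φ m‖ := by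
  obtain ⟨δ, hδ, h⟩ : ∃ δ > (0 : ℝ≥0∞), ∀ m ∈ Finset.range N, ∀ x y, edist x y ≤ δ →
      |φ m x - φ m y| ≤ ε * ‖φ m‖ := by
    refine exists_pos_forall_mem_finset ⟨1, one_pos⟩ _
      (fun m a b hab h x y hxy => h x y (hxy.trans hab)) fun m _ => ?_
    rcases (norm_nonneg (φ m)).eq_or_lt with h0 | h0
    · have h1 : φ m = 0 := norm_eq_zero.1 h0.symm
      exact ⟨1, one_pos, fun x y _ => by simp [h1]⟩
    · obtain ⟨η, hη, h⟩ := EMetric.uniformContinuous_iff.1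
        (CompactSpace.uniformContinuous_of_continuous (φ m).continuous)
        (ENNReal.ofReal (ε * ‖φ m‖)) (by rw [gt_iff_lt, ENNReal.ofReal_pos]; positivity)
      obtain ⟨η', hη', hη''⟩ := exists_between hη
      refine ⟨η', hη', fun x y hxy => ?_⟩
      have h1 := h (hxy.trans_lt hη'')
      rw [edist_dist, ENNReal.ofReal_lt_ofReal_iff (by positivity), Real.dist_eq] at h1
      exact h1.le
  exact ⟨δ, hδ, fun m hm => h m (Finset.mem_range.2 hm)⟩

/-- The invariant measures on the shadowing hull are close to the convex hull of the periodic
measures of the `p i`. -/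
theorem exists_mem_periodicHull {φ : X ≃ₜ X} {n k : ℕ} (hn : 0 < n) {p : Fin k → X} {δ : ℝ≥0∞}
    (hper : ∀ i, Function.IsPeriodicPt φ n (p i))
    (hsep : ∀ i j, i ≠ j → ∃ l < n, 3 * δ < edist (φ^[l] (p i)) (φ^[l] (p j)))
    {ν : Measure X} (hν : ν ∈ invariantMeasuresOn φ (shadowHull φ n p δ)) :
    ∃ μ ∈ periodicHull φ p, IsProbabilityMeasure μ ∧ ∀ ψ : C(X, ℝ), ∀ ε : ℝ,
      (∀ x y, edist x y ≤ δ → |ψ x - ψ y| ≤ ε) → |∫ x, ψ x ∂ν - ∫ x, ψ x ∂μ| ≤ ε := by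
  obtain ⟨hνp, hνi, hνK⟩ := hν
  obtain ⟨α, hα, h⟩ := exists_convex_combination hn hsep hνi hνK
  have hfact : ∀ i, IsProbabilityMeasure (periodicMeasure φ (p i)) := fun i => by
    have : Fact (p i ∈ Function.periodicPts φ) := ⟨⟨n, hn, hper i⟩⟩
    infer_instance
  refine ⟨_, ⟨α, hα, rfl⟩, ⟨?_⟩, fun ψ ε hε => ?_⟩
  · simp only [Measure.finsetSum_apply, Measure.smul_apply, measure_univ]
    simp only [ENNReal.smul_def, smul_eq_mul, mul_one]
    exact_mod_cast hα
  · have h1 := h ψ ψ.continuous ε hε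
    have h2 : ∀ i, Integrable ψ (periodicMeasure φ (p i)) := fun i =>
      ψ.continuous.integrable_of_hasCompactSupport (HasCompactSupport.of_compactSpace ψ)
    rw [integral_finsetSum_measure fun i _ => (h2 i).smul_measure_nnreal]
    simp only [integral_smul_nnreal_measure]
    rw [Finset.sum_congr rfl fun i _ => by
      rw [integral_periodicMeasure hn (hper i) ψ.continuous.stronglyMeasurable]]
    exact h1

end WeakDist

/-! ### Dominated data and Pesin bounds at periodic points -/

section Data

variable {d : ℕ} {M : Type*} [EMetricSpace M] [ChartedSpace (EuclideanSpace ℝ (Fin d)) M]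
  [IsManifold (𝓡 d) ∞ M] {f : M ≃ₘ^1⟮𝓡 d, 𝓡 d⟯ M} {Λ : Set M}
  {E F : (x : M) → Submodule ℝ (TangentSpace (𝓡 d) x)} {s : ℕ}

omit [IsManifold (𝓡 d) ∞ M] in
theorem derivNormOn_nonneg [RiemannianBundle (fun x : M => TangentSpace (𝓡 d) x)]
    (f : M → M) (E : (x : M) → Submodule ℝ (TangentSpace (𝓡 d) x)) (x : M) :
    0 ≤ derivNormOn f E x :=
  ContinuousLinearMap.opNorm_nonneg _

omit [IsManifold (𝓡 d) ∞ M] in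
theorem mfderiv_symm_mfderiv (f : M ≃ₘ^1⟮𝓡 d, 𝓡 d⟯ M) (x : M) (v : TangentSpace (𝓡 d) x) :
    mfderiv (𝓡 d) (𝓡 d) f.symm (f x) (mfderiv (𝓡 d) (𝓡 d) f x v) = v := by
  have h1 := mfderiv_comp x (f.symm.mdifferentiable one_ne_zero (f x))
    (f.mdifferentiable one_ne_zero x)
  have h2 : (f.symm : M → M) ∘ f = id := funext f.symm_apply_apply
  rw [h2, mfderiv_id] at h1
  exact (congrArg (fun L => L v) h1).symm

omit [IsManifold (𝓡 d) ∞ M] in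
theorem norm_le_derivNormOn_symm [RiemannianBundle (fun x : M => TangentSpace (𝓡 d) x)]
    {x : M} {v : TangentSpace (𝓡 d) x} (hv : mfderiv (𝓡 d) (𝓡 d) f x v ∈ F (f x)) :
    ‖v‖ ≤ derivNormOn f.symm F (f x) * ‖mfderiv (𝓡 d) (𝓡 d) f x v‖ := by
  have h1 := derivNormOn_le f.symm F (f x) hv
  -- The inverse derivative lands in the tangent space at `f.symm (f x)`, which has to be
  -- transported to `x` before the norms can be compared.
  have h2 : ∀ y, y = x → ∀ w : TangentSpace (𝓡 d) y, (w : EuclideanSpace ℝ (Fin d)) = v →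
      ‖w‖ = ‖v‖ := by
    rintro _ rfl w rfl
    rfl
  rwa [h2 _ (f.symm_apply_apply x) _ (mfderiv_symm_mfderiv f x v)] at h1

theorem isLocallyBounded_norm [RiemannianBundle (fun x : M => TangentSpace (𝓡 d) x)]
    [IsContinuousRiemannianBundle (EuclideanSpace ℝ (Fin d))
      (fun x : M => TangentSpace (𝓡 d) x)] :
    IsLocallyBounded (fun (x : M) (v : TangentSpace (𝓡 d) x) => ‖v‖) :=
  eventually_norm_frame_le

/-- Dominated data for a norm that is independent of the one of the domination. -/
theorem IsDominatedSplitting.exists_isDominatedData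
    [RiemannianBundle (fun x : M => TangentSpace (𝓡 d) x)]
    (h : IsDominatedSplitting f Λ E F s) (hfΛ : f '' Λ = Λ) :
    ∃ P ν' α' β', (∀ c, ContinuousOn (localProj P c)
        (Λ ∩ (chartAt (EuclideanSpace ℝ (Fin d)) c).source)) ∧
      IsLocallyBounded ν' ∧ (∀ x v, 0 ≤ ν' x v) ∧
      IsDominatedData f Λ E F s P (fun (x : M) (v : TangentSpace (𝓡 d) x) => ‖v‖) ν'
        (derivNormOn f E) (fun x => derivNormOn f.symm F (f x)) α' β' := by
  obtain ⟨P, hP, hPc⟩ := h.continuous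
  have hinv := h.invariant
  have hE : ∀ x ∈ Λ, ∀ v ∈ F x, mfderiv (𝓡 d) (𝓡 d) f x v ∈ F (f x) := fun x hx v hv => by
    rw [← hinv.map_right x hx]
    exact Submodule.mem_map_of_mem hv
  -- The second metric is recorded only through its norm function, which keeps its Riemannian
  -- structure apart from the given one.
  have hdom : ∃ ν' : (x : M) → TangentSpace (𝓡 d) x → ℝ, ∃ α' β' : M → ℝ,
      IsLocallyBounded ν' ∧ (∀ x v, 0 ≤ ν' x v) ∧ (∀ x, 0 ≤ α' x) ∧ (∀ x, 0 ≤ β' x) ∧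
      (∀ x ∈ Λ, ∀ v ∈ E x, ν' (f x) (mfderiv (𝓡 d) (𝓡 d) f x v) ≤ α' x * ν' x v) ∧
      (∀ x ∈ Λ, ∀ v ∈ F x, ν' x v ≤ β' x * ν' (f x) (mfderiv (𝓡 d) (𝓡 d) f x v)) ∧
      ∀ x ∈ Λ, α' x * β' x ≤ 1 / 2 := by
    obtain ⟨g, hg⟩ := h.dominated
    let : RiemannianBundle (fun x : M => TangentSpace (𝓡 d) x) := ⟨g.toRiemannianMetric⟩
    exact ⟨fun x v => ‖v‖, derivNormOn f E, fun x => derivNormOn f.symm F (f x),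
      isLocallyBounded_norm, fun _ _ => norm_nonneg _, derivNormOn_nonneg f E,
      fun x => derivNormOn_nonneg _ _ _, fun x _ v hv => derivNormOn_le f E x hv,
      fun x hx v hv => norm_le_derivNormOn_symm (hE x hx v hv), fun x hx => (hg x hx).le⟩
  obtain ⟨ν', α', β', h1, h2, h3, h4, h5, h6, h7⟩ := hdom
  exact ⟨P, ν', α', β', continuousOn_localProj hPc, h1, h2, hinv,
    fun x hx => hfΛ ▸ mem_image_of_mem f hx, fun x hx => (hP x hx).1, fun x hx => (hP x hx).2,
    derivNormOn_nonneg f E, fun x => derivNormOn_nonneg _ _ _, h3, h4,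
    fun x _ v hv => derivNormOn_le f E x hv,
    fun x hx v hv => norm_le_derivNormOn_symm (hE x hx v hv), h5, h6, h7⟩

omit [IsManifold (𝓡 d) ∞ M] in
-- For a periodic point the backward orbit is the forward segment read from its end. The factor
-- indexed by `j` is the norm of the inverse derivative at `f^[j + 1] x`, hence the reflection `j ↦
-- n - 1 - j`.
theorem prod_Ico_le_of_mem_pesinBlock [RiemannianBundle (fun x : M => TangentSpace (𝓡 d) x)]
    {lam : ℝ} {x : M} (hx : x ∈ pesinBlock f Λ E F lam) {n : ℕ} (hn : f^[n] x = x) {m : ℕ}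
    (hm : m ≤ n) :
    ∏ j ∈ Finset.Ico (n - m) n, derivNormOn f.symm F (f (f^[j] x)) ≤ lam ^ m := by
  have hl : Function.LeftInverse f.symm f := f.symm_apply_apply
  have h1 : ∀ i ≤ n, f.symm^[i] x = f^[n - i] x := fun i hi => by
    conv_lhs => rw [← hn, ← Nat.add_sub_cancel' hi, Function.iterate_add_apply]
    exact hl.iterate i _
  refine le_of_eq_of_le ?_ (hx.2 m).2
  refine Finset.prod_bij' (fun j _ => n - 1 - j) (fun i _ => n - 1 - i) ?_ ?_ ?_ ?_ ?_
  · intro j hj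
    rw [Finset.mem_Ico] at hj
    rw [Finset.mem_range]
    omega
  · intro i hi
    rw [Finset.mem_range] at hi
    rw [Finset.mem_Ico]
    omega
  · intro j hj
    rw [Finset.mem_Ico] at hj
    omega
  · intro i hi
    rw [Finset.mem_range] at hi
    omega
  · intro j hj
    rw [Finset.mem_Ico] at hj
    rw [h1 _ (by omega), show n - (n - 1 - j) = j + 1 by omega, Function.iterate_succ_apply']

end Data

theorem exists_edist_iterate_le {X : Type*} [EMetricSpace X] [CompactSpace X] {f : X → X}
    (hf : Continuous f) (N : ℕ) {δ : ℝ≥0∞} (hδ : 0 < δ) :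
    ∃ η > (0 : ℝ≥0∞), ∀ l < N, ∀ x y, edist x y < η → edist (f^[l] x) (f^[l] y) ≤ δ := by
  obtain ⟨η, hη, h⟩ : ∃ η > (0 : ℝ≥0∞), ∀ l ∈ Finset.range N, ∀ x y, edist x y < η →
      edist (f^[l] x) (f^[l] y) ≤ δ := by
    refine exists_pos_forall_mem_finset ⟨1, one_pos⟩ _
      (fun m a b hab h x y hxy => h x y (hxy.trans_le hab)) fun l _ => ?_
    obtain ⟨η, hη, h⟩ := EMetric.uniformContinuous_iff.1
      (CompactSpace.uniformContinuous_of_continuous (hf.iterate l)) δ hδ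
    exact ⟨η, hη, fun x y hxy => (h hxy).le⟩
  exact ⟨η, hη, fun l hl => h l (Finset.mem_range.2 hl)⟩

/-! ### The shadowing hull of periodic points of a Pesin block -/

section Main

variable {d : ℕ} {M : Type*} [EMetricSpace M] [CompactSpace M]
  [ChartedSpace (EuclideanSpace ℝ (Fin d)) M] [IsManifold (𝓡 d) ∞ M]
  [RiemannianBundle (fun x : M => TangentSpace (𝓡 d) x)]
  [IsContinuousRiemannianBundle (EuclideanSpace ℝ (Fin d)) (fun x : M => TangentSpace (𝓡 d) x)]
  {f : M ≃ₘ^1⟮𝓡 d, 𝓡 d⟯ M} {Λ : Set M}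
  {E F : (x : M) → Submodule ℝ (TangentSpace (𝓡 d) x)} {s : ℕ}

/-- Periodic orbits of a Pesin block which are close at time `0` are pairwise separated, and the
orbits which shadow them form a hyperbolic set. -/
theorem IsDominatedSplitting.exists_hyperbolic_shadowHull (h : IsDominatedSplitting f Λ E F s)
    (hΛ : IsCompact Λ) (hfΛ : f '' Λ = Λ) {lam : ℝ} (hlam0 : 0 ≤ lam) (hlam1 : lam < 1)
    {δ₁ : ℝ≥0∞} (hδ₁ : 0 < δ₁) :
    ∃ δ > (0 : ℝ≥0∞), δ ≤ δ₁ ∧ ∃ η > (0 : ℝ≥0∞), ∀ n > 0, ∀ k > 0, ∀ p : Fin k → M,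
      Function.Injective p → (∀ i, p i ∈ pesinBlock f Λ E F lam) →
      (∀ i, Function.IsPeriodicPt f n (p i)) → (∀ i j, edist (p i) (p j) < η) →
      ∃ n' > 0, (∀ i, Function.IsPeriodicPt f n' (p i)) ∧
        (∀ i j, i ≠ j → ∃ l < n', 3 * δ < edist (f^[l] (p i)) (f^[l] (p j))) ∧
        (∀ (a : ℤ → Fin k) (L : ℕ), 0 < L → (∀ m, a (m + L) = a m) →
          ∃ x, IsShadowed f.toHomeomorph n' p δ a x) ∧
        Real.log k / n ≤ Real.log k / n' ∧
        IsHyperbolicSet f (shadowHull f.toHomeomorph n' p δ) s := by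
  obtain ⟨P, ν', α', β', hP, hν', hν0', H⟩ := h.exists_isDominatedData hfΛ
  obtain ⟨T, B, C, r₀, hA⟩ := exists_isGoodAtlas isLocallyBounded_norm hν'
    (fun _ _ => norm_nonneg _) hν0' hΛ hP
  obtain ⟨N, hN, δ₀, hδ₀, hnet⟩ := H.exists_network hA hΛ hlam0 hlam1
  have hδ : 0 < min δ₀ δ₁ := lt_min hδ₀ hδ₁
  set δ := min δ₀ δ₁ with hδdef
  obtain ⟨η₁, hη₁, hnet⟩ := hnet δ hδ (min_le_left _ _)
  obtain ⟨η₂, hη₂, hclose⟩ := exists_edist_iterate_le f.continuous N hδ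
  refine ⟨δ, hδ, min_le_right _ _, min η₁ η₂, lt_min hη₁ hη₂, ?_⟩
  intro n hn k hk p hp hpΛ hper hη
  -- Any common period at least `N` will do. The separation of the segments by more than `3 * δ`
  -- comes from expansivity of the network and injectivity of `p`.
  have hex : ∀ n' ≥ N, (∀ i, Function.IsPeriodicPt f n' (p i)) →
      (∀ i j, i ≠ j → ∃ l < n', 3 * δ < edist (f^[l] (p i)) (f^[l] (p j))) ∧
        (∀ (a : ℤ → Fin k) (L : ℕ), 0 < L → (∀ m, a (m + L) = a m) →
          ∃ x, IsShadowed f.toHomeomorph n' p δ a x) ∧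
        IsHyperbolicSet f (shadowHull f.toHomeomorph n' p δ) s := by
    intro n' hn' hper'
    obtain ⟨q, σ, c, y, t, Q, B, g, ρ, r, hNet⟩ := hnet n' hn' k hk p (fun i => (hpΛ i).1)
      (fun i => hper' i) (fun i m _ => ((hpΛ i).2 m).1)
      (fun i m hm => prod_Ico_le_of_mem_pesinBlock (hpΛ i) (hper' i) hm)
      (fun i j => (hη i j).trans_le (min_le_left _ _))
    refine ⟨fun i j hij => ?_, fun a L hL ha => hNet.exists_isShadowed hL ha,
      hNet.isHyperbolicSet hA.exists_derivNorm_le⟩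
    by_contra! hcon
    exact hij (hp (hNet.eq_of_edist_le (hper' i) (hper' j) hcon))
  rcases le_or_gt N n with hnN | hnN
  · obtain ⟨h1, h2, h3⟩ := hex n hnN hper
    exact ⟨n, hn, hper, h1, h2, le_rfl, h3⟩
  · have hper' : ∀ i, Function.IsPeriodicPt f (n * N) (p i) := fun i => (hper i).mul_const N
    obtain ⟨h1, h2, h3⟩ := hex (n * N) (Nat.le_mul_of_pos_left N hn) hper'
    refine ⟨n * N, Nat.mul_pos hn hN, hper', h1, h2, ?_, h3⟩
    -- Here `n < N`, so all times reduce modulo `n` to times below `N`, at which `η`-close points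
    -- are still `δ`-close. Separation then leaves room for one point only, and `log k = 0` for
    -- either period.
    have hsub : Subsingleton (Fin k) := ⟨fun i j => by
      by_contra hij
      obtain ⟨l, -, hl⟩ := h1 i j hij
      rw [← (hper i).iterate_mod_apply l, ← (hper j).iterate_mod_apply l] at hl
      refine absurd hl (not_lt.2 ?_)
      refine (hclose _ ((Nat.mod_lt l hn).trans hnN) _ _
        ((hη i j).trans_le (min_le_right _ _))).trans ?_
      exact le_mul_of_one_le_left' (by norm_num)⟩
    have hk1 : k = 1 := by
      have := Fintype.card_le_one_iff_subsingleton.2 hsub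
      rw [Fintype.card_fin] at this
      omega
    simp [hk1]

end Main

end DominatedHorseshoe

end

theorem mainTheorem5 {d : ℕ} {M : Type*} [EMetricSpace M] [CompactSpace M]
    [ChartedSpace (EuclideanSpace ℝ (Fin d)) M] [IsManifold (𝓡 d) ∞ M]
    [RiemannianBundle (fun x : M => TangentSpace (𝓡 d) x)]
    [IsContMDiffRiemannianBundle (𝓡 d) ∞ (EuclideanSpace ℝ (Fin d))
      (fun x : M => TangentSpace (𝓡 d) x)]
    [IsRiemannianManifold (𝓡 d) M]
    [MeasurableSpace M] [BorelSpace M]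
    (φ : ℕ → C(M, ℝ)) (hφ : DenseRange φ)
    (f : M ≃ₘ^1⟮𝓡 d, 𝓡 d⟯ M)
    (Λ : Set M) (hΛ : IsCompact Λ) (hfΛ : f '' Λ = Λ)
    (E F : (x : M) → Submodule ℝ (TangentSpace (𝓡 d) x)) (s : ℕ)
    (hEF : DominatedHorseshoe.IsDominatedSplitting f Λ E F s)
    (lam : ℝ) (hlam0 : 0 < lam) (hlam1 : lam < 1) :
    ∀ ε : ℝ, 0 < ε → ∃ η₀ : ℝ, 0 < η₀ ∧
      ∀ (n : ℕ), 0 < n → ∀ (k : ℕ), 0 < k → ∀ (p : Fin k → M), Function.Injective p →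
      (∀ i, p i ∈ DominatedHorseshoe.pesinBlock f Λ E F lam) →
      (∀ i, Function.IsPeriodicPt f n (p i)) →
      ∀ η : ℝ, 0 < η → η < η₀ →
      (∀ i j, i < j → edist (p i) (p j) < ENNReal.ofReal η) →
      DominatedHorseshoe.IsSeparatedSet f n (16 * η) (Set.range p) →
      ∃ K : Set M, DominatedHorseshoe.IsHyperbolicSet f K s ∧
        ((Real.log k / n : ℝ) : EReal) ≤ Dynamics.coverEntropy f K ∧
        ∀ ν ∈ DominatedHorseshoe.invariantMeasuresOn f K,
          ∃ μ ∈ DominatedHorseshoe.periodicHull f p, DominatedHorseshoe.weakDist φ ν μ < ε := by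
  have := DominatedHorseshoe.isContinuousRiemannianBundle_of_isContMDiff (d := d) (M := M)
  intro ε hε
  obtain ⟨N, hN⟩ := DominatedHorseshoe.exists_weakDist_lt φ hε
  -- The shadowing scale is bounded by a modulus of continuity of the first `N` test functions, the
  -- only ones that matter for the distance `ε`.
  obtain ⟨δ₁, hδ₁, hmod⟩ := DominatedHorseshoe.exists_modulus φ (show 0 < ε / 4 by positivity) N
  obtain ⟨δ, hδ, hδδ₁, η, hη, H⟩ :=
    hEF.exists_hyperbolic_shadowHull hΛ hfΛ hlam0.le hlam1 hδ₁
  -- The threshold `η` is an extended number, possibly infinite; any positive real below it serves.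
  obtain ⟨η₀, -, hη₀, hηη₀⟩ := ENNReal.lt_iff_exists_real_btwn.1 hη
  refine ⟨η₀, ENNReal.ofReal_pos.1 hη₀, fun n hn k hk p hp hpΛ hper η' hη' hηη' hclose _ => ?_⟩
  have hlt : ∀ i j, i < j → edist (p i) (p j) < η := fun i j hij =>
    (hclose i j hij).trans_le ((ENNReal.ofReal_le_ofReal hηη'.le).trans hηη₀.le)
  have hlt' : ∀ i j, edist (p i) (p j) < η := fun i j => by
    rcases lt_trichotomy i j with h | rfl | h
    · exact hlt i j h
    · rwa [edist_self]
    · rw [edist_comm]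
      exact hlt j i h
  obtain ⟨n', hn', hper', hsep, hsh, hlog, hK⟩ := H n hn k hk p hp hpΛ hper hlt'
  refine ⟨_, hK, ?_, fun ν hν => ?_⟩
  · exact (EReal.coe_le_coe_iff.2 hlog).trans
      (DominatedHorseshoe.log_div_le_coverEntropy hn' hk hsh hsep hδ)
  · obtain ⟨μ, hμ, hμp, h⟩ :=
      DominatedHorseshoe.exists_mem_periodicHull (φ := f.toHomeomorph) hn' hper' hsep hν
    exact ⟨μ, hμ, hN ν μ hν.1 hμp fun m hm => h (φ m) _ fun x y hxy =>
      hmod m hm x y (hxy.trans hδδ₁)⟩
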